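/- There are a (deterministic) real-RAM algorithm and a constant $C$ such that the following holds. Let $X$ be a set of $n$ points in the Euclidean plane, given as a list of coordinates, no three of which are collinear, and let $t\ge 0$ be an integer with $t<n/2$. On input $(X,t)$ the algorithm halts and outputs a rectangle of arbitrary orientation that encloses at least $n-t$ points of $X$ and has minimum area among all rectangles that do so. For $n\ge 2$ the number of steps is at most $$C\,(kt^3+ktn+n^2\log n),$$ where $k=k(X,t)$ is the number of points of $X$ on the first $t+1$ convex layers of $X$; it is also at most $C\,(n^2\log n+n^2t+nt^3)$. Here the first convex layer of $X$ is the boundary of the convex hull of $X$, and the $(i+1)$-st is the boundary of the convex hull of the points that remain when those on the first $i$ layers are removed. A rectangle is a closed region $\{p+au+bv : a,b\in[0,1]\}$ with $u\perp v$ and area $\|u\|\,\|v\|$; sides of length zero are allowed (this matters only if $n-t\le 2$). A real-RAM algorithm is a fixed program with integer and real variables and arrays indexed by integers, in which each addition, subtraction or comparison of integers, each field operation or comparison of reals, each memory access and each control step costs one step; constants are natural numbers, and there is no conversion from reals to integers. -/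

import Mathlib

/-! ### Plane geometry: rectangles with outliers and convex layers -/

/-- The Euclidean plane. -/
abbrev Plane : Type := EuclideanSpace ℝ (Fin 2)

/-- A rectangle of arbitrary orientation, given by a corner and two perpendicular side vectors.
A side may have length zero, so that sets of at most two points have a smallest rectangle;
such a rectangle lies on a line and never contains three non-collinear points. -/
structure Rectangle where
  corner : Plane
  side₁ : Plane
  side₂ : Plane
  perp : inner ℝ side₁ side₂ = 0

namespace Rectangle

/-- The closed region covered by the rectangle. -/
def region (r : Rectangle) : Set Plane :=
  {x | ∃ a ∈ Set.Icc (0 : ℝ) 1, ∃ b ∈ Set.Icc (0 : ℝ) 1,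
    x = r.corner + a • r.side₁ + b • r.side₂}

/-- The area, the product of the two side lengths. -/
noncomputable def area (r : Rectangle) : ℝ := ‖r.side₁‖ * ‖r.side₂‖

open scoped Classical in
/-- The number of points of `X` that the rectangle encloses. -/
noncomputable def enclosed (r : Rectangle) (X : Finset Plane) : ℕ :=
  (X.filter (fun x => x ∈ r.region)).card

/-- `r` is a minimum enclosing rectangle of `X` with `t` outliers: it encloses at least `|X| - t`
points, and no rectangle that does so has smaller area. -/
def IsMER (r : Rectangle) (X : Finset Plane) (t : ℕ) : Prop :=
  X.card - t ≤ r.enclosed X ∧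
    ∀ r' : Rectangle, X.card - t ≤ r'.enclosed X → r.area ≤ r'.area

end Rectangle

/-- No three distinct points of `X` lie on a line. -/
def NoThreeCollinear (X : Finset Plane) : Prop :=
  ∀ a ∈ X, ∀ b ∈ X, ∀ c ∈ X, a ≠ b → a ≠ c → b ≠ c → ¬ Collinear ℝ {a, b, c}

open scoped Classical in
/-- The points of `Y` on the boundary of the convex hull of `Y`. -/
noncomputable def hullPoints (Y : Finset Plane) : Finset Plane :=
  Y.filter (fun y => y ∈ frontier (convexHull ℝ (Y : Set Plane)))

open scoped Classical in
/-- What is left of `X` when its first `i` convex layers have been removed. -/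
noncomputable def afterLayers (X : Finset Plane) : ℕ → Finset Plane
  | 0 => X
  | i + 1 => afterLayers X i \ hullPoints (afterLayers X i)

open scoped Classical in
/-- The number `k(X, t)` of points on the first `t + 1` convex layers of `X`; the layer with index
`i` (from `0`) consists of the hull points of what is left after `i` layers. -/
noncomputable def layerCount (X : Finset Plane) (t : ℕ) : ℕ :=
  ((Finset.range (t + 1)).biUnion (fun i => hullPoints (afterLayers X i))).card

/-! ### The real RAM

A program is a fixed finite text. It works on integer (natural number) variables, real variables,
and unbounded arrays of integers and of reals, all named by numerals of the program text. Arrays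
are indexed by computed integers. Every arithmetic operation, memory access, comparison and
control step has unit cost. Integers admit only addition, truncated subtraction and comparison;
reals admit the four field operations and comparison. The only constants are natural numbers, and
no real number can be converted to an integer (no rounding). -/

namespace RealRAM

/-- The contents of the memory. -/
structure State where
  ivar : ℕ → ℕ
  rvar : ℕ → ℝ
  iarr : ℕ → ℕ → ℕ
  rarr : ℕ → ℕ → ℝ

/-- Integer expressions; `get a e` is the entry of integer array `a` at index `e`. -/
inductive IExp where
  | const (c : ℕ)
  | var (x : ℕ)
  | get (a : ℕ) (e : IExp)
  | add (e f : IExp)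
  | sub (e f : IExp)

/-- Real expressions; `get a e` is the entry of real array `a` at index `e`. -/
inductive RExp where
  | const (c : ℕ)
  | var (x : ℕ)
  | get (a : ℕ) (e : IExp)
  | add (e f : RExp)
  | sub (e f : RExp)
  | mul (e f : RExp)
  | div (e f : RExp)

/-- Tests. -/
inductive Test where
  | ilt (e f : IExp)
  | rlt (e f : RExp)
  | neg (b : Test)
  | both (b c : Test)

/-- Programs. -/
inductive Prog where
  | skip
  | setI (x : ℕ) (e : IExp)
  | setR (x : ℕ) (e : RExp)
  | storeI (a : ℕ) (i e : IExp)
  | storeR (a : ℕ) (i : IExp) (e : RExp)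
  | seq (p q : Prog)
  | branch (b : Test) (p q : Prog)
  | loop (b : Test) (p : Prog)

namespace IExp

def eval (s : State) : IExp → ℕ
  | const c => c
  | var x => s.ivar x
  | get a e => s.iarr a (e.eval s)
  | add e f => e.eval s + f.eval s
  | sub e f => e.eval s - f.eval s

/-- The cost of an evaluation: the number of operations in the expression. -/
def cost : IExp → ℕ
  | const _ => 1
  | var _ => 1
  | get _ e => e.cost + 1
  | add e f => e.cost + f.cost + 1
  | sub e f => e.cost + f.cost + 1

end IExp

namespace RExp

noncomputable def eval (s : State) : RExp → ℝ
  | const c => (c : ℝ)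
  | var x => s.rvar x
  | get a e => s.rarr a (e.eval s)
  | add e f => e.eval s + f.eval s
  | sub e f => e.eval s - f.eval s
  | mul e f => e.eval s * f.eval s
  | div e f => e.eval s / f.eval s

/-- The cost of an evaluation: the number of operations in the expression. -/
def cost : RExp → ℕ
  | const _ => 1
  | var _ => 1
  | get _ e => e.cost + 1
  | add e f => e.cost + f.cost + 1
  | sub e f => e.cost + f.cost + 1
  | mul e f => e.cost + f.cost + 1
  | div e f => e.cost + f.cost + 1

end RExp

namespace Test

def holds (s : State) : Test → Prop
  | ilt e f => e.eval s < f.eval s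
  | rlt e f => e.eval s < f.eval s
  | neg b => ¬ b.holds s
  | both b c => b.holds s ∧ c.holds s

/-- The cost of an evaluation: the number of operations in the test. -/
def cost : Test → ℕ
  | ilt e f => e.cost + f.cost + 1
  | rlt e f => e.cost + f.cost + 1
  | neg b => b.cost + 1
  | both b c => b.cost + c.cost + 1

end Test

namespace State

def setI (s : State) (x v : ℕ) : State :=
  { s with ivar := Function.update s.ivar x v }

noncomputable def setR (s : State) (x : ℕ) (v : ℝ) : State :=
  { s with rvar := Function.update s.rvar x v }

def storeI (s : State) (a i v : ℕ) : State :=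
  { s with iarr := Function.update s.iarr a (Function.update (s.iarr a) i v) }

noncomputable def storeR (s : State) (a i : ℕ) (v : ℝ) : State :=
  { s with rarr := Function.update s.rarr a (Function.update (s.rarr a) i v) }

end State

/-- `Exec p s T s'`: started in `s`, the program `p` halts in `s'` after exactly `T` steps. -/
inductive Exec : Prog → State → ℕ → State → Prop
  | skip (s : State) : Exec Prog.skip s 1 s
  | setI (s : State) (x : ℕ) (e : IExp) :
      Exec (Prog.setI x e) s (e.cost + 1) (s.setI x (e.eval s))
  | setR (s : State) (x : ℕ) (e : RExp) :
      Exec (Prog.setR x e) s (e.cost + 1) (s.setR x (e.eval s))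
  | storeI (s : State) (a : ℕ) (i e : IExp) :
      Exec (Prog.storeI a i e) s (i.cost + e.cost + 1) (s.storeI a (i.eval s) (e.eval s))
  | storeR (s : State) (a : ℕ) (i : IExp) (e : RExp) :
      Exec (Prog.storeR a i e) s (i.cost + e.cost + 1) (s.storeR a (i.eval s) (e.eval s))
  | seq {p q : Prog} {s s' s'' : State} {T T' : ℕ} :
      Exec p s T s' → Exec q s' T' s'' → Exec (Prog.seq p q) s (T + T') s''
  | branch_true {b : Test} {p q : Prog} {s s' : State} {T : ℕ} :
      b.holds s → Exec p s T s' → Exec (Prog.branch b p q) s (b.cost + 1 + T) s'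
  | branch_false {b : Test} {p q : Prog} {s s' : State} {T : ℕ} :
      ¬ b.holds s → Exec q s T s' → Exec (Prog.branch b p q) s (b.cost + 1 + T) s'
  | loop_done {b : Test} {p : Prog} {s : State} :
      ¬ b.holds s → Exec (Prog.loop b p) s (b.cost + 1) s
  | loop_step {b : Test} {p : Prog} {s s' s'' : State} {T T' : ℕ} :
      b.holds s → Exec p s T s' → Exec (Prog.loop b p) s' T' s'' →
        Exec (Prog.loop b p) s (b.cost + 1 + T + T') s''

/-- The initial memory: integer variables `0` and `1` hold `n` and `t`, real arrays `0` and `1`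
hold the first and the second coordinates of the points, and everything else is `0`. -/
noncomputable def input (n t : ℕ) (p : Fin n → Plane) : State where
  ivar x := if x = 0 then n else if x = 1 then t else 0
  rvar _ := 0
  iarr _ _ := 0
  rarr a i := if h : i < n then
      (if a = 0 then p ⟨i, h⟩ 0 else if a = 1 then p ⟨i, h⟩ 1 else 0)
    else 0

/-- The final memory holds the rectangle `r`: its corner in the real variables `0` and `1`, and
its side vectors in the real variables `2`, `3` and `4`, `5`. -/
def Outputs (s : State) (r : Rectangle) : Prop :=
  s.rvar 0 = r.corner 0 ∧ s.rvar 1 = r.corner 1 ∧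
  s.rvar 2 = r.side₁ 0 ∧ s.rvar 3 = r.side₁ 1 ∧
  s.rvar 4 = r.side₂ 0 ∧ s.rvar 5 = r.side₂ 1

end RealRAM

/-!
# Minimum-area rectangles with outliers on a real RAM

Why a smallest rectangle can be found by looking at lines through two points: turn the bounding box
of a point set, with the same four points on its sides, until a side contains two points. In one of
the two senses of rotation the area does not exceed the initial one (`exists_turn`). Hence
a smallest rectangle with at most `t` points outside may be taken flush with a directed line `p q`
through two points and to the right of it (`exists_flushBox`). At most `t` points lie to the left of
such a line.

Finding these lines: for each `p`, the points `q` are sorted by their angle about `p`, where a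
rational pseudo-angle replaces the angle, and a scan gives for all `q` the number of points to the
left of `p q` (`run_countLeft`). Sorting is done by a tournament tree that is replayed after each
extraction; a table of halves takes the place of division. This costs `n ^ 2 log n` in all.

Searching one line (`run_edge`): if `l ≤ t` points lie to its left, then `m = t + 1 - l` points are
enough for each of the other three sides, because fewer than `m` points of the right half plane are
left out. The same tree selects these points in time `n + m log n`. With the line as the bottom of
the box, for each of the `m` left sides the right side and the top side are moved against each other
along a staircase in time `m` (`run_staircase`). So one line costs `n + t log n + t ^ 2`, up to constants, and `log n` may be
replaced by `√n`.

Counting the lines: the first point of a line with at most `t` points on its left lies on the first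
`t + 1` convex layers, since a point that survives the removal of `j` layers has at least `j` points
strictly beyond it in every direction (`le_card_beyond`). There are at most `4 k (t + 1)` such lines
(`card_pairs_le`): colour the points at random with `2 (t + 1)` colours. A line is called good if its
two points have the same colour and no point on its left has this colour. This has probability at
least `1 / (4 (t + 1))`, while each point is the first one of at most one good line, since of two
lines with the same first point one has the other's second point on its left. The total time is thus
of order `n ^ 2 log n + k t (n + t ^ 2)`, and `k ≤ n` gives the second bound.

Programs are verified with the total-correctness triple `Run p s B Q`, which carries the bound `B`
for the number of steps; every rule also supplies a `Frame`, the statement that memory to which the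
program text does not assign is unchanged.
-/

/-! ### Total correctness with a time budget -/

namespace RealRAM

/-- Started in `s`, the program `p` halts after at most `B` steps in a state with property `Q`. -/
def Run (p : Prog) (s : State) (B : ℕ) (Q : State → Prop) : Prop :=
  ∃ T s', Exec p s T s' ∧ T ≤ B ∧ Q s'

namespace Prog

/-- `p.writesI x`: some assignment in the text of `p` targets the integer variable `x`. -/
def writesI (x : ℕ) : Prog → Bool
  | setI y _ => x == y
  | seq p q => p.writesI x || q.writesI x
  | branch _ p q => p.writesI x || q.writesI x
  | loop _ p => p.writesI x
  | _ => false

/-- `p.writesR x`: some assignment in the text of `p` targets the real variable `x`. -/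
def writesR (x : ℕ) : Prog → Bool
  | setR y _ => x == y
  | seq p q => p.writesR x || q.writesR x
  | branch _ p q => p.writesR x || q.writesR x
  | loop _ p => p.writesR x
  | _ => false

/-- `p.writesIArr a`: some assignment in the text of `p` targets the integer array `a`. -/
def writesIArr (a : ℕ) : Prog → Bool
  | storeI b _ _ => a == b
  | seq p q => p.writesIArr a || q.writesIArr a
  | branch _ p q => p.writesIArr a || q.writesIArr a
  | loop _ p => p.writesIArr a
  | _ => false

/-- `p.writesRArr a`: some assignment in the text of `p` targets the real array `a`. -/
def writesRArr (a : ℕ) : Prog → Bool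
  | storeR b _ _ => a == b
  | seq p q => p.writesRArr a || q.writesRArr a
  | branch _ p q => p.writesRArr a || q.writesRArr a
  | loop _ p => p.writesRArr a
  | _ => false

end Prog

/-- The states `s` and `s'` agree on everything that the text of `p` does not assign to. -/
structure Frame (p : Prog) (s s' : State) : Prop where
  ivar : ∀ x, p.writesI x = false → s'.ivar x = s.ivar x
  rvar : ∀ x, p.writesR x = false → s'.rvar x = s.rvar x
  iarr : ∀ a, p.writesIArr a = false → s'.iarr a = s.iarr a
  rarr : ∀ a, p.writesRArr a = false → s'.rarr a = s.rarr a

theorem Frame.refl (p : Prog) (s : State) : Frame p s s :=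
  ⟨fun _ _ => rfl, fun _ _ => rfl, fun _ _ => rfl, fun _ _ => rfl⟩

theorem Frame.trans {p : Prog} {s s' s'' : State} (h : Frame p s s') (h' : Frame p s' s'') :
    Frame p s s'' :=
  ⟨fun x hx => (h'.ivar x hx).trans (h.ivar x hx), fun x hx => (h'.rvar x hx).trans (h.rvar x hx),
    fun x hx => (h'.iarr x hx).trans (h.iarr x hx), fun x hx => (h'.rarr x hx).trans (h.rarr x hx)⟩

/-- A frame of a program whose text writes less is a frame of one that writes more. -/
theorem Frame.mono {p q : Prog} {s s' : State} (h : Frame p s s')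
    (hI : ∀ x, q.writesI x = false → p.writesI x = false)
    (hR : ∀ x, q.writesR x = false → p.writesR x = false)
    (hIA : ∀ x, q.writesIArr x = false → p.writesIArr x = false)
    (hRA : ∀ x, q.writesRArr x = false → p.writesRArr x = false) : Frame q s s' :=
  ⟨fun x hx => h.ivar x (hI x hx), fun x hx => h.rvar x (hR x hx),
    fun x hx => h.iarr x (hIA x hx), fun x hx => h.rarr x (hRA x hx)⟩

theorem Frame.seq_left {p q : Prog} {s s' : State} (h : Frame p s s') :
    Frame (Prog.seq p q) s s' := by
  apply h.mono <;> intro x hx <;> simp_all [Prog.writesI, Prog.writesR, Prog.writesIArr,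
    Prog.writesRArr]

theorem Frame.seq_right {p q : Prog} {s s' : State} (h : Frame q s s') :
    Frame (Prog.seq p q) s s' := by
  apply h.mono <;> intro x hx <;> simp_all [Prog.writesI, Prog.writesR, Prog.writesIArr,
    Prog.writesRArr]

/-- An execution changes only what the program text assigns to. All rules below pass this fact on,
so that invariants need to speak only of the memory that changes. -/
theorem Exec.frame {p : Prog} {s s' : State} {T : ℕ} (h : Exec p s T s') : Frame p s s' := by
  induction h with
  | skip s => exact Frame.refl _ _
  | setI s x e =>
    refine ⟨fun y hy => ?_, fun _ _ => rfl, fun _ _ => rfl, fun _ _ => rfl⟩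
    exact Function.update_of_ne (by simpa [Prog.writesI] using hy) _ _
  | setR s x e =>
    refine ⟨fun _ _ => rfl, fun y hy => ?_, fun _ _ => rfl, fun _ _ => rfl⟩
    exact Function.update_of_ne (by simpa [Prog.writesR] using hy) _ _
  | storeI s a i e =>
    refine ⟨fun _ _ => rfl, fun _ _ => rfl, fun y hy => ?_, fun _ _ => rfl⟩
    exact Function.update_of_ne (by simpa [Prog.writesIArr] using hy) _ _
  | storeR s a i e =>
    refine ⟨fun _ _ => rfl, fun _ _ => rfl, fun _ _ => rfl, fun y hy => ?_⟩
    exact Function.update_of_ne (by simpa [Prog.writesRArr] using hy) _ _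
  | seq _ _ ih ih' => exact ih.seq_left.trans ih'.seq_right
  | branch_true _ _ ih =>
    apply ih.mono <;> intro x hx <;> simp_all [Prog.writesI, Prog.writesR, Prog.writesIArr,
      Prog.writesRArr]
  | branch_false _ _ ih =>
    apply ih.mono <;> intro x hx <;> simp_all [Prog.writesI, Prog.writesR, Prog.writesIArr,
      Prog.writesRArr]
  | loop_done _ => exact Frame.refl _ _
  | loop_step _ _ _ ih ih' => exact Frame.trans ⟨ih.ivar, ih.rvar, ih.iarr, ih.rarr⟩ ih'

namespace Run

variable {p q : Prog} {s : State} {B B' : ℕ} {Q Q' : State → Prop}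

theorem mono (h : Run p s B Q) (hB : B ≤ B') (hQ : ∀ s', Frame p s s' → Q s' → Q' s') :
    Run p s B' Q' := by
  obtain ⟨T, s', he, hT, hs⟩ := h
  exact ⟨T, s', he, hT.trans hB, hQ s' he.frame hs⟩

theorem seq (h : Run p s B Q) (h' : ∀ s', Frame p s s' → Q s' → Run q s' B' Q') :
    Run (Prog.seq p q) s (B + B') Q' := by
  obtain ⟨T, s', he, hT, hs⟩ := h
  obtain ⟨T', s'', he', hT', hs'⟩ := h' s' he.frame hs
  exact ⟨T + T', s'', he.seq he', by omega, hs'⟩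

theorem branch {b : Test} (h : b.holds s → Run p s B Q) (h' : ¬ b.holds s → Run q s B Q) :
    Run (Prog.branch b p q) s (b.cost + 1 + B) Q := by
  by_cases hb : b.holds s
  · obtain ⟨T, s', he, hT, hs⟩ := h hb
    exact ⟨_, s', he.branch_true hb, by omega, hs⟩
  · obtain ⟨T, s', he, hT, hs⟩ := h' hb
    exact ⟨_, s', he.branch_false hb, by omega, hs⟩

theorem skip (h : Q s) : Run Prog.skip s 1 Q := ⟨1, s, Exec.skip s, le_rfl, h⟩

/-- The rule for loops. The invariant `Inv m` carries a bound `m` for the number of rounds still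
to come. -/
theorem loop {b : Test} (Inv : ℕ → State → Prop)
    (hstep : ∀ m s', Frame p s s' → Inv m s' → b.holds s' →
      ∃ m', m = m' + 1 ∧ Run p s' B (Inv m'))
    (hdone : ∀ m s', Frame p s s' → Inv m s' → ¬ b.holds s' → Q s') (m : ℕ) (h : Inv m s) :
    Run (Prog.loop b p) s (m * (B + b.cost + 1) + (b.cost + 1)) Q := by
  suffices H : ∀ m s', Frame p s s' → Inv m s' →
      Run (Prog.loop b p) s' (m * (B + b.cost + 1) + (b.cost + 1)) Q from
    H m s (Frame.refl _ _) h
  intro m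
  induction m with
  | zero =>
    intro s' hF hI
    by_cases hb : b.holds s'
    · obtain ⟨m', hm, -⟩ := hstep 0 s' hF hI hb
      omega
    · exact ⟨_, s', Exec.loop_done hb, by omega, hdone 0 s' hF hI hb⟩
  | succ m ih =>
    intro s' hF hI
    by_cases hb : b.holds s'
    · obtain ⟨m', hm, T, s₁, he, hT, hI'⟩ := hstep _ s' hF hI hb
      obtain rfl : m = m' := by omega
      obtain ⟨T', s₂, he', hT', hQ⟩ := ih s₁ (hF.trans he.frame) hI'
      refine ⟨_, s₂, Exec.loop_step hb he he', ?_, hQ⟩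
      rw [Nat.succ_mul]
      omega
    · exact ⟨_, s', Exec.loop_done hb, by omega, hdone _ s' hF hI hb⟩

end Run

/-! ### Program notation and programs without loops -/

instance : Add IExp := ⟨IExp.add⟩
instance : Sub IExp := ⟨IExp.sub⟩
instance (c : ℕ) : OfNat IExp c := ⟨IExp.const c⟩
instance : Add RExp := ⟨RExp.add⟩
instance : Sub RExp := ⟨RExp.sub⟩
instance : Mul RExp := ⟨RExp.mul⟩
instance : Div RExp := ⟨RExp.div⟩
instance (c : ℕ) : OfNat RExp c := ⟨RExp.const c⟩

section eval

variable (s : State) (e f : IExp) (g h : RExp) (b c : Test)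

@[simp] theorem IExp.eval_zero : (0 : IExp).eval s = 0 := rfl
@[simp] theorem IExp.eval_one : (1 : IExp).eval s = 1 := rfl
@[simp] theorem IExp.eval_var (x : ℕ) : (IExp.var x).eval s = s.ivar x := rfl
@[simp] theorem IExp.eval_get (a : ℕ) : (IExp.get a e).eval s = s.iarr a (e.eval s) := rfl
@[simp] theorem IExp.eval_add : (e + f).eval s = e.eval s + f.eval s := rfl
@[simp] theorem IExp.eval_sub : (e - f).eval s = e.eval s - f.eval s := rfl
@[simp] theorem RExp.eval_zero : (0 : RExp).eval s = 0 := Nat.cast_zero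
@[simp] theorem RExp.eval_var (x : ℕ) : (RExp.var x).eval s = s.rvar x := rfl
@[simp] theorem RExp.eval_get (a : ℕ) : (RExp.get a e).eval s = s.rarr a (e.eval s) := rfl
@[simp] theorem RExp.eval_add : (g + h).eval s = g.eval s + h.eval s := rfl
@[simp] theorem RExp.eval_sub : (g - h).eval s = g.eval s - h.eval s := rfl
@[simp] theorem RExp.eval_mul : (g * h).eval s = g.eval s * h.eval s := rfl
@[simp] theorem RExp.eval_div : (g / h).eval s = g.eval s / h.eval s := rfl
@[simp] theorem Test.holds_ilt : (Test.ilt e f).holds s ↔ e.eval s < f.eval s := Iff.rfl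
@[simp] theorem Test.holds_rlt : (Test.rlt g h).holds s ↔ g.eval s < h.eval s := Iff.rfl
@[simp] theorem Test.holds_neg : b.neg.holds s ↔ ¬ b.holds s := Iff.rfl
@[simp] theorem Test.holds_both : (b.both c).holds s ↔ b.holds s ∧ c.holds s := Iff.rfl

end eval

namespace State

variable (s : State) (x y a c i j v : ℕ) (r : ℝ)

@[simp] theorem setI_ivar : (s.setI x v).ivar y = if y = x then v else s.ivar y := by
  simp [setI, Function.update_apply]
@[simp] theorem setI_rvar : (s.setI x v).rvar = s.rvar := rfl
@[simp] theorem setI_iarr : (s.setI x v).iarr = s.iarr := rfl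
@[simp] theorem setI_rarr : (s.setI x v).rarr = s.rarr := rfl
@[simp] theorem setR_ivar : (s.setR x r).ivar = s.ivar := rfl
@[simp] theorem setR_rvar : (s.setR x r).rvar y = if y = x then r else s.rvar y := by
  simp [setR, Function.update_apply]
@[simp] theorem setR_iarr : (s.setR x r).iarr = s.iarr := rfl
@[simp] theorem setR_rarr : (s.setR x r).rarr = s.rarr := rfl
@[simp] theorem storeI_ivar : (s.storeI a i v).ivar = s.ivar := rfl
@[simp] theorem storeI_rvar : (s.storeI a i v).rvar = s.rvar := rfl
@[simp] theorem storeI_iarr : (s.storeI a i v).iarr c =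
    if c = a then Function.update (s.iarr a) i v else s.iarr c := by
  simp [storeI, Function.update_apply]
@[simp] theorem storeI_rarr : (s.storeI a i v).rarr = s.rarr := rfl
@[simp] theorem storeR_ivar : (s.storeR a i r).ivar = s.ivar := rfl
@[simp] theorem storeR_rvar : (s.storeR a i r).rvar = s.rvar := rfl
@[simp] theorem storeR_iarr : (s.storeR a i r).iarr = s.iarr := rfl
@[simp] theorem storeR_rarr : (s.storeR a i r).rarr c =
    if c = a then Function.update (s.rarr a) i r else s.rarr c := by
  simp [storeR, Function.update_apply]

end State

namespace Prog

/-- The program contains no loop. -/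
def loopFree : Prog → Bool
  | seq p q => p.loopFree && q.loopFree
  | branch _ p q => p.loopFree && q.loopFree
  | loop _ _ => false
  | _ => true

open scoped Classical in
/-- The final state of a program without loops. -/
noncomputable def result : Prog → State → State
  | skip, s => s
  | setI x e, s => s.setI x (e.eval s)
  | setR x e, s => s.setR x (e.eval s)
  | storeI a i e, s => s.storeI a (i.eval s) (e.eval s)
  | storeR a i e, s => s.storeR a (i.eval s) (e.eval s)
  | seq p q, s => q.result (p.result s)
  | branch b p q, s => if b.holds s then p.result s else q.result s
  | loop _ _, s => s

/-- A bound for the number of steps of a program without loops. -/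
def budget : Prog → ℕ
  | skip => 1
  | setI _ e => e.cost + 1
  | setR _ e => e.cost + 1
  | storeI _ i e => i.cost + e.cost + 1
  | storeR _ i e => i.cost + e.cost + 1
  | seq p q => p.budget + q.budget
  | branch b p q => b.cost + 1 + max p.budget q.budget
  | loop _ _ => 0

theorem exec_result (p : Prog) (hp : p.loopFree = true) (s : State) :
    ∃ T, T ≤ p.budget ∧ Exec p s T (p.result s) := by
  induction p generalizing s with
  | skip => exact ⟨_, le_rfl, Exec.skip s⟩
  | setI x e => exact ⟨_, le_rfl, Exec.setI s x e⟩
  | setR x e => exact ⟨_, le_rfl, Exec.setR s x e⟩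
  | storeI a i e => exact ⟨_, le_rfl, Exec.storeI s a i e⟩
  | storeR a i e => exact ⟨_, le_rfl, Exec.storeR s a i e⟩
  | seq p q ihp ihq =>
    simp only [loopFree, Bool.and_eq_true] at hp
    obtain ⟨T, hT, h⟩ := ihp hp.1 s
    obtain ⟨T', hT', h'⟩ := ihq hp.2 (p.result s)
    exact ⟨_, Nat.add_le_add hT hT', h.seq h'⟩
  | branch b p q ihp ihq =>
    simp only [loopFree, Bool.and_eq_true] at hp
    by_cases hb : b.holds s
    · obtain ⟨T, hT, h⟩ := ihp hp.1 s
      refine ⟨b.cost + 1 + T, ?_, ?_⟩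
      · simp only [budget]; omega
      · simpa only [result, if_pos hb] using h.branch_true hb
    · obtain ⟨T, hT, h⟩ := ihq hp.2 s
      refine ⟨b.cost + 1 + T, ?_, ?_⟩
      · simp only [budget]; omega
      · simpa only [result, if_neg hb] using h.branch_false hb
  | loop b p => simp [loopFree] at hp

/-- `for x < e do p`, counting up from `0`. The bound `e` is evaluated in every round. -/
def forLoop (x : ℕ) (e : IExp) (p : Prog) : Prog :=
  seq (setI x 0) (loop (Test.ilt (IExp.var x) e) (seq p (setI x (IExp.var x + 1))))

end Prog

namespace Run

variable {p q : Prog} {s : State} {B : ℕ} {Q : State → Prop}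

/-- Programs without loops are verified by computing their final state and their cost. -/
theorem of_loopFree (hp : p.loopFree = true) (hB : p.budget ≤ B) (hQ : Q (p.result s)) :
    Run p s B Q := by
  obtain ⟨T, hT, h⟩ := p.exec_result hp s
  exact ⟨T, _, h, hT.trans hB, hQ⟩

/-- The rule for `forLoop`, with a bound `F i` for the steps of the round number `i`. -/
theorem forLoop {x : ℕ} {e : IExp} {N : ℕ} (Inv : ℕ → State → Prop) (F : ℕ → ℕ)
    (hx : p.writesI x = false)
    (he : ∀ s', Frame (Prog.forLoop x e p) s s' → e.eval s' = N)
    (h0 : Inv 0 (s.setI x 0))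
    (hstep : ∀ i s', i < N → s'.ivar x = i → Frame (Prog.forLoop x e p) s s' → Inv i s' →
      Run p s' (F i) (fun s'' => Inv (i + 1) (s''.setI x (i + 1)))) :
    Run (Prog.forLoop x e p) s (∑ i ∈ Finset.range N, (F i + e.cost + 7) + e.cost + 6)
      (Inv N) := by
  set fl := Prog.forLoop x e p with hfl
  have hF0 : Frame fl s (s.setI x 0) := (Exec.setI s x 0).frame.seq_left
  have key : ∀ d i s', i + d = N → s'.ivar x = i → Frame fl s s' → Inv i s' →
      ∃ T s'', Exec (Prog.loop (Test.ilt (IExp.var x) e) (Prog.seq p (Prog.setI x (IExp.var x + 1))))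
        s' T s'' ∧ T ≤ ∑ j ∈ Finset.Ico i N, (F j + e.cost + 7) + e.cost + 3 ∧ Inv N s'' := by
    intro d
    induction d with
    | zero =>
      intro i s' hi hxi hF hI
      have hb : ¬ (Test.ilt (IExp.var x) e).holds s' := by
        simp only [Test.holds_ilt, IExp.eval_var, hxi, he s' hF]; omega
      obtain rfl : i = N := by omega
      refine ⟨_, s', Exec.loop_done hb, ?_, hI⟩
      simp [Test.cost, IExp.cost]; omega
    | succ d ih =>
      intro i s' hi hxi hF hI
      have hb : (Test.ilt (IExp.var x) e).holds s' := by
        simp only [Test.holds_ilt, IExp.eval_var, hxi, he s' hF]; omega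
      obtain ⟨T, s₁, h₁, hT, hI₁⟩ := hstep i s' (by omega) hxi hF hI
      have hx1 : s₁.ivar x = i := by rw [h₁.frame.ivar x hx, hxi]
      have h₂ := h₁.seq (Exec.setI s₁ x (IExp.var x + 1))
      have hev : (IExp.var x + 1 : IExp).eval s₁ = i + 1 := by simp [hx1]
      rw [hev] at h₂
      have hF₂ : Frame fl s (s₁.setI x (i + 1)) := by
        refine hF.trans (Frame.seq_right (q := Prog.loop _ _) ?_)
        have := h₂.frame
        exact ⟨this.ivar, this.rvar, this.iarr, this.rarr⟩
      obtain ⟨T', s₂, h₃, hT', hI₂⟩ := ih (i + 1) _ (by omega) (by simp) hF₂ hI₁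
      refine ⟨_, s₂, Exec.loop_step hb h₂ h₃, ?_, hI₂⟩
      rw [Finset.sum_eq_sum_Ico_succ_bot (by omega : i < N)]
      have hc : (IExp.var x + 1 : IExp).cost = 3 := rfl
      simp only [Test.cost, IExp.cost]
      omega
  obtain ⟨T, s', h, hT, hI⟩ := key N 0 _ (by omega) (by simp) hF0 h0
  refine ⟨_, s', (Exec.setI s x 0).seq h, ?_, hI⟩
  rw [Finset.range_eq_Ico]
  have hc : (0 : IExp).cost = 1 := rfl
  rw [hc]
  omega

/-- The rule for `forLoop` with one bound for the steps of all rounds. -/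
theorem forLoop_const {x : ℕ} {e : IExp} {N : ℕ} (Inv : ℕ → State → Prop)
    (hx : p.writesI x = false)
    (he : ∀ s', Frame (Prog.forLoop x e p) s s' → e.eval s' = N)
    (h0 : Inv 0 (s.setI x 0))
    (hstep : ∀ i s', i < N → s'.ivar x = i → Frame (Prog.forLoop x e p) s s' → Inv i s' →
      Run p s' B (fun s'' => Inv (i + 1) (s''.setI x (i + 1)))) :
    Run (Prog.forLoop x e p) s (N * (B + e.cost + 7) + e.cost + 6) (Inv N) := by
  have h := Run.forLoop (N := N) Inv (fun _ => B) hx he h0 hstep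
  simpa using h

end Run

infixr:60 " ;; " => Prog.seq

end RealRAM

/-! ### Names for the memory cells

Integer variables: the input sizes `v_n`, `v_t`; the numbers `v_p`, `v_q` of the two points on the
current line; loop counters `v_i`, `v_j`; the point or player `v_w`, the tree node `v_v` and its
children's players `v_l`, `v_r`; the length `v_m` of the lists to be selected; the counter `v_c` of
the angular scan; the numbers `v_a`, `v_b` of list entries excluded in the search of boxes, `v_k`
(one more than the number excluded from the third list) and the number `v_e` of points excluded;
the flag `v_found`.

Real variables (`0` to `5` hold the output): the area `r_best` of the output rectangle; the vector
`r_dx`, `r_dy` with its squared length `r_sq`; the extents `r_wd`, `r_ht` and the area `r_area` of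
the current box.

Real arrays: the coordinates `a_x`, `a_y`; the pseudo-angles `a_key`; the coordinates `a_fx`, `a_fy`
along and across the current line, and the negated ones `a_nfx`.

Integer arrays: the table `a_par` of halves; the players `a_leaf` and the nodes `a_node` of the
tournament tree; the angular order `a_ord` and its inverse `a_pos`; the numbers `a_cnt` of points on
the left of lines; the lists `a_lo`, `a_hi`, `a_top` of extreme points with their inverses `a_rlo`,
`a_rhi`, `a_rtop`; the sides `a_right` of the points with respect to the current pivot. -/

namespace RealRAM

notation "v_n" => (0 : ℕ)
notation "v_t" => (1 : ℕ)
notation "v_p" => (2 : ℕ)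
notation "v_q" => (3 : ℕ)
notation "v_i" => (4 : ℕ)
notation "v_j" => (5 : ℕ)
notation "v_w" => (6 : ℕ)
notation "v_v" => (7 : ℕ)
notation "v_m" => (8 : ℕ)
notation "v_c" => (9 : ℕ)
notation "v_a" => (10 : ℕ)
notation "v_b" => (11 : ℕ)
notation "v_k" => (12 : ℕ)
notation "v_e" => (13 : ℕ)
notation "v_found" => (14 : ℕ)
notation "v_l" => (15 : ℕ)
notation "v_r" => (16 : ℕ)

notation "r_best" => (6 : ℕ)
notation "r_dx" => (7 : ℕ)
notation "r_dy" => (8 : ℕ)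
notation "r_sq" => (9 : ℕ)
notation "r_wd" => (10 : ℕ)
notation "r_ht" => (11 : ℕ)
notation "r_area" => (12 : ℕ)

notation "a_x" => (0 : ℕ)
notation "a_y" => (1 : ℕ)
notation "a_key" => (2 : ℕ)
notation "a_fx" => (3 : ℕ)
notation "a_nfx" => (4 : ℕ)
notation "a_fy" => (5 : ℕ)

notation "a_par" => (0 : ℕ)
notation "a_leaf" => (1 : ℕ)
notation "a_node" => (2 : ℕ)
notation "a_ord" => (3 : ℕ)
notation "a_pos" => (4 : ℕ)
notation "a_cnt" => (5 : ℕ)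
notation "a_lo" => (6 : ℕ)
notation "a_rlo" => (7 : ℕ)
notation "a_hi" => (8 : ℕ)
notation "a_rhi" => (9 : ℕ)
notation "a_top" => (10 : ℕ)
notation "a_rtop" => (11 : ℕ)
notation "a_right" => (12 : ℕ)

notation "iv" => IExp.var
notation "ia" => IExp.get
notation "rv" => RExp.var
notation "ra" => RExp.get

/-! ### Selecting the largest keys with a tournament tree -/

open scoped Classical in
/-- The winner of a match between `l` and `r`. A number that is at least `n` stands for nobody. -/
noncomputable def better (n : ℕ) (K : ℕ → ℝ) (l r : ℕ) : ℕ :=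
  if l < n ∧ ¬ (r < n ∧ K l < K r) then l else r

theorem better_eq (n : ℕ) (K : ℕ → ℝ) (l r : ℕ) : better n K l r = l ∨ better n K l r = r := by
  unfold better; split_ifs <;> simp

theorem better_left {n : ℕ} {K : ℕ → ℝ} {l : ℕ} (r : ℕ) (h : l < n) :
    better n K l r < n ∧ K l ≤ K (better n K l r) := by
  unfold better
  split_ifs with h'
  · exact ⟨h, le_rfl⟩
  · have : r < n ∧ K l < K r := by tauto
    exact ⟨this.1, this.2.le⟩

theorem better_right {n : ℕ} {K : ℕ → ℝ} {r : ℕ} (l : ℕ) (h : r < n) :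
    better n K l r < n ∧ K r ≤ K (better n K l r) := by
  unfold better
  split_ifs with h'
  · refine ⟨h'.1, ?_⟩
    by_contra hlt
    exact h'.2 ⟨h, not_le.mp hlt⟩
  · exact ⟨h, le_rfl⟩

/-- The node `w` of the tournament tree holds the winner of the match between its children,
the nodes `2 w` and `2 w + 1`. -/
def Played (n : ℕ) (K : ℕ → ℝ) (node : ℕ → ℕ) (w : ℕ) : Prop :=
  node w = better n K (node (w + w)) (node (w + w + 1))

/-- The leaves `n, …, 2 n - 1` of the tournament tree hold the players `i` with `A i`. -/
def Leaves (n : ℕ) (A : ℕ → Prop) (node : ℕ → ℕ) : Prop :=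
  ∀ i < n, (A i → node (n + i) = i) ∧ (¬ A i → node (n + i) = n)

/-- The root of a tournament tree holds a player with the largest key. -/
theorem root_spec {n : ℕ} {K : ℕ → ℝ} {A : ℕ → Prop} {node : ℕ → ℕ} (hl : Leaves n A node)
    (hp : ∀ w, 1 ≤ w → w < n → Played n K node w) {i : ℕ} (hi : i < n) (hA : A i) :
    node 1 < n ∧ A (node 1) ∧ ∀ j < n, A j → K j ≤ K (node 1) := by
  have alive : ∀ d u, u + d = 2 * n → 1 ≤ u → 1 ≤ d → node u < n → A (node u) := by
    intro d
    induction d using Nat.strong_induction_on with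
    | _ d ih =>
      intro u hu h1 hd h
      by_cases hun : u < n
      · have := hp u h1 hun
        rcases better_eq n K (node (u + u)) (node (u + u + 1)) with h' | h'
        · rw [Played, h'] at this
          rw [this] at h ⊢
          exact ih (2 * n - (u + u)) (by omega) (u + u) (by omega) (by omega) (by omega) h
        · rw [Played, h'] at this
          rw [this] at h ⊢
          exact ih (2 * n - (u + u + 1)) (by omega) (u + u + 1) (by omega) (by omega) (by omega) h
      · obtain ⟨j, rfl⟩ := Nat.exists_eq_add_of_le (not_lt.mp hun)
        by_cases hj : A j
        · rwa [(hl j (by omega)).1 hj]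
        · rw [(hl j (by omega)).2 hj] at h
          omega
  have climb : ∀ u, 1 ≤ u → u < 2 * n → node u < n → node 1 < n ∧ K (node u) ≤ K (node 1) := by
    intro u
    induction u using Nat.strong_induction_on with
    | _ u ih =>
      intro h1 h2 h
      by_cases hu : u = 1
      · subst hu; exact ⟨h, le_rfl⟩
      · have hP := hp (u / 2) (by omega) (by omega)
        have : node (u / 2) < n ∧ K (node u) ≤ K (node (u / 2)) := by
          rw [hP]
          rcases Nat.even_or_odd' u with ⟨c, hc | hc⟩
          · have : u / 2 + u / 2 = u := by omega
            rw [this]; exact better_left _ h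
          · have : u / 2 + u / 2 + 1 = u := by omega
            rw [this]; exact better_right _ h
        have h' := ih (u / 2) (by omega) (by omega) (by omega) this.1
        exact ⟨h'.1, this.2.trans h'.2⟩
  have leaf : ∀ j < n, A j → node 1 < n ∧ K j ≤ K (node 1) := by
    intro j hj hAj
    have h := (hl j hj).1 hAj
    have := climb (n + j) (by omega) (by omega) (by omega)
    rwa [h] at this
  have h1 := (leaf i hi hA).1
  exact ⟨h1, alive (2 * n - 1) 1 (by omega) le_rfl (by omega) h1, fun j hj hAj => (leaf j hj hAj).2⟩

/-- The first `m` entries of `out` list the `m` members of `S` with the largest keys, in descending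
order, and `rank` is the inverse list. Members that are not listed have rank `n`. -/
structure Selected (n m : ℕ) (S : ℕ → Prop) (K : ℕ → ℝ) (out rank : ℕ → ℕ) : Prop where
  out_spec : ∀ j < m, out j < n ∧ S (out j) ∧ rank (out j) = j
  rank_spec : ∀ i < n, rank i = n ∨ (rank i < m ∧ out (rank i) = i)
  sorted : ∀ j < m, ∀ i < n, S i → j ≤ rank i → K i ≤ K (out j)

theorem Selected.exists_unlisted {n m : ℕ} {S : ℕ → Prop} [DecidablePred S] {K : ℕ → ℝ}
    {out rank : ℕ → ℕ} (h : Selected n m S K out rank)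
    (hm : m < ((Finset.range n).filter S).card) : ∃ i < n, S i ∧ rank i = n := by
  by_contra hcon
  push Not at hcon
  have : (Finset.range n).filter S ⊆ (Finset.range m).image out := by
    intro i hi
    simp only [Finset.mem_filter, Finset.mem_range] at hi
    rcases h.rank_spec i hi.1 with h' | h'
    · exact absurd h' (hcon i hi.1 hi.2)
    · exact Finset.mem_image.mpr ⟨rank i, by simpa using h'.1, h'.2⟩
  have := (Finset.card_le_card this).trans Finset.card_image_le
  simp at this
  omega

theorem Selected.step {n m w : ℕ} {S : ℕ → Prop} {K : ℕ → ℝ}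
    {out rank : ℕ → ℕ} (h : Selected n m S K out rank) (hw : w < n) (hS : S w) (hr : rank w = n)
    (hmax : ∀ i < n, S i ∧ rank i = n → K i ≤ K w) (hmn : m < n) :
    Selected n (m + 1) S K (Function.update out m w) (Function.update rank w m) := by
  have hne : ∀ j < m, out j ≠ w := by
    intro j hj hjw
    have := (h.out_spec j hj).2.2
    rw [hjw, hr] at this
    omega
  refine ⟨fun j hj => ?_, fun i hi => ?_, fun j hj i hi hSi hji => ?_⟩
  · by_cases hjm : j = m
    · subst hjm; simp [hw, hS]
    · have hj' : j < m := by omega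
      simpa [Function.update_of_ne hjm, Function.update_of_ne (hne j hj')] using h.out_spec j hj'
  · by_cases hiw : i = w
    · subst hiw; right; simp
    · rw [Function.update_of_ne hiw]
      rcases h.rank_spec i hi with h' | h'
      · exact Or.inl h'
      · right
        rw [Function.update_of_ne (by omega)]
        exact ⟨by omega, h'.2⟩
  · by_cases hjm : j = m
    · subst hjm
      rw [Function.update_self]
      by_cases hiw : i = w
      · rw [hiw]
      · rw [Function.update_of_ne hiw] at hji
        rcases h.rank_spec i hi with h' | h'
        · exact hmax i hi ⟨hSi, h'⟩
        · omega
    · rw [Function.update_of_ne hjm]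
      refine h.sorted j (by omega) i hi hSi ?_
      by_cases hiw : i = w
      · rw [hiw, hr]; omega
      · rwa [Function.update_of_ne hiw] at hji

namespace Prog

/-- Stores the parent `v / 2` of every node `v` of the tournament tree. -/
def parents : Prog :=
  forLoop v_i (iv v_n) (storeI a_par (iv v_i + iv v_i) (iv v_i) ;;
    storeI a_par (iv v_i + iv v_i + 1) (iv v_i))

/-- Plays the match of node `v_v`; the keys are in the real array `K`. -/
def play (K : ℕ) : Prog :=
  setI v_l (ia a_node (iv v_v + iv v_v)) ;;
  setI v_r (ia a_node (iv v_v + iv v_v + 1)) ;;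
  branch (.both (.ilt (iv v_l) (iv v_n))
      (.neg (.both (.ilt (iv v_r) (iv v_n)) (.rlt (ra K (iv v_l)) (ra K (iv v_r))))))
    (storeI a_node (iv v_v) (iv v_l)) (storeI a_node (iv v_v) (iv v_r))

/-- Removes the champion, the entry number `v_j` of the list, and plays its matches again. -/
def extract (K o r : ℕ) : Prog :=
  (setI v_w (ia a_node 1) ;; storeI o (iv v_j) (iv v_w) ;; storeI r (iv v_w) (iv v_j) ;;
    setI v_v (iv v_n + iv v_w) ;; storeI a_node (iv v_v) (iv v_n)) ;;
  loop (.ilt 1 (iv v_v)) (setI v_v (ia a_par (iv v_v)) ;; play K)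

/-- Lists in array `o` the `v_m` players with the largest keys, and their ranks in array `r`.
Player `i` takes part if entry `i` of the array `a_leaf` is `i`, and does not if it is `n`. -/
def select (K o r : ℕ) : Prog :=
  forLoop v_i (iv v_n) (storeI r (iv v_i) (iv v_n) ;;
    storeI a_node (iv v_n + iv v_i) (ia a_leaf (iv v_i))) ;;
  forLoop v_i (iv v_n - 1) (setI v_v (iv v_n - 1 - iv v_i) ;; play K) ;;
  forLoop v_j (iv v_m) (extract K o r)

end Prog

theorem run_parents {s : State} {n : ℕ} (hn : s.ivar v_n = n) :
    Run Prog.parents s (30 * n + 10) (fun s' => ∀ v < 2 * n, s'.iarr a_par v = v / 2) := by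
  refine (Run.forLoop_const (N := n) (B := 20)
    (fun i s' => ∀ v < 2 * i, s'.iarr a_par v = v / 2) rfl ?_ ?_ ?_).mono ?_ (fun _ _ h => h)
  · intro s' hF
    exact (hF.ivar 0 rfl).trans hn
  · intro v hv; omega
  · intro i s' hi hvi hF hI
    refine Run.of_loopFree rfl (by decide) ?_
    intro v hv
    simp only [Prog.result, State.setI_iarr, State.storeI_iarr, if_true, IExp.eval_add,
      IExp.eval_var, IExp.eval_one, State.storeI_ivar, hvi]
    by_cases h1 : v = i + i + 1
    · subst h1; simp; omega
    · rw [Function.update_of_ne h1]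
      by_cases h2 : v = i + i
      · subst h2; simp; omega
      · rw [Function.update_of_ne h2]
        exact hI v (by omega)
  · have : (iv v_n).cost = 1 := rfl
    rw [this]; omega

theorem run_play {s : State} {n : ℕ} (K : ℕ) (hn : s.ivar v_n = n) :
    Run (Prog.play K) s 40 (fun s' => s'.iarr a_node = Function.update (s.iarr a_node)
      (s.ivar v_v) (better n (s.rarr K) (s.iarr a_node (s.ivar v_v + s.ivar v_v))
        (s.iarr a_node (s.ivar v_v + s.ivar v_v + 1)))) := by
  refine Run.of_loopFree rfl (Nat.le_of_ble_eq_true rfl) ?_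
  simp only [Prog.play, Prog.result, better, Test.holds_both, Test.holds_neg, Test.holds_ilt,
    Test.holds_rlt]
  simp [hn]
  split_ifs <;> simp

theorem update_leaf {n w : ℕ} {A : ℕ → Prop} {node : ℕ → ℕ} (hl : Leaves n A node) :
    Leaves n (fun i => A i ∧ i ≠ w) (Function.update node (n + w) n) := by
  intro i hi
  by_cases hiw : i = w
  · subst hiw; simp
  · have : n + i ≠ n + w := by omega
    rw [Function.update_of_ne this]
    simpa [hiw] using hl i hi

theorem update_internal {n v x : ℕ} {A : ℕ → Prop} {node : ℕ → ℕ} (hl : Leaves n A node)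
    (hv : v < n) : Leaves n A (Function.update node v x) := by
  intro i hi
  rw [Function.update_of_ne (by omega)]
  exact hl i hi

/-- A change at node `v` affects, of the matches played, only the one at the parent of `v`. -/
theorem Played.update_of_ne {n v w x : ℕ} {K : ℕ → ℝ} {node : ℕ → ℕ} (h : Played n K node w)
    (hv : w ≠ v) (hv2 : w ≠ v / 2) : Played n K (Function.update node v x) w := by
  unfold Played at *
  rw [Function.update_of_ne hv, Function.update_of_ne (by omega), Function.update_of_ne (by omega)]
  exact h

theorem Played.update_self {n v : ℕ} {K : ℕ → ℝ} {node : ℕ → ℕ} (hv : 1 ≤ v) :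
    Played n K (Function.update node v (better n K (node (v + v)) (node (v + v + 1)))) v := by
  unfold Played
  rw [Function.update_self, Function.update_of_ne (by omega), Function.update_of_ne (by omega)]

section select

variable {K o r : ℕ} {n : ℕ} {S : ℕ → Prop} {key : ℕ → ℝ}

/-- The loop invariant of `Prog.select` after `j` entries have been listed. -/
structure SelectInv (o r n : ℕ) (S : ℕ → Prop) (key : ℕ → ℝ) (j : ℕ) (s : State) : Prop where
  leaves : Leaves n (fun i => S i ∧ s.iarr r i = n) (s.iarr a_node)
  played : ∀ w, 1 ≤ w → w < n → Played n key (s.iarr a_node) w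
  selected : Selected n j S key (s.iarr o) (s.iarr r)

/-- One extraction replays the matches on the path from a leaf to the root, which is as long as the
logarithm of the number of nodes. -/
theorem run_extract (hoN : o ≠ a_node) (hrN : r ≠ a_node) (hor : o ≠ r) (ho : o ≠ a_par)
    (hr : r ≠ a_par) {s : State} {j : ℕ}
    (hn : s.ivar v_n = n) (hj : s.ivar v_j = j) (hkey : s.rarr K = key)
    (hpar : ∀ v < 2 * n, s.iarr a_par v = v / 2) (hjn : j < n)
    (hex : ∃ i < n, S i ∧ s.iarr r i = n) (hI : SelectInv o r n S key j s) :
    Run (Prog.extract K o r) s (Nat.log 2 (2 * n) * 50 + 30)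
      (SelectInv o r n S key (j + 1)) := by
  obtain ⟨i₀, hi₀, hS₀, hr₀⟩ := hex
  obtain ⟨hwn, ⟨hwS, hwr⟩, hmax⟩ := root_spec hI.leaves hI.played hi₀ ⟨hS₀, hr₀⟩
  set w := s.iarr a_node 1 with hw
  have hsel := hI.selected.step hwn hwS hwr hmax hjn
  -- the state after the champion has been recorded and its leaf has been emptied
  have step1 := Run.of_loopFree (s := s) (B := 20) (p := (Prog.setI v_w (ia a_node 1) ;;
    Prog.storeI o (iv v_j) (iv v_w) ;; Prog.storeI r (iv v_w) (iv v_j) ;;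
    Prog.setI v_v (iv v_n + iv v_w) ;; Prog.storeI a_node (iv v_v) (iv v_n)))
    (Q := fun s' => s'.iarr o = Function.update (s.iarr o) j w ∧
      s'.iarr r = Function.update (s.iarr r) w j ∧ s'.ivar v_v = n + w ∧
      s'.iarr a_node = Function.update (s.iarr a_node) (n + w) n) rfl
    (Nat.le_of_ble_eq_true rfl) (by
      simp [Prog.result, hoN, hrN, hor, hor.symm, hoN.symm, hrN.symm, hn, hj, hw])
  refine (step1.seq (B' := Nat.log 2 (2 * n) * (45 + 3 + 1) + (3 + 1))
    (Q' := SelectInv o r n S key (j + 1)) ?_).mono (by omega) (fun _ _ h => h)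
  rintro s₁ hF₁ ⟨hso, hsr, hsv, hsn⟩
  have hrF : ∀ a, a ≠ a_node → (Prog.setI v_v (ia a_par (iv v_v)) ;; Prog.play K).writesIArr a
      = false := by
    intro a ha
    simp [Prog.writesIArr, Prog.play, ha]
  have hn₁ : s₁.ivar v_n = n := (hF₁.ivar 0 rfl).trans hn
  have hkey₁ : s₁.rarr K = key := (hF₁.rarr K rfl).trans hkey
  have hp₁ : ∀ v < 2 * n, s₁.iarr a_par v = v / 2 := by
    rw [hF₁.iarr 0 (by simp [Prog.writesIArr, ho.symm, hr.symm])]; exact hpar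
  -- the matches at and above the parent of the current node remain to be replayed
  refine Run.loop (B := 45) (fun m s' => m = Nat.log 2 (s'.ivar v_v) ∧ 1 ≤ s'.ivar v_v ∧
      s'.ivar v_v < 2 * n ∧
      Leaves n (fun i => S i ∧ s₁.iarr r i = n) (s'.iarr a_node) ∧
      ∀ w, 1 ≤ w → w < n → w ≠ s'.ivar v_v / 2 → Played n key (s'.iarr a_node) w) ?_ ?_
      (Nat.log 2 (s₁.ivar v_v)) ?_ |>.mono ?_ (fun _ _ h => h)
  · rintro m s' hF ⟨hm, h1, h2, hl, hp⟩ hb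
    have hb' : 1 < s'.ivar v_v := by simpa using hb
    have hlog : Nat.log 2 (s'.ivar v_v) = Nat.log 2 (s'.ivar v_v / 2) + 1 :=
      Nat.log_of_one_lt_of_le one_lt_two hb'
    refine ⟨Nat.log 2 (s'.ivar v_v / 2), hm.trans hlog, ?_⟩
    have hn' : s'.ivar v_n = n := (hF.ivar 0 rfl).trans hn₁
    have hpar' : s'.iarr a_par (s'.ivar v_v) = s'.ivar v_v / 2 := by
      rw [hF.iarr 0 rfl]; exact hp₁ _ h2
    have hkey' : s'.rarr K = key := (hF.rarr K rfl).trans hkey₁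
    set v := s'.ivar v_v with hv
    refine (Run.seq (B := 5) (Q := fun s'' => s''.ivar v_v = v / 2 ∧ s''.iarr = s'.iarr)
      (Run.of_loopFree rfl (Nat.le_of_ble_eq_true rfl) ?_) (B' := 40) ?_).mono le_rfl
      (fun _ _ h => h)
    · simp [Prog.result, hpar', ← hv]
    · rintro s₂ hF₂ ⟨hv₂, ha₂⟩
      refine (run_play K ((hF₂.ivar 0 rfl).trans hn')).mono le_rfl ?_
      intro s₃ hF₃ h₃
      have hv₃ : s₃.ivar v_v = v / 2 := (hF₃.ivar 7 rfl).trans hv₂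
      rw [hv₂, ha₂, hF₂.rarr K rfl, hkey'] at h₃
      refine ⟨by rw [hv₃], by rw [hv₃]; omega, by rw [hv₃]; omega, ?_, ?_⟩
      · rw [h₃]; exact update_internal hl (by omega)
      · intro w' hw1 hwn' hwv
        rw [h₃]
        rw [hv₃] at hwv
        by_cases hwe : w' = v / 2
        · subst hwe; exact Played.update_self hw1
        · exact (hp w' hw1 hwn' hwe).update_of_ne hwe hwv
  · rintro m s' hF ⟨hm, h1, h2, hl, hp⟩ hb
    have hb' : s'.ivar v_v = 1 := by
      have : ¬ 1 < s'.ivar v_v := by simpa using hb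
      omega
    have hr' : s'.iarr r = s₁.iarr r := hF.iarr r (hrF r hrN)
    have ho' : s'.iarr o = s₁.iarr o := hF.iarr o (hrF o hoN)
    refine ⟨by rwa [hr'], fun w' hw1 hwn' => hp w' hw1 hwn' (by omega), ?_⟩
    rw [hr', ho', hso, hsr]; exact hsel
  · refine ⟨rfl, by omega, by omega, ?_, ?_⟩
    · rw [hsn, hsr]
      intro i hi
      have := update_leaf (w := w) hI.leaves i hi
      by_cases hiw : i = w
      · subst hiw; simp [hjn.ne]
      · simpa [Function.update_of_ne hiw, hiw] using this
    · intro w' hw1 hwn' hwv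
      rw [hsn]
      exact (hI.played w' hw1 hwn').update_of_ne (by omega) (by omega)
  · have hle : Nat.log 2 (s₁.ivar v_v) ≤ Nat.log 2 (2 * n) := Nat.log_mono_right (by omega)
    have hc : (Test.ilt 1 (iv v_v)).cost = 3 := rfl
    rw [hc]
    exact Nat.add_le_add_right (Nat.mul_le_mul_right _ hle) _

theorem run_select (hoN : o ≠ a_node) (hrN : r ≠ a_node) (hor : o ≠ r) (ho : o ≠ a_par)
    (hr : r ≠ a_par) (hr' : r ≠ a_leaf) [DecidablePred S] {s : State} {m : ℕ}
    (hn : s.ivar v_n = n) (hm : s.ivar v_m = m)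
    (hpar : ∀ v < 2 * n, s.iarr a_par v = v / 2)
    (hleaf : ∀ i < n, s.iarr a_leaf i = if S i then i else n)
    (hcard : m ≤ ((Finset.range n).filter S).card) :
    Run (Prog.select K o r) s (100 * n + 100 + m * (Nat.log 2 (2 * n) * 50 + 50))
      (fun s' => Selected n m S (s.rarr K) (s'.iarr o) (s'.iarr r)) := by
  have hmn : m ≤ n := hcard.trans ((Finset.card_filter_le _ _).trans (by simp))
  -- the leaves
  have step1 := Run.forLoop_const (s := s) (N := n) (B := 20) (x := v_i) (e := iv v_n)
    (p := Prog.storeI r (iv v_i) (iv v_n) ;;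
      Prog.storeI a_node (iv v_n + iv v_i) (ia a_leaf (iv v_i)))
    (fun i s' => (∀ k < i, s'.iarr r k = n ∧ s'.iarr a_node (n + k) = if S k then k else n)) rfl
    (fun s' hF => (hF.ivar 0 rfl).trans hn) (by simp) (by
      intro i s' hi hvi hF hI
      refine Run.of_loopFree rfl (Nat.le_of_ble_eq_true rfl) ?_
      intro k hk
      have hn' : s'.ivar v_n = n := (hF.ivar 0 rfl).trans hn
      have hl' : s'.iarr a_leaf = s.iarr a_leaf :=
        hF.iarr 1 (by simp [Prog.forLoop, Prog.writesIArr, hr'.symm])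
      have hlf := hleaf i hi
      rcases Nat.lt_succ_iff_lt_or_eq.mp hk with hlt | rfl
      · have h1 : k ≠ i := by omega
        have := hI k hlt
        simpa [Prog.result, hrN, hrN.symm, hr'.symm, hn', hvi, Function.update_apply, h1] using this
      · simpa [Prog.result, hrN, hrN.symm, hr'.symm, hn', hvi, hl'] using hlf)
  refine (step1.seq (B' := (n - 1) * (50 + 3 + 7) + 3 + 6 +
    (m * (Nat.log 2 (2 * n) * 50 + 30 + 1 + 7) + 1 + 6)) ?_).mono (by
      have hc : (iv v_n).cost = 1 := rfl
      rw [hc]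
      have : m * (Nat.log 2 (2 * n) * 50 + 30 + 1 + 7) ≤ m * (Nat.log 2 (2 * n) * 50 + 50) :=
        Nat.mul_le_mul_left _ (by omega)
      omega) (fun _ _ h => h)
  intro s₁ hF₁ h₁
  have hn₁ : s₁.ivar v_n = n := (hF₁.ivar 0 rfl).trans hn
  have hm₁ : s₁.ivar v_m = m := (hF₁.ivar 8 rfl).trans hm
  have hk₁ : s₁.rarr K = s.rarr K := hF₁.rarr K rfl
  have hp₁ : ∀ v < 2 * n, s₁.iarr a_par v = v / 2 := by
    rw [hF₁.iarr 0 (by simp [Prog.forLoop, Prog.writesIArr, hr.symm])]; exact hpar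
  have hW : ∀ a, a ≠ a_node → (Prog.forLoop v_i (iv v_n - 1)
      (Prog.setI v_v (iv v_n - 1 - iv v_i) ;; Prog.play K)).writesIArr a = false := by
    intro a ha
    simp [Prog.forLoop, Prog.writesIArr, Prog.play, ha]
  -- the matches, from the last node to the root
  have step2 := Run.forLoop_const (s := s₁) (N := n - 1) (B := 50) (x := v_i) (e := iv v_n - 1)
    (p := Prog.setI v_v (iv v_n - 1 - iv v_i) ;; Prog.play K)
    (fun i s' => Leaves n (fun i => S i ∧ s₁.iarr r i = n) (s'.iarr a_node) ∧
      ∀ w, n - 1 - i < w → w < n → Played n (s.rarr K) (s'.iarr a_node) w) rfl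
    (fun s' hF => by
      have := (hF.ivar 0 rfl).trans hn₁
      simp [this]) (by
      refine ⟨fun i hi => ?_, fun w hw hwn => by omega⟩
      obtain ⟨h, h'⟩ := h₁ i hi
      by_cases hS : S i <;> simp_all) (by
      rintro i s' hi hvi hF ⟨hl, hp⟩
      have hn' : s'.ivar v_n = n := (hF.ivar 0 rfl).trans hn₁
      refine (Run.seq (B := 8) (Q := fun s'' => s''.ivar v_v = n - 1 - i ∧ s''.iarr = s'.iarr)
        (Run.of_loopFree rfl (Nat.le_of_ble_eq_true rfl) ?_) (B' := 40) ?_).mono (by omega)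
        (fun _ _ h => h)
      · simp [Prog.result, hn', hvi]
      · rintro s₂ hF₂ ⟨hv₂, ha₂⟩
        refine (run_play K ((hF₂.ivar 0 rfl).trans hn')).mono le_rfl ?_
        intro s₃ hF₃ h₃
        rw [hv₂, ha₂, hF₂.rarr K rfl, hF.rarr K rfl, hk₁] at h₃
        simp only [State.setI_iarr]
        rw [h₃]
        refine ⟨update_internal hl (by omega), fun w hw hwn => ?_⟩
        by_cases hwe : w = n - 1 - i
        · subst hwe; exact Played.update_self (by omega)
        · exact (hp w (by omega) hwn).update_of_ne hwe (by omega))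
  refine step2.seq ?_
  rintro s₂ hF₂ ⟨hl₂, hp₂⟩
  have hr₂ : s₂.iarr r = s₁.iarr r := hF₂.iarr r (hW r hrN)
  have hW' : ∀ a, a ≠ a_node → a ≠ o → a ≠ r →
      (Prog.forLoop v_j (iv v_m) (Prog.extract K o r)).writesIArr a = false := by
    intro a h1 h2 h3
    simp [Prog.forLoop, Prog.extract, Prog.writesIArr, Prog.play, h1, h2, h3]
  refine (Run.forLoop_const (N := m) (SelectInv o r n S (s.rarr K)) rfl ?_ ?_ ?_).mono le_rfl
    (fun _ _ h => h.selected)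
  · intro s' hF
    exact (hF.ivar 8 rfl).trans ((hF₂.ivar 8 rfl).trans hm₁)
  · refine ⟨?_, fun w hw hwn => hp₂ w (by omega) hwn, ?_⟩
    · simpa [hr₂] using hl₂
    · refine ⟨fun j hj => by omega, fun i hi => Or.inl ?_, fun j hj => by omega⟩
      simpa [hr₂] using (h₁ i hi).1
  · intro j s' hj hvj hF hI
    refine (run_extract hoN hrN hor ho hr ((hF.ivar 0 rfl).trans ((hF₂.ivar 0 rfl).trans hn₁)) hvj
      ((hF.rarr K rfl).trans ((hF₂.rarr K rfl).trans hk₁)) ?_ (by omega)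
      (hI.selected.exists_unlisted (by omega)) hI).mono le_rfl ?_
    · rw [hF.iarr 0 (hW' 0 (by decide) ho.symm hr.symm), hF₂.iarr 0 (hW 0 (by decide))]
      exact hp₁
    · intro s'' _ h
      exact ⟨h.leaves, h.played, h.selected⟩

end select


/-! ### Counting the points to the left of all lines through a point -/

/-- The cross product of the vectors from point `i` to the points `j` and `k`. It is positive if
`k` lies strictly to the left of the directed line from `i` to `j`. -/
def cross (X Y : ℕ → ℝ) (i j k : ℕ) : ℝ :=
  (X j - X i) * (Y k - Y i) - (Y j - Y i) * (X k - X i)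

open scoped Classical in
/-- The number of points strictly to the left of the directed line from point `i` to point `j`. -/
noncomputable def leftCount (n : ℕ) (X Y : ℕ → ℝ) (i j : ℕ) : ℕ :=
  ((Finset.range n).filter (fun k => 0 < cross X Y i j k)).card

/-- The points with numbers below `n` are distinct, and no three of them lie on a line. -/
structure GeneralPosition (n : ℕ) (X Y : ℕ → ℝ) : Prop where
  injective : ∀ i < n, ∀ j < n, X i = X j → Y i = Y j → i = j
  cross_ne_zero : ∀ i < n, ∀ j < n, ∀ k < n, i ≠ j → i ≠ k → j ≠ k → cross X Y i j k ≠ 0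

/-- Point `i` comes after point `p` in the lexicographic order. -/
def IsRight (X Y : ℕ → ℝ) (p i : ℕ) : Prop :=
  0 < X i - X p ∨ (¬ X i - X p < 0 ∧ 0 < Y i - Y p)

open scoped Classical in
/-- First coordinate of the direction from `p` to `i`, turned into the lexicographically positive
half plane. -/
noncomputable def turnedX (X Y : ℕ → ℝ) (p i : ℕ) : ℝ :=
  if IsRight X Y p i then X i - X p else 0 - (X i - X p)

open scoped Classical in
/-- Second coordinate of the direction from `p` to `i`, turned into the lexicographically positive
half plane. -/
noncomputable def turnedY (X Y : ℕ → ℝ) (p i : ℕ) : ℝ :=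
  if IsRight X Y p i then Y i - Y p else 0 - (Y i - Y p)

open scoped Classical in
/-- A substitute for the angle of a vector in the lexicographically positive half plane: the ratio
`y / (x + |y|)`, which needs no square root and increases with the angle. -/
noncomputable def pseudoAngle (x y : ℝ) : ℝ := if y < 0 then y / (x - y) else y / (x + y)

theorem pseudoAngle_lt_iff {x y x' y' : ℝ} (h : 0 < x ∨ (x = 0 ∧ 0 < y))
    (h' : 0 < x' ∨ (x' = 0 ∧ 0 < y')) :
    pseudoAngle x y < pseudoAngle x' y' ↔ 0 < x * y' - y * x' := by
  have hx : 0 ≤ x := by rcases h with h | h <;> linarith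
  have hx' : 0 ≤ x' := by rcases h' with h | h <;> linarith
  unfold pseudoAngle
  split_ifs with h1 h2 h2
  · rw [div_lt_div_iff₀ (by linarith) (by linarith)]
    constructor <;> intro h <;> nlinarith
  · have hpos : 0 < x := by
      rcases h with h | h
      · exact h
      · linarith
    have hd : 0 < x' + y' := by rcases h' with h' | h' <;> linarith
    rw [div_lt_div_iff₀ (by linarith) hd]
    have e1 : 0 < x * y' - y * x' := by
      rcases h' with h' | h'
      · nlinarith [mul_nonneg hx (not_lt.mp h2), mul_pos (neg_pos.mpr h1) h']
      · rw [h'.1]; nlinarith [mul_pos hpos h'.2]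
    refine ⟨fun _ => e1, fun _ => ?_⟩
    nlinarith [mul_nonneg (neg_pos.mpr h1).le (not_lt.mp h2)]
  · have hpos : 0 < x' := by
      rcases h' with h' | h'
      · exact h'
      · linarith
    have hd : 0 < x + y := by rcases h with h | h <;> linarith
    rw [div_lt_div_iff₀ hd (by linarith)]
    have e1 := mul_nonneg hx (neg_pos.mpr h2).le
    have e2 := mul_nonneg (not_lt.mp h1) hx'
    have e3 := mul_nonneg (not_lt.mp h1) (neg_pos.mpr h2).le
    constructor <;> intro h <;> nlinarith
  · have hd : 0 < x + y := by rcases h with h | h <;> linarith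
    have hd' : 0 < x' + y' := by rcases h' with h' | h' <;> linarith
    rw [div_lt_div_iff₀ hd hd']
    constructor <;> intro h <;> nlinarith

/-- A list as long as `S` is large contains all of `S`. -/
theorem Selected.all_listed {n m : ℕ} {S : ℕ → Prop} [DecidablePred S] {K : ℕ → ℝ}
    {out rank : ℕ → ℕ} (h : Selected n m S K out rank)
    (hm : m = ((Finset.range n).filter S).card) {i : ℕ} (hi : i < n) (hS : S i) :
    rank i < m ∧ out (rank i) = i := by
  have hsub : (Finset.range m).image out ⊆ (Finset.range n).filter S := by
    intro i hi
    obtain ⟨j, hj, rfl⟩ := Finset.mem_image.mp hi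
    have := h.out_spec j (by simpa using hj)
    simp [this.1, this.2.1]
  have hinj : Set.InjOn out (Finset.range m) := by
    intro a ha b hb hab
    have ha' := (h.out_spec a (by simpa using ha)).2.2
    rw [hab, (h.out_spec b (by simpa using hb)).2.2] at ha'
    exact ha'.symm
  have heq := Finset.eq_of_subset_of_card_le hsub (by
    rw [Finset.card_image_of_injOn hinj, Finset.card_range, hm])
  have : i ∈ (Finset.range m).image out := by rw [heq]; simp [hi, hS]
  obtain ⟨j, hj, rfl⟩ := Finset.mem_image.mp this
  have hj' : j < m := by simpa using hj
  rw [(h.out_spec j hj').2.2]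
  exact ⟨hj', rfl⟩

theorem Selected.rank_eq_iff {n m : ℕ} {S : ℕ → Prop} {K : ℕ → ℝ}
    {out rank : ℕ → ℕ} (h : Selected n m S K out rank) (hmn : m ≤ n) {i j : ℕ} (hi : i < n)
    (hj : j < m) : rank i = j ↔ i = out j := by
  constructor
  · intro hr
    rcases h.rank_spec i hi with h' | h'
    · omega
    · rw [← hr, h'.2]
  · rintro rfl
    exact (h.out_spec j hj).2.2

section angular

variable {n p : ℕ} {X Y : ℕ → ℝ}

theorem GeneralPosition.turned (h : GeneralPosition n X Y) {i : ℕ} (hp : p < n) (hi : i < n)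
    (hip : i ≠ p) :
    0 < turnedX X Y p i ∨ (turnedX X Y p i = 0 ∧ 0 < turnedY X Y p i) := by
  unfold turnedX turnedY
  by_cases hr : IsRight X Y p i
  · simp only [if_pos hr]
    rcases hr with hr | hr
    · exact Or.inl hr
    · rcases (not_lt.mp hr.1).eq_or_lt with h' | h'
      · exact Or.inr ⟨h'.symm, hr.2⟩
      · exact Or.inl h'
  · simp only [if_neg hr]
    unfold IsRight at hr
    push Not at hr
    by_cases hx : X i - X p < 0
    · left; linarith
    · right
      have hx0 : X i - X p = 0 := le_antisymm hr.1 (not_lt.mp hx)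
      have hy := hr.2 (not_lt.mp hx)
      refine ⟨by linarith, ?_⟩
      rcases hy.eq_or_lt with h' | h'
      · exact absurd (h.injective i hi p hp (by linarith) (by linarith)) hip
      · linarith

/-- The cross product of the turned directions is, up to sign, that of the directions. -/
theorem turned_cross (q k : ℕ) :
    turnedX X Y p q * turnedY X Y p k - turnedY X Y p q * turnedX X Y p k = cross X Y p q k ∧
      (IsRight X Y p q ↔ IsRight X Y p k) ∨
    turnedX X Y p q * turnedY X Y p k - turnedY X Y p q * turnedX X Y p k = - cross X Y p q k ∧
      ¬ (IsRight X Y p q ↔ IsRight X Y p k) := by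
  unfold turnedX turnedY cross
  by_cases hq : IsRight X Y p q <;> by_cases hk : IsRight X Y p k <;> simp [hq, hk] <;> ring

variable {ord pos : ℕ → ℕ}

/-- The positions in the angular order about `p` are those of the turned directions. -/
theorem pos_lt_iff (h : GeneralPosition n X Y) (hp : p < n)
    (hs : Selected n (n - 1) (fun i => i ≠ p)
      (fun i => pseudoAngle (turnedX X Y p i) (turnedY X Y p i)) ord pos)
    (hall : ∀ i < n, i ≠ p → pos i < n - 1 ∧ ord (pos i) = i)
    {q k : ℕ} (hq : q < n) (hk : k < n) (hqp : q ≠ p) (hkp : k ≠ p) (hqk : q ≠ k) :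
    pos k < pos q ↔ 0 < turnedX X Y p q * turnedY X Y p k - turnedY X Y p q * turnedX X Y p k := by
  rw [← pseudoAngle_lt_iff (h.turned hp hq hqp) (h.turned hp hk hkp)]
  constructor
  · intro hlt
    have hle := hs.sorted (pos k) (hall k hk hkp).1 q hq hqp hlt.le
    simp only [(hall k hk hkp).2] at hle
    refine lt_of_le_of_ne hle fun heq => ?_
    have h0 : ¬ 0 < turnedX X Y p q * turnedY X Y p k - turnedY X Y p q * turnedX X Y p k := by
      rw [← pseudoAngle_lt_iff (h.turned hp hq hqp) (h.turned hp hk hkp)]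
      exact heq.not_lt
    have h1 : ¬ 0 < turnedX X Y p k * turnedY X Y p q - turnedY X Y p k * turnedX X Y p q := by
      rw [← pseudoAngle_lt_iff (h.turned hp hk hkp) (h.turned hp hq hqp)]
      exact heq.not_gt
    refine h.cross_ne_zero p hp q hq k hk hqp.symm hkp.symm hqk ?_
    rcases turned_cross (X := X) (Y := Y) (p := p) q k with h' | h' <;> linarith [h'.1]
  · intro hlt
    by_contra hcon
    have hle := hs.sorted (pos q) (hall q hq hqp).1 k hk hkp (not_lt.mp hcon)
    simp only [(hall q hq hqp).2] at hle
    linarith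

open scoped Classical in
/-- When `j` points have been passed in descending angular order about `p`, these are the points
on the left of the next line, directed to the lexicographically positive side. -/
noncomputable def leftSet (n : ℕ) (X Y : ℕ → ℝ) (p : ℕ) (pos : ℕ → ℕ) (j : ℕ) : Finset ℕ :=
  (Finset.range n).filter (fun i => i ≠ p ∧
    ((IsRight X Y p i ∧ pos i < j) ∨ (¬ IsRight X Y p i ∧ j ≤ pos i)))

theorem mem_leftSet {j i : ℕ} : i ∈ leftSet n X Y p pos j ↔ i < n ∧ i ≠ p ∧
    ((IsRight X Y p i ∧ pos i < j) ∨ (¬ IsRight X Y p i ∧ j ≤ pos i)) := by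
  simp [leftSet]

/-- When the scan passes the point `w`, this point enters or leaves the set of points on the left. -/
theorem card_leftSet_succ (hinj : ∀ i < n, i ≠ p → ∀ k < n, k ≠ p → pos i = pos k → i = k) {w : ℕ}
    (hw : w < n) (hwp : w ≠ p) :
    (IsRight X Y p w →
      (leftSet n X Y p pos (pos w + 1)).card = (leftSet n X Y p pos (pos w)).card + 1) ∧
    (¬ IsRight X Y p w →
      (leftSet n X Y p pos (pos w + 1)).card = (leftSet n X Y p pos (pos w)).card - 1) := by
  constructor <;> intro hr
  · rw [← Finset.card_insert_of_notMem (a := w) (by simp [mem_leftSet, hr])]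
    congr 1
    ext i
    rw [Finset.mem_insert, mem_leftSet, mem_leftSet]
    by_cases hiw : i = w
    · subst hiw; simp [hw, hwp, hr]
    · have : i < n → i ≠ p → pos i ≠ pos w := fun h h' he => hiw (hinj i h h' w hw hwp he)
      constructor
      · rintro ⟨h1, h2, h3⟩
        have := this h1 h2
        refine Or.inr ⟨h1, h2, ?_⟩
        rcases h3 with h3 | h3
        · exact Or.inl ⟨h3.1, by omega⟩
        · exact Or.inr ⟨h3.1, by omega⟩
      · rintro (h | ⟨h1, h2, h3⟩)
        · exact absurd h hiw
        · have := this h1 h2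
          refine ⟨h1, h2, ?_⟩
          rcases h3 with h3 | h3
          · exact Or.inl ⟨h3.1, by omega⟩
          · exact Or.inr ⟨h3.1, by omega⟩
  · rw [← Finset.card_erase_of_mem (a := w) (by simp [mem_leftSet, hr, hw, hwp])]
    congr 1
    ext i
    rw [Finset.mem_erase, mem_leftSet, mem_leftSet]
    by_cases hiw : i = w
    · subst hiw; simp [hr]
    · have : i < n → i ≠ p → pos i ≠ pos w := fun h h' he => hiw (hinj i h h' w hw hwp he)
      constructor
      · rintro ⟨h1, h2, h3⟩
        have := this h1 h2
        refine ⟨hiw, h1, h2, ?_⟩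
        rcases h3 with h3 | h3
        · exact Or.inl ⟨h3.1, by omega⟩
        · exact Or.inr ⟨h3.1, by omega⟩
      · rintro ⟨-, h1, h2, h3⟩
        have := this h1 h2
        refine ⟨h1, h2, ?_⟩
        rcases h3 with h3 | h3
        · exact Or.inl ⟨h3.1, by omega⟩
        · exact Or.inr ⟨h3.1, by omega⟩

theorem cross_self_left (i j : ℕ) : cross X Y i j i = 0 := by unfold cross; ring

theorem cross_self_right (i j : ℕ) : cross X Y i j j = 0 := by unfold cross; ring

/-- The number of points left of the line from `p` to `q` can be read off the angular order. If `q`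
precedes `p`, the points in question are those to the right of the turned line. -/
theorem leftCount_eq (h : GeneralPosition n X Y) (hp : p < n)
    (hs : Selected n (n - 1) (fun i => i ≠ p)
      (fun i => pseudoAngle (turnedX X Y p i) (turnedY X Y p i)) ord pos)
    (hall : ∀ i < n, i ≠ p → pos i < n - 1 ∧ ord (pos i) = i)
    {q : ℕ} (hq : q < n) (hqp : q ≠ p) :
    (IsRight X Y p q → leftCount n X Y p q = (leftSet n X Y p pos (pos q)).card) ∧
    (¬ IsRight X Y p q →
      leftCount n X Y p q = n - 1 - 1 - (leftSet n X Y p pos (pos q + 1)).card) := by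
  have hne : ∀ k < n, k ≠ p → k ≠ q → pos k ≠ pos q := by
    intro k hk hkp hkq he
    rw [← (hall k hk hkp).2, he, (hall q hq hqp).2] at hkq
    exact hkq rfl
  have key : ∀ k < n, k ≠ p → k ≠ q → (0 < cross X Y p q k ↔
      ((IsRight X Y p k ↔ IsRight X Y p q) ↔ pos k < pos q)) := by
    intro k hk hkp hkq
    have hne' := h.cross_ne_zero p hp q hq k hk hqp.symm hkp.symm hkq.symm
    have hpos := pos_lt_iff h hp hs hall hq hk hqp hkp hkq.symm
    rcases turned_cross (X := X) (Y := Y) (p := p) q k with h' | h'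
    · rw [h'.1] at hpos
      simp only [hpos, h'.2, true_iff]
    · rw [h'.1] at hpos
      have hno : ¬ (IsRight X Y p k ↔ IsRight X Y p q) := fun hh => h'.2 hh.symm
      simp only [hpos, hno, false_iff]
      constructor
      · intro h1; linarith
      · intro h1
        rcases lt_or_gt_of_ne hne' with h2 | h2
        · exact absurd (by linarith) h1
        · exact h2
  refine ⟨fun hr => ?_, fun hr => ?_⟩
  · unfold leftCount
    congr 1
    ext k
    rw [Finset.mem_filter, Finset.mem_range, mem_leftSet]
    by_cases hkp : k = p
    · subst hkp; simp [cross_self_left]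
    by_cases hkq : k = q
    · subst hkq; simp [cross_self_right, hr]
    constructor
    · rintro ⟨h1, h2⟩
      rw [key k h1 hkp hkq] at h2
      have := hne k h1 hkp hkq
      refine ⟨h1, hkp, ?_⟩
      by_cases hrk : IsRight X Y p k
      · left; simp_all
      · right; simp_all
    · rintro ⟨h1, -, h2⟩
      refine ⟨h1, ?_⟩
      have := hne k h1 hkp hkq
      rw [key k h1 hkp hkq]
      rcases h2 with h2 | h2
      · simp [h2, hr]
      · simp [h2, hr]
  · have hunion : ((Finset.range n).filter (fun k => 0 < cross X Y p q k)) =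
        (((Finset.range n).erase p).erase q) \ leftSet n X Y p pos (pos q + 1) := by
      ext k
      rw [Finset.mem_filter, Finset.mem_range, Finset.mem_sdiff, mem_leftSet, Finset.mem_erase,
        Finset.mem_erase, Finset.mem_range]
      by_cases hkp : k = p
      · subst hkp; simp [cross_self_left]
      by_cases hkq : k = q
      · subst hkq; simp [cross_self_right]
      by_cases hk : k < n
      · have := hne k hk hkp hkq
        rw [key k hk hkp hkq]
        by_cases hrk : IsRight X Y p k
        · simp [hk, hkp, hkq, hrk, hr]; omega
        · simp [hk, hkp, hkq, hrk, hr]; omega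
      · simp [hk]
    unfold leftCount
    rw [hunion, Finset.card_sdiff_of_subset, Finset.card_erase_of_mem, Finset.card_erase_of_mem,
      Finset.card_range]
    · simpa using hp
    · simp [hq, hqp]
    · intro k hk
      rw [mem_leftSet] at hk
      rw [Finset.mem_erase, Finset.mem_erase, Finset.mem_range]
      refine ⟨?_, hk.2.1, hk.1⟩
      rintro rfl
      rcases hk.2.2 with h' | h'
      · exact hr h'.1
      · omega

end angular

/-- The parts of the memory that hold the input and are not changed by the later computation. -/
structure Env (n t : ℕ) (X Y : ℕ → ℝ) (s : State) : Prop where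
  n_eq : s.ivar v_n = n
  t_eq : s.ivar v_t = t
  x_eq : s.rarr a_x = X
  y_eq : s.rarr a_y = Y
  par_eq : ∀ v < 2 * n, s.iarr a_par v = v / 2

theorem Env.of_frame {n t : ℕ} {X Y : ℕ → ℝ} {p : Prog} {s s' : State} (h : Env n t X Y s)
    (hF : Frame p s s') (h1 : p.writesI v_n = false) (h2 : p.writesI v_t = false)
    (h3 : p.writesRArr a_x = false) (h4 : p.writesRArr a_y = false)
    (h5 : p.writesIArr a_par = false) : Env n t X Y s' :=
  ⟨(hF.ivar _ h1).trans h.n_eq, (hF.ivar _ h2).trans h.t_eq, (hF.rarr _ h3).trans h.x_eq,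
    (hF.rarr _ h4).trans h.y_eq, by rw [hF.iarr _ h5]; exact h.par_eq⟩

namespace Prog

/-- Computes the direction from point `v_p` to point `v_i`, turned into the lexicographically
positive half plane. Records the side in `a_right` and counts in `v_c` the points on the negative
side. -/
def turn : Prog :=
  (setR r_dx (ra a_x (iv v_i) - ra a_x (iv v_p)) ;;
    setR r_dy (ra a_y (iv v_i) - ra a_y (iv v_p))) ;;
  branch (.both (.neg (.ilt (iv v_i) (iv v_p))) (.neg (.ilt (iv v_p) (iv v_i))))
    (storeI a_leaf (iv v_i) (iv v_n))
    (branch (.both (.neg (.rlt 0 (rv r_dx)))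
        (.neg (.both (.neg (.rlt (rv r_dx) 0)) (.rlt 0 (rv r_dy)))))
      (storeI a_leaf (iv v_i) (iv v_i) ;; storeI a_right (iv v_i) 0 ;; setI v_c (iv v_c + 1) ;;
        setR r_dx (0 - rv r_dx) ;; setR r_dy (0 - rv r_dy))
      (storeI a_leaf (iv v_i) (iv v_i) ;; storeI a_right (iv v_i) 1))

/-- Stores the pseudo-angle of the turned direction to point `v_i`. -/
def angle : Prog :=
  branch (.rlt (rv r_dy) 0)
    (storeR a_key (iv v_i) (rv r_dy / (rv r_dx - rv r_dy)))
    (storeR a_key (iv v_i) (rv r_dy / (rv r_dx + rv r_dy)))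

/-- Stores in `a_cnt` the number of points to the left of the line from point `v_p` to the point
number `v_j` of the angular order, and updates the counter `v_c`. -/
def countOne : Prog :=
  setI v_w (ia a_ord (iv v_j)) ;;
  branch (.ilt 0 (ia a_right (iv v_w)))
    (storeI a_cnt (iv v_w) (iv v_c) ;; setI v_c (iv v_c + 1))
    (setI v_c (iv v_c - 1) ;; storeI a_cnt (iv v_w) (iv v_n - 1 - 1 - iv v_c))

/-- Stores in `a_cnt`, for all `q`, the number of points left of the line from point `v_p` to
point `q`. -/
def countLeft : Prog :=
  setI v_c 0 ;; forLoop v_i (iv v_n) (turn ;; angle) ;; setI v_m (iv v_n - 1) ;;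
  select a_key a_ord a_pos ;; forLoop v_j (iv v_m) countOne

end Prog

section

variable {n t p : ℕ} {X Y : ℕ → ℝ}

/-- The state of the computation of the directions after `i` rounds. -/
structure DirectionInv (n : ℕ) (X Y : ℕ → ℝ) (p i : ℕ) (s : State) : Prop where
  leaf : ∀ k < i, s.iarr a_leaf k = if k ≠ p then k else n
  right : ∀ k < i, k ≠ p → (0 < s.iarr a_right k ↔ IsRight X Y p k)
  key : ∀ k < i, k ≠ p → s.rarr a_key k = pseudoAngle (turnedX X Y p k) (turnedY X Y p k)
  count : s.ivar v_c = ∑ k ∈ Finset.range i,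
    (open scoped Classical in if k ≠ p ∧ ¬ IsRight X Y p k then 1 else 0)

theorem forall_lt_update {α : Type*} {P : ℕ → α → Prop} {f : ℕ → α} {i : ℕ} {x : α}
    (h : ∀ k < i, P k (f k)) (hx : P i x) : ∀ k < i + 1, P k (Function.update f i x k) := by
  intro k hk
  rcases Nat.lt_succ_iff_lt_or_eq.mp hk with hlt | rfl
  · rw [Function.update_of_ne (by omega)]; exact h k hlt
  · rwa [Function.update_self]

open scoped Classical in
theorem run_turn {s : State} {i : ℕ} (hE : Env n t X Y s) (hp : s.ivar v_p = p)
    (hi : s.ivar v_i = i) :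
    Run Prog.turn s 80 (fun s' =>
      s'.iarr a_leaf = Function.update (s.iarr a_leaf) i (if i ≠ p then i else n) ∧
      (∀ k, k ≠ i → s'.iarr a_right k = s.iarr a_right k) ∧
      (i ≠ p → (0 < s'.iarr a_right i ↔ IsRight X Y p i) ∧
        s'.rvar r_dx = turnedX X Y p i ∧ s'.rvar r_dy = turnedY X Y p i) ∧
      s'.ivar v_c = s.ivar v_c + if i ≠ p ∧ ¬ IsRight X Y p i then 1 else 0) := by
  refine (Run.seq (B := 16) (Q := fun s' => s'.rvar r_dx = X i - X p ∧ s'.rvar r_dy = Y i - Y p ∧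
    s'.iarr = s.iarr ∧ s'.ivar = s.ivar) (Run.of_loopFree rfl (Nat.le_of_ble_eq_true rfl) ?_)
    (B' := 58) (fun s₁ hF h => (Run.branch (B := 39) (fun hb => ?_) (fun hb =>
      (Run.branch (B := 23) (fun hb' => ?_) (fun hb' => ?_)).mono ?_ (fun _ _ h => h))).mono ?_
      (fun _ _ h => h))).mono (Nat.le_of_ble_eq_true rfl) (fun _ _ h => h)
  · simp [Prog.result, hE.x_eq, hE.y_eq, hp, hi]
  any_goals exact Nat.le_of_ble_eq_true rfl
  all_goals
    obtain ⟨hx, hy, ha, hv⟩ := h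
    simp only [Test.holds_both, Test.holds_neg, Test.holds_ilt, IExp.eval_var, hv, hp, hi] at hb
  · obtain rfl : i = p := by omega
    refine Run.of_loopFree rfl (Nat.le_of_ble_eq_true rfl) ?_
    simp +contextual [Prog.result, ha, hv, hi, hE.n_eq]
  all_goals
    have hip : i ≠ p := by omega
    simp only [Test.holds_both, Test.holds_neg, Test.holds_rlt, RExp.eval_var, RExp.eval_zero, hx,
      hy] at hb'
    refine Run.of_loopFree rfl (Nat.le_of_ble_eq_true rfl) ?_
  · have hr : ¬ IsRight X Y p i := by unfold IsRight; tauto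
    refine ⟨?_, ?_, ?_, ?_⟩
    · simp [Prog.result, ha, hv, hi, hip]
    · intro k hk; simp [Prog.result, ha, hv, hi, hk]
    · simp [Prog.result, hv, hi, hr, turnedX, turnedY, hx, hy]
    · simp [Prog.result, hv, hr, hip]
  · have hr : IsRight X Y p i := by unfold IsRight; tauto
    refine ⟨?_, ?_, ?_, ?_⟩
    · simp [Prog.result, ha, hv, hi, hip]
    · intro k hk; simp [Prog.result, ha, hv, hi, hk]
    · simp [Prog.result, hv, hi, hr, turnedX, turnedY, hx, hy]
    · simp [Prog.result, hv, hr]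

theorem run_angle (s : State) :
    Run Prog.angle s 20 (fun s' => s'.rarr a_key =
      Function.update (s.rarr a_key) (s.ivar v_i) (pseudoAngle (s.rvar r_dx) (s.rvar r_dy))) := by
  refine Run.of_loopFree rfl (Nat.le_of_ble_eq_true rfl) ?_
  simp only [Prog.angle, Prog.result, pseudoAngle, Test.holds_rlt, RExp.eval_var, RExp.eval_zero]
  split_ifs <;> simp

theorem run_direction {s : State} {i : ℕ} (hE : Env n t X Y s) (hp : s.ivar v_p = p)
    (hi : s.ivar v_i = i) (hI : DirectionInv n X Y p i s) :
    Run (Prog.turn ;; Prog.angle) s 100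
      (fun s' => DirectionInv n X Y p (i + 1) (s'.setI v_i (i + 1))) := by
  refine (run_turn hE hp hi).seq (B' := 20) ?_
  rintro s₁ hF₁ ⟨h1, h2, h3, h4⟩
  refine (run_angle s₁).mono le_rfl ?_
  intro s₂ hF₂ h5
  have hi₁ : s₁.ivar v_i = i := (hF₁.ivar 4 rfl).trans hi
  have hk₁ : s₁.rarr a_key = s.rarr a_key := hF₁.rarr 2 rfl
  have hl₂ : s₂.iarr a_leaf = s₁.iarr a_leaf := hF₂.iarr 1 rfl
  have hr₂ : s₂.iarr a_right = s₁.iarr a_right := hF₂.iarr 12 rfl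
  have hc₂ : s₂.ivar v_c = s₁.ivar v_c := hF₂.ivar 9 rfl
  refine ⟨?_, ?_, ?_, ?_⟩
  · simp only [State.setI_iarr, hl₂, h1]
    exact forall_lt_update (P := fun k x => x = if k ≠ p then k else n) hI.leaf rfl
  · intro k hk hkp
    simp only [State.setI_iarr, hr₂]
    by_cases hki : k = i
    · subst hki; exact (h3 hkp).1
    · rw [h2 k hki]; exact hI.right k (by omega) hkp
  · simp only [State.setI_rarr, h5, hi₁, hk₁]
    exact forall_lt_update (P := fun k x => k ≠ p → x = pseudoAngle (turnedX X Y p k)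
      (turnedY X Y p k)) hI.key (fun hip => by rw [(h3 hip).2.1, (h3 hip).2.2])
  · rw [State.setI_ivar, if_neg (by decide), hc₂, h4, hI.count, Finset.sum_range_succ]

/-- The numbers of points left of all the lines from `p` are found by one angular scan about `p`. -/
theorem run_countLeft (h : GeneralPosition n X Y) {s : State} (hE : Env n t X Y s)
    (hp : s.ivar v_p = p) (hpn : p < n) :
    Run Prog.countLeft s (400 * n + 300 + n * (Nat.log 2 (2 * n) * 50))
      (fun s' => ∀ q < n, q ≠ p → s'.iarr a_cnt q = leftCount n X Y p q) := by
  classical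
  refine (Run.seq (B := 2) (Q := fun s' => s'.ivar v_c = 0) (Run.of_loopFree rfl
    (Nat.le_of_ble_eq_true rfl) (by simp [Prog.result]))
    (B' := (n * (100 + 1 + 7) + 1 + 6) + (10 + ((100 * n + 100 +
      (n - 1) * (Nat.log 2 (2 * n) * 50 + 50)) + ((n - 1) * (40 + 1 + 7) + 1 + 6)))) ?_).mono ?_
    (fun _ _ h => h)
  swap
  · have : (n - 1) * (Nat.log 2 (2 * n) * 50 + 50) ≤ n * (Nat.log 2 (2 * n) * 50 + 50) :=
      Nat.mul_le_mul_right _ (by omega)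
    rw [mul_add n (Nat.log 2 (2 * n) * 50) 50] at this
    omega
  intro s₁ hF₁ hc₁
  have hE₁ := hE.of_frame hF₁ rfl rfl rfl rfl rfl
  have hp₁ : s₁.ivar v_p = p := (hF₁.ivar 2 rfl).trans hp
  refine (Run.forLoop_const (N := n) (DirectionInv n X Y p) rfl
    (by exact fun s' hF => (hF.ivar 0 rfl).trans hE₁.n_eq) ?_ ?_).seq ?_
  · exact ⟨by simp, by simp, by simp, by simp [hc₁]⟩
  · intro i s' hi hvi hF hI
    exact run_direction (hE₁.of_frame hF rfl rfl rfl rfl rfl) ((hF.ivar 2 rfl).trans hp₁) hvi hI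
  intro s₂ hF₂ hI
  have hE₂ := hE₁.of_frame hF₂ rfl rfl rfl rfl rfl
  refine (Run.seq (Q := fun s' => s'.ivar v_m = n - 1) (Run.of_loopFree rfl
    (Nat.le_of_ble_eq_true rfl) (by simp [Prog.result, hE₂.n_eq]))) ?_
  intro s₃ hF₃ hm₃
  have hE₃ := hE₂.of_frame hF₃ rfl rfl rfl rfl rfl
  have hl₃ : s₃.iarr a_leaf = s₂.iarr a_leaf := hF₃.iarr 1 rfl
  have hcard : n - 1 = ((Finset.range n).filter (fun i => i ≠ p)).card := by
    rw [Finset.filter_ne', Finset.card_erase_of_mem (by simpa using hpn), Finset.card_range]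
  refine (run_select (S := fun i => i ≠ p) (K := a_key) (o := a_ord) (r := a_pos) (by decide)
    (by decide) (by decide) (by decide) (by decide) (by decide) hE₃.n_eq hm₃ hE₃.par_eq
    (fun i hi => by rw [hl₃]; exact hI.leaf i hi) hcard.le).seq ?_
  intro s₄ hF₄ hs₄
  have hk₃ : s₃.rarr a_key = s₂.rarr a_key := hF₃.rarr 2 rfl
  have hs : Selected n (n - 1) (fun i => i ≠ p)
      (fun i => pseudoAngle (turnedX X Y p i) (turnedY X Y p i)) (s₄.iarr a_ord)
      (s₄.iarr a_pos) := by
    refine ⟨hs₄.out_spec, hs₄.rank_spec, fun j hj i hi hip hji => ?_⟩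
    have := hs₄.sorted j hj i hi hip hji
    have ho := hs₄.out_spec j hj
    rwa [hk₃, hI.key i hi hip, hI.key _ ho.1 ho.2.1] at this
  have hall : ∀ i < n, i ≠ p → s₄.iarr a_pos i < n - 1 ∧ s₄.iarr a_ord (s₄.iarr a_pos i) = i :=
    fun i hi hip => hs.all_listed hcard hi hip
  have hinj : ∀ i < n, i ≠ p → ∀ k < n, k ≠ p → s₄.iarr a_pos i = s₄.iarr a_pos k → i = k := by
    intro i hi hip k hk hkp he
    rw [← (hall i hi hip).2, he, (hall k hk hkp).2]
  have hr₄ : ∀ k < n, k ≠ p → (0 < s₄.iarr a_right k ↔ IsRight X Y p k) := by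
    have e : s₄.iarr a_right = s₂.iarr a_right := (hF₄.iarr 12 rfl).trans (hF₃.iarr 12 rfl)
    rw [e]; exact hI.right
  have hc₄ : s₄.ivar v_c = (leftSet n X Y p (s₄.iarr a_pos) 0).card := by
    have e : s₄.ivar v_c = s₂.ivar v_c := (hF₄.ivar 9 rfl).trans (hF₃.ivar 9 rfl)
    rw [e, hI.count, leftSet, Finset.card_filter]
    refine Finset.sum_congr rfl fun k _ => ?_
    simp
  refine (Run.forLoop_const (N := n - 1) (fun j s' =>
      s'.ivar v_c = (leftSet n X Y p (s₄.iarr a_pos) j).card ∧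
      ∀ i < j, s'.iarr a_cnt (s₄.iarr a_ord i) = leftCount n X Y p (s₄.iarr a_ord i)) rfl
    (by exact fun s' hF => (hF.ivar 8 rfl).trans ((hF₄.ivar 8 rfl).trans hm₃)) ?_ ?_).mono le_rfl ?_
  · exact ⟨by simpa using hc₄, by simp⟩
  · rintro j s' hj hvj hF ⟨hc, hcnt⟩
    obtain ⟨hwn, hwp, hpw⟩ := hs.out_spec j hj
    have hn' : s'.ivar v_n = n := (hF.ivar 0 rfl).trans ((hF₄.ivar 0 rfl).trans hE₃.n_eq)
    have hord : s'.iarr a_ord = s₄.iarr a_ord := hF.iarr 3 rfl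
    have hright : s'.iarr a_right = s₄.iarr a_right := hF.iarr 12 rfl
    have hne : ∀ i < j, s₄.iarr a_ord i ≠ s₄.iarr a_ord j := by
      intro i hi he
      have := (hs.out_spec i (by omega)).2.2
      rw [he, hpw] at this
      omega
    have hsucc := card_leftSet_succ (X := X) (Y := Y) hinj hwn hwp
    have hlc := leftCount_eq h hpn hs hall hwn hwp
    rw [hpw] at hsucc hlc
    set w := s₄.iarr a_ord j with hw
    refine Run.of_loopFree rfl (Nat.le_of_ble_eq_true rfl) ?_
    simp only [Prog.countOne, Prog.result, Test.holds_ilt]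
    by_cases hr : IsRight X Y p w
    · have hr' := (hr₄ w hwn hwp).mpr hr
      refine ⟨?_, ?_⟩
      · simp [hord, hright, hvj, ← hw, hr', hc, hsucc.1 hr]
      · refine fun i hi => ?_
        rcases Nat.lt_succ_iff_lt_or_eq.mp hi with hlt | rfl
        · simpa [hord, hright, hvj, ← hw, hr', hc, Function.update_of_ne (hne i hlt)]
            using hcnt i hlt
        · simp [hord, hright, hvj, ← hw, hr', hc, hlc.1 hr]
    · have hr' : s₄.iarr a_right w = 0 := by
        have := mt (hr₄ w hwn hwp).mp hr
        omega
      refine ⟨?_, ?_⟩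
      · simp [hord, hright, hvj, ← hw, hr', hc, hsucc.2 hr]
      · refine fun i hi => ?_
        rcases Nat.lt_succ_iff_lt_or_eq.mp hi with hlt | rfl
        · simpa [hord, hright, hvj, ← hw, hr', hc, Function.update_of_ne (hne i hlt)]
            using hcnt i hlt
        · simp [hord, hright, hvj, ← hw, hr', hc, hlc.2 hr, hsucc.2 hr, hn']
  · rintro s₅ hF₅ ⟨-, hcnt⟩ q hq hqp
    have := hcnt _ (hall q hq hqp).1
    rwa [(hall q hq hqp).2] at this

end


/-! ### The boxes on a line through two points -/

section frame

variable (X Y : ℕ → ℝ) (p q : ℕ)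

/-- The squared distance of the points `p` and `q`. -/
def sqDist : ℝ := (X q - X p) * (X q - X p) + (Y q - Y p) * (Y q - Y p)

/-- The coordinate of point `i` along the direction from `p` to `q`, with origin `p` and scaled by
the distance of `p` and `q`. -/
def along (i : ℕ) : ℝ := (X q - X p) * (X i - X p) + (Y q - Y p) * (Y i - Y p)

/-- The coordinate of point `i` in the direction to the right of the line from `p` to `q`, scaled
by the distance of `p` and `q`. -/
def depth (i : ℕ) : ℝ := (Y q - Y p) * (X i - X p) - (X q - X p) * (Y i - Y p)

/-- The rectangle on the line from `p` to `q` that consists of the points with coordinates between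
`x₁` and `x₂` along the line and between `0` and `h` to its right. -/
noncomputable def frameRect (x₁ x₂ h : ℝ) : Rectangle where
  corner := !₂[X p + x₁ / sqDist X Y p q * (X q - X p), Y p + x₁ / sqDist X Y p q * (Y q - Y p)]
  side₁ := !₂[(x₂ - x₁) / sqDist X Y p q * (X q - X p), (x₂ - x₁) / sqDist X Y p q * (Y q - Y p)]
  side₂ := !₂[h / sqDist X Y p q * (Y q - Y p), 0 - h / sqDist X Y p q * (X q - X p)]
  perp := by
    simp [PiLp.inner_apply, Fin.sum_univ_two]
    ring

end frame

/-! ### The search for the best box on a line -/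

/-- Three lists of the `m` members of `S` with the smallest and the largest first coordinates and
with the largest second coordinates. -/
structure Lists (n m : ℕ) (S : ℕ → Prop) (x y : ℕ → ℝ) (lo rlo hi rhi top rtop : ℕ → ℕ) :
    Prop where
  lo_sel : Selected n m S (fun i => 0 - x i) lo rlo
  hi_sel : Selected n m S x hi rhi
  top_sel : Selected n m S y top rtop
  m_le : m ≤ n

open scoped Classical in
/-- The number of `i < n` with property `Q`. -/
noncomputable def countBelow (n : ℕ) (Q : ℕ → Prop) : ℕ := ((Finset.range n).filter Q).card

theorem countBelow_congr {n : ℕ} {Q Q' : ℕ → Prop} (h : ∀ i < n, (Q i ↔ Q' i)) :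
    countBelow n Q = countBelow n Q' := by
  unfold countBelow
  congr 1
  ext i
  simp only [Finset.mem_filter, Finset.mem_range]
  exact and_congr_right (h i)

theorem countBelow_mono {n : ℕ} {Q Q' : ℕ → Prop} (h : ∀ i < n, Q i → Q' i) :
    countBelow n Q ≤ countBelow n Q' := by
  unfold countBelow
  refine Finset.card_le_card fun i hi => ?_
  simp only [Finset.mem_filter, Finset.mem_range] at hi ⊢
  exact ⟨hi.1, h i hi.1 hi.2⟩

theorem countBelow_succ {n w : ℕ} {Q Q' : ℕ → Prop} (hw : w < n) (hQ : ¬ Q' w)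
    (h : ∀ i < n, (Q i ↔ i = w ∨ Q' i)) : countBelow n Q = countBelow n Q' + 1 := by
  unfold countBelow
  rw [← Finset.card_insert_of_notMem (a := w) (by simp [hQ])]
  congr 1
  ext i
  simp only [Finset.mem_filter, Finset.mem_range, Finset.mem_insert]
  constructor
  · rintro ⟨h1, h2⟩
    exact ((h i h1).mp h2).imp_right fun h3 => ⟨h1, h3⟩
  · rintro (rfl | ⟨h1, h2⟩)
    · exact ⟨hw, (h _ hw).mpr (Or.inl rfl)⟩
    · exact ⟨h1, (h i h1).mpr (Or.inr h2)⟩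

/-- The number of members of `S` that are among the first `a`, `b`, `j` of the three lists. -/
noncomputable def excluded (n : ℕ) (S : ℕ → Prop) (rlo rhi rtop : ℕ → ℕ) (a b j : ℕ) : ℕ :=
  countBelow n (fun i => S i ∧ (rlo i < a ∨ rhi i < b ∨ rtop i < j))

open scoped Classical in
/-- One more list entry adds at most one point to those excluded. -/
theorem Selected.card_succ {n m : ℕ} {S : ℕ → Prop} {K : ℕ → ℝ}
    {out rank : ℕ → ℕ} (h : Selected n m S K out rank) (hmn : m ≤ n) (P : ℕ → Prop) {b : ℕ}
    (hb : b < m) :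
    countBelow n (fun i => S i ∧ (rank i < b + 1 ∨ P i)) =
      countBelow n (fun i => S i ∧ (rank i < b ∨ P i)) + if P (out b) then 0 else 1 := by
  obtain ⟨hn, hS, hr⟩ := h.out_spec b hb
  have hiff : ∀ i < n, (rank i < b + 1 ↔ rank i < b ∨ i = out b) := by
    intro i hi
    rw [← h.rank_eq_iff hmn hi hb]
    omega
  split_ifs with hP
  · rw [add_zero]
    refine countBelow_congr fun i hi => ?_
    rw [hiff i hi]
    constructor
    · rintro ⟨h1, (h2 | rfl) | h2⟩
      · exact ⟨h1, Or.inl h2⟩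
      · exact ⟨h1, Or.inr hP⟩
      · exact ⟨h1, Or.inr h2⟩
    · rintro ⟨h1, h2 | h2⟩
      · exact ⟨h1, Or.inl (Or.inl h2)⟩
      · exact ⟨h1, Or.inr h2⟩
  · refine countBelow_succ hn (fun h => ?_) fun i hi => ?_
    · rcases h.2 with h | h
      · omega
      · exact hP h
    rw [hiff i hi]
    constructor
    · rintro ⟨h1, (h2 | h2) | h2⟩
      · exact Or.inr ⟨h1, Or.inl h2⟩
      · exact Or.inl h2
      · exact Or.inr ⟨h1, Or.inr h2⟩
    · rintro (rfl | ⟨h1, h2⟩)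
      · exact ⟨hS, Or.inl (Or.inr rfl)⟩
      · exact ⟨h1, h2.imp_left Or.inl⟩

section lists

variable {n m : ℕ} {S : ℕ → Prop} {x y : ℕ → ℝ} {lo rlo hi rhi top rtop : ℕ → ℕ}

theorem excluded_mono {a b b' j j' : ℕ} (hb : b ≤ b') (hj : j ≤ j') :
    excluded n S rlo rhi rtop a b j ≤ excluded n S rlo rhi rtop a b' j' := by
  exact countBelow_mono fun i _ h => ⟨h.1, by omega⟩

open scoped Classical in
theorem Lists.excluded_succ_hi (h : Lists n m S x y lo rlo hi rhi top rtop) {a b j : ℕ}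
    (hb : b < m) : excluded n S rlo rhi rtop a (b + 1) j = excluded n S rlo rhi rtop a b j +
      if ¬ rlo (hi b) < a ∧ ¬ rtop (hi b) < j then 1 else 0 := by
  have := h.hi_sel.card_succ h.m_le (fun i => rlo i < a ∨ rtop i < j) hb
  unfold excluded
  simp only [or_left_comm (a := rlo _ < a)]
  rw [this]
  split_ifs <;> tauto

open scoped Classical in
theorem Lists.excluded_succ_top (h : Lists n m S x y lo rlo hi rhi top rtop) {a b j : ℕ}
    (hj : j < m) : excluded n S rlo rhi rtop a b (j + 1) = excluded n S rlo rhi rtop a b j +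
      if ¬ rlo (top j) < a ∧ ¬ rhi (top j) < b then 1 else 0 := by
  have := h.top_sel.card_succ h.m_le (fun i => rlo i < a ∨ rhi i < b) hj
  unfold excluded
  have e : ∀ i c, (rlo i < a ∨ rhi i < b ∨ rtop i < c) ↔ (rtop i < c ∨ rlo i < a ∨ rhi i < b) := by
    intros; tauto
  simp only [e]
  rw [this]
  split_ifs <;> tauto

theorem Lists.excluded_lo (h : Lists n m S x y lo rlo hi rhi top rtop) {a : ℕ} (ha : a ≤ m) :
    excluded n S rlo rhi rtop a 0 0 = a := by
  induction a with
  | zero => simp [excluded, countBelow]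
  | succ a ih =>
    have := h.lo_sel.card_succ h.m_le (fun i => rhi i < 0 ∨ rtop i < 0) (show a < m by omega)
    rw [excluded, this]
    have ih' := ih (by omega)
    rw [excluded] at ih'
    rw [ih']
    simp

/-- If fewer than `|S|` points are excluded, then the box is not empty. -/
theorem exists_kept {N a b j : ℕ} (hN : N ≤ countBelow n S)
    (he : excluded n S rlo rhi rtop a b j < N) :
    ∃ i < n, S i ∧ a ≤ rlo i ∧ b ≤ rhi i ∧ j ≤ rtop i := by
  by_contra hcon
  push Not at hcon
  refine absurd he (not_lt.mpr (hN.trans (countBelow_mono fun i hi hS => ⟨hS, ?_⟩)))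
  have := hcon i hi hS
  by_contra h'
  push Not at h'
  have := this h'.1 h'.2.1
  omega

/-- The area of a box, up to the scale: `a`, `b`, `j` entries of the three lists are excluded. -/
noncomputable def boxArea (x y : ℕ → ℝ) (lo hi top : ℕ → ℕ) (d : ℝ) (a b j : ℕ) : ℝ :=
  (x (hi b) - x (lo a)) * y (top j) / d

/-- Excluding more of the third list makes a nonempty box smaller. -/
theorem Lists.boxArea_le (h : Lists n m S x y lo rlo hi rhi top rtop)
    (hm : m ≤ countBelow n S) {d : ℝ} (hd : 0 ≤ d) {a b j j' : ℕ} (ha : a < m)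
    (hb : b < m) (hj : j ≤ j') (hj' : j' < m)
    (he : excluded n S rlo rhi rtop a b j' < m) :
    boxArea x y lo hi top d a b j' ≤ boxArea x y lo hi top d a b j := by
  obtain ⟨i, hi, hS, h1, h2, h3⟩ := exists_kept hm he
  have e1 := h.lo_sel.sorted a ha i hi hS h1
  have e2 := h.hi_sel.sorted b hb i hi hS h2
  have ho := h.top_sel.out_spec j' hj'
  have e3 := h.top_sel.sorted j (by omega) (top j') ho.1 ho.2.1 (by omega)
  unfold boxArea
  refine div_le_div_of_nonneg_right ?_ hd
  exact mul_le_mul_of_nonneg_left e3 (by linarith)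

end lists

/-! ### Memory during the search -/

/-- The state holds a sound result so far: before a box has been found, the initial rectangle,
and then one with the property `Encl` whose area is recorded in `r_best`. -/
def Sound (Init Encl : Rectangle → Prop) (s : State) : Prop :=
  ∃ r, Outputs s r ∧ (s.ivar v_found = 0 → Init r) ∧
    (0 < s.ivar v_found → Encl r ∧ r.area = s.rvar r_best)

/-- A rectangle of area at most `v` has been found. -/
def Reached (s : State) (v : ℝ) : Prop := 0 < s.ivar v_found ∧ s.rvar r_best ≤ v

/-- The result after some part of the computation is sound and no worse than before. -/
structure Improves (Init Encl : Rectangle → Prop) (s s' : State) : Prop where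
  sound : Sound Init Encl s'
  keep : ∀ v, Reached s v → Reached s' v

theorem Improves.trans {Init Encl : Rectangle → Prop} {s s' s'' : State}
    (h : Improves Init Encl s s') (h' : Improves Init Encl s' s'') : Improves Init Encl s s'' :=
  ⟨h'.sound, fun v hv => h'.keep v (h.keep v hv)⟩

/-- The program does not touch the output and the record of its area. -/
def Prog.keepsOutput (p : Prog) : Bool :=
  !p.writesI v_found && !p.writesR 0 && !p.writesR 1 && !p.writesR 2 && !p.writesR 3 &&
    !p.writesR 4 && !p.writesR 5 && !p.writesR r_best

theorem Improves.of_frame {Init Encl : Rectangle → Prop} {p : Prog} {s s' : State}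
    (hp : p.keepsOutput = true) (hF : Frame p s s') (h : Sound Init Encl s) :
    Improves Init Encl s s' := by
  simp only [Prog.keepsOutput, Bool.and_eq_true, Bool.not_eq_true'] at hp
  obtain ⟨⟨⟨⟨⟨⟨⟨h1, h2⟩, h3⟩, h4⟩, h5⟩, h6⟩, h7⟩, h8⟩ := hp
  constructor
  · obtain ⟨r, hr, hr'⟩ := h
    refine ⟨r, ?_, ?_⟩
    · unfold Outputs at *
      rwa [hF.rvar _ h2, hF.rvar _ h3, hF.rvar _ h4, hF.rvar _ h5, hF.rvar _ h6, hF.rvar _ h7]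
    · rwa [hF.ivar _ h1, hF.rvar _ h8]
  · intro v hv
    rwa [Reached, hF.ivar _ h1, hF.rvar _ h8]

/-- The memory during the search for the best box on the line from `p` to `q`. -/
structure EdgeEnv (X Y : ℕ → ℝ) (p q m : ℕ) (lo rlo hi rhi top rtop : ℕ → ℕ) (x y : ℕ → ℝ)
    (s : State) : Prop where
  p_eq : s.ivar v_p = p
  m_eq : s.ivar v_m = m
  x_eq : s.rarr a_x = X
  y_eq : s.rarr a_y = Y
  dx_eq : s.rvar r_dx = X q - X p
  dy_eq : s.rvar r_dy = Y q - Y p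
  sq_eq : s.rvar r_sq = sqDist X Y p q
  fx_eq : s.rarr a_fx = x
  fy_eq : s.rarr a_fy = y
  lo_eq : s.iarr a_lo = lo
  rlo_eq : s.iarr a_rlo = rlo
  hi_eq : s.iarr a_hi = hi
  rhi_eq : s.iarr a_rhi = rhi
  top_eq : s.iarr a_top = top
  rtop_eq : s.iarr a_rtop = rtop

/-- The program does not touch the memory described by `EdgeEnv`. -/
def Prog.keepsEdge (p : Prog) : Bool :=
  !p.writesI v_p && !p.writesI v_m && !p.writesRArr a_x && !p.writesRArr a_y && !p.writesR r_dx &&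
  !p.writesR r_dy && !p.writesR r_sq && !p.writesRArr a_fx && !p.writesRArr a_fy &&
  !p.writesIArr a_lo && !p.writesIArr a_rlo && !p.writesIArr a_hi && !p.writesIArr a_rhi &&
  !p.writesIArr a_top && !p.writesIArr a_rtop

theorem EdgeEnv.of_frame {X Y : ℕ → ℝ} {p q m : ℕ} {lo rlo hi rhi top rtop : ℕ → ℕ} {x y : ℕ → ℝ}
    {s s' : State} {P : Prog} (h : EdgeEnv X Y p q m lo rlo hi rhi top rtop x y s)
    (hF : Frame P s s') (hP : P.keepsEdge = true) :
    EdgeEnv X Y p q m lo rlo hi rhi top rtop x y s' := by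
  simp only [Prog.keepsEdge, Bool.and_eq_true, Bool.not_eq_true'] at hP
  obtain ⟨⟨⟨⟨⟨⟨⟨⟨⟨⟨⟨⟨⟨⟨h1, h2⟩, h3⟩, h4⟩, h5⟩, h6⟩, h7⟩, h8⟩, h9⟩, h10⟩, h11⟩, h12⟩, h13⟩, h14⟩,
    h15⟩ := hP
  exact ⟨(hF.ivar _ h1).trans h.p_eq, (hF.ivar _ h2).trans h.m_eq, (hF.rarr _ h3).trans h.x_eq,
    (hF.rarr _ h4).trans h.y_eq, (hF.rvar _ h5).trans h.dx_eq, (hF.rvar _ h6).trans h.dy_eq,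
    (hF.rvar _ h7).trans h.sq_eq, (hF.rarr _ h8).trans h.fx_eq, (hF.rarr _ h9).trans h.fy_eq,
    (hF.iarr _ h10).trans h.lo_eq, (hF.iarr _ h11).trans h.rlo_eq, (hF.iarr _ h12).trans h.hi_eq,
    (hF.iarr _ h13).trans h.rhi_eq, (hF.iarr _ h14).trans h.top_eq,
    (hF.iarr _ h15).trans h.rtop_eq⟩

namespace Prog

/-- Writes the box with `v_a`, `v_b` and `v_k - 1` list entries excluded to the output if no box
has been found or its area is smaller than the best one. -/
def candidate : Prog :=
  (setR r_wd (ra a_fx (ia a_hi (iv v_b)) - ra a_fx (ia a_lo (iv v_a))) ;;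
    setR r_ht (ra a_fy (ia a_top (iv v_k - 1))) ;;
    setR r_area (rv r_wd * rv r_ht / rv r_sq)) ;;
  branch (.both (.ilt 0 (iv v_found)) (.neg (.rlt (rv r_area) (rv r_best))))
    skip
    (setI v_found 1 ;; setR r_best (rv r_area) ;;
      setR 0 (ra a_x (iv v_p) + ra a_fx (ia a_lo (iv v_a)) / rv r_sq * rv r_dx) ;;
      setR 1 (ra a_y (iv v_p) + ra a_fx (ia a_lo (iv v_a)) / rv r_sq * rv r_dy) ;;
      setR 2 (rv r_wd / rv r_sq * rv r_dx) ;; setR 3 (rv r_wd / rv r_sq * rv r_dy) ;;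
      setR 4 (rv r_ht / rv r_sq * rv r_dy) ;; setR 5 (0 - rv r_ht / rv r_sq * rv r_dx))

/-- Excludes one more entry of the list of large first coordinates. The number of excluded points
is in `v_e`. -/
def excludeHi : Prog :=
  setI v_w (ia a_hi (iv v_b)) ;; setI v_b (iv v_b + 1) ;;
  branch (.both (.neg (.ilt (ia a_rlo (iv v_w)) (iv v_a)))
      (.neg (.ilt (ia a_rtop (iv v_w)) (iv v_k - 1))))
    (setI v_e (iv v_e + 1)) skip

/-- Excludes one entry fewer of the list of large second coordinates. -/
def includeTop : Prog :=
  setI v_k (iv v_k - 1) ;; setI v_w (ia a_top (iv v_k - 1)) ;;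
  branch (.both (.neg (.ilt (ia a_rlo (iv v_w)) (iv v_a)))
      (.neg (.ilt (ia a_rhi (iv v_w)) (iv v_b))))
    (setI v_e (iv v_e - 1)) skip

/-- Tries, with the first `v_a` entries of the list of small first coordinates excluded, the best
boxes: as more entries of one of the other two lists are excluded, fewer of the other one are. -/
def staircase : Prog :=
  (setI v_e (iv v_a) ;; setI v_b 0 ;; setI v_k (iv v_m)) ;;
  forLoop v_j (iv v_m - 1) (setI v_w (ia a_top (iv v_j)) ;;
    branch (.ilt (ia a_rlo (iv v_w)) (iv v_a)) skip (setI v_e (iv v_e + 1))) ;;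
  loop (.both (.ilt (iv v_b) (iv v_m)) (.ilt 0 (iv v_k)))
    (branch (.ilt (iv v_e) (iv v_m)) (candidate ;; excludeHi) includeTop)

end Prog

section search

variable {X Y : ℕ → ℝ} {n p q m : ℕ} {S : ℕ → Prop} {lo rlo hi rhi top rtop : ℕ → ℕ} {x y : ℕ → ℝ}
  {Init Encl : Rectangle → Prop}

theorem run_candidate {s : State} (hE : EdgeEnv X Y p q m lo rlo hi rhi top rtop x y s)
    {a b j : ℕ} (ha : s.ivar v_a = a) (hb : s.ivar v_b = b) (hk : s.ivar v_k = j + 1)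
    (hencl : Encl (frameRect X Y p q (x (lo a)) (x (hi b)) (y (top j))))
    (harea : (frameRect X Y p q (x (lo a)) (x (hi b)) (y (top j))).area =
      boxArea x y lo hi top (sqDist X Y p q) a b j) (hs : Sound Init Encl s) :
    Run Prog.candidate s 110 (fun s' => Improves Init Encl s s' ∧
      Reached s' (boxArea x y lo hi top (sqDist X Y p q) a b j)) := by
  obtain ⟨ep, -, ex, ey, edx, edy, esq, efx, efy, elo, -, ehi, -, etop, -⟩ := hE
  have hfirst : Run (Prog.setR r_wd (ra a_fx (ia a_hi (iv v_b)) - ra a_fx (ia a_lo (iv v_a))) ;;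
      Prog.setR r_ht (ra a_fy (ia a_top (iv v_k - 1))) ;;
      Prog.setR r_area (rv r_wd * rv r_ht / rv r_sq)) s 25 (fun s' =>
        s'.rvar r_wd = x (hi b) - x (lo a) ∧ s'.rvar r_ht = y (top j) ∧
        s'.rvar r_area = boxArea x y lo hi top (sqDist X Y p q) a b j) := by
    refine Run.of_loopFree rfl (Nat.le_of_ble_eq_true rfl) ?_
    simp [Prog.result, efx, efy, elo, ehi, etop, esq, ha, hb, hk, boxArea]
  refine (hfirst.seq (B' := 85) ?_).mono (Nat.le_of_ble_eq_true rfl) (fun _ _ h => h)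
  rintro s₁ hF₁ ⟨hw, hh, har⟩
  have himp := Improves.of_frame (Init := Init) (Encl := Encl) rfl hF₁ hs
  refine (Run.branch (B := 74) (fun hb => ?_) (fun hb => ?_)).mono (Nat.le_of_ble_eq_true rfl)
    (fun _ _ h => h)
  · simp only [Test.holds_both, Test.holds_neg, Test.holds_ilt, Test.holds_rlt, IExp.eval_zero,
      IExp.eval_var, RExp.eval_var, not_lt, har] at hb
    exact (Run.skip (Q := fun s' => Improves Init Encl s s' ∧ Reached s' _) ⟨himp, hb⟩).mono
      (by omega) (fun _ _ h => h)
  · simp only [Test.holds_both, Test.holds_neg, Test.holds_ilt, Test.holds_rlt, IExp.eval_zero,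
      IExp.eval_var, RExp.eval_var, not_and, not_not, har] at hb
    have e1 : s₁.ivar v_p = p := (hF₁.ivar 2 rfl).trans ep
    have e2 : s₁.rarr a_x = X := (hF₁.rarr 0 rfl).trans ex
    have e3 : s₁.rarr a_y = Y := (hF₁.rarr 1 rfl).trans ey
    have e4 : s₁.rarr a_fx = x := (hF₁.rarr 3 rfl).trans efx
    have e5 : s₁.iarr a_lo = lo := (hF₁.iarr 6 rfl).trans elo
    have e6 : s₁.ivar v_a = a := (hF₁.ivar 10 rfl).trans ha
    have e7 : s₁.rvar r_dx = X q - X p := (hF₁.rvar 7 rfl).trans edx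
    have e8 : s₁.rvar r_dy = Y q - Y p := (hF₁.rvar 8 rfl).trans edy
    have e9 : s₁.rvar r_sq = sqDist X Y p q := (hF₁.rvar 9 rfl).trans esq
    refine Run.of_loopFree rfl (Nat.le_of_ble_eq_true rfl) ⟨⟨⟨_, ?_, ?_, fun _ => ⟨hencl, ?_⟩⟩, ?_⟩,
      ?_⟩
    · refine ⟨?_, ?_, ?_, ?_, ?_, ?_⟩ <;>
        simp [Prog.result, frameRect, e1, e2, e3, e4, e5, e6, e7, e8, e9, hw, hh]
    · simp [Prog.result]
    · simp [Prog.result, har, harea]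
    · intro v hv
      have hv' := himp.keep v hv
      refine ⟨by simp [Prog.result], ?_⟩
      simpa [Prog.result, har] using (hb hv'.1).le.trans hv'.2
    · refine ⟨by simp [Prog.result], by simp [Prog.result, har]⟩

theorem run_excludeHi (hL : Lists n m S x y lo rlo hi rhi top rtop) {s : State}
    (hE : EdgeEnv X Y p q m lo rlo hi rhi top rtop x y s)
    {a b j : ℕ} (ha : s.ivar v_a = a) (hb : s.ivar v_b = b) (hk : s.ivar v_k = j + 1)
    (hbm : b < m) (he : s.ivar v_e = excluded n S rlo rhi rtop a b j) :
    Run Prog.excludeHi s 35 (fun s' => s'.ivar v_b = b + 1 ∧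
      s'.ivar v_e = excluded n S rlo rhi rtop a (b + 1) j) := by
  refine Run.of_loopFree rfl (Nat.le_of_ble_eq_true rfl) ?_
  rw [hL.excluded_succ_hi hbm]
  simp only [Prog.excludeHi, Prog.result, Test.holds_both, Test.holds_neg, Test.holds_ilt]
  simp only [IExp.eval_var, IExp.eval_get, IExp.eval_add, IExp.eval_sub, IExp.eval_one,
    State.setI_iarr, State.setI_ivar, hE.hi_eq, hE.rlo_eq, hE.rtop_eq, ha, hb, hk, if_true,
    Nat.reduceEqDiff, if_false, Nat.add_sub_cancel]
  split_ifs with h <;> simp_all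

theorem run_includeTop (hL : Lists n m S x y lo rlo hi rhi top rtop) {s : State}
    (hE : EdgeEnv X Y p q m lo rlo hi rhi top rtop x y s)
    {a b j : ℕ} (ha : s.ivar v_a = a) (hb : s.ivar v_b = b) (hk : s.ivar v_k = j + 1)
    (hjm : j < m) (he : s.ivar v_e = excluded n S rlo rhi rtop a b j) :
    Run Prog.includeTop s 35 (fun s' => s'.ivar v_k = j ∧ ∀ i, j = i + 1 →
      s'.ivar v_e = excluded n S rlo rhi rtop a b i) := by
  refine Run.of_loopFree rfl (Nat.le_of_ble_eq_true rfl) ?_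
  simp only [Prog.includeTop, Prog.result, Test.holds_both, Test.holds_neg, Test.holds_ilt]
  simp only [IExp.eval_var, IExp.eval_get, IExp.eval_sub, IExp.eval_one,
    State.setI_iarr, State.setI_ivar, hE.top_eq, hE.rlo_eq, hE.rhi_eq, ha, hb, hk, if_true,
    Nat.reduceEqDiff, if_false, Nat.add_sub_cancel]
  refine ⟨by split_ifs <;> simp, ?_⟩
  rintro i rfl
  rw [hL.excluded_succ_top (show i < m by omega)] at he
  simp only [Nat.add_sub_cancel]
  split_ifs with h
  · rw [if_pos h] at he
    simp [he]
  · rw [if_neg h] at he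
    simp [he]

/-- The search takes linear time, since a step either excludes one more entry of the second list or
includes one more of the third. It matches every box: one that is skipped because of too many
excluded points has too many of them itself, and one that is skipped after a candidate has been
tried excludes no more of the third list, hence is not smaller than the candidate. -/
theorem run_staircase (hL : Lists n m S x y lo rlo hi rhi top rtop) (hm : m ≤ countBelow n S)
    (hd : 0 ≤ sqDist X Y p q)
    (hbox : ∀ a < m, ∀ b < m, ∀ j < m, excluded n S rlo rhi rtop a b j < m →
      Encl (frameRect X Y p q (x (lo a)) (x (hi b)) (y (top j))) ∧
        (frameRect X Y p q (x (lo a)) (x (hi b)) (y (top j))).area =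
          boxArea x y lo hi top (sqDist X Y p q) a b j)
    {s : State} (hE : EdgeEnv X Y p q m lo rlo hi rhi top rtop x y s)
    {a : ℕ} (ha : s.ivar v_a = a) (ham : a < m) (hs : Sound Init Encl s) :
    Run Prog.staircase s (400 * m + 100) (fun s' => Improves Init Encl s s' ∧
      ∀ b < m, ∀ j < m, excluded n S rlo rhi rtop a b j < m →
        Reached s' (boxArea x y lo hi top (sqDist X Y p q) a b j)) := by
  refine (Run.seq (B := 6) (Q := fun s' => s'.ivar v_e = a ∧ s'.ivar v_b = 0 ∧ s'.ivar v_k = m)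
    (Run.of_loopFree rfl (Nat.le_of_ble_eq_true rfl) (by simp [Prog.result, ha, hE.m_eq]))
    (B' := ((m - 1) * (30 + 3 + 7) + 3 + 6) + ((m + m) * (160 + 7 + 1) + (7 + 1)))
    ?_).mono (by omega) (fun _ _ h => h)
  rintro s₁ hF₁ ⟨he₁, hb₁, hk₁⟩
  have hE₁ := hE.of_frame hF₁ rfl
  have ha₁ : s₁.ivar v_a = a := (hF₁.ivar 10 rfl).trans ha
  have hI₁ := Improves.of_frame (Init := Init) (Encl := Encl) rfl hF₁ hs
  refine (Run.forLoop_const (N := m - 1)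
    (fun j s' => s'.ivar v_e = excluded n S rlo rhi rtop a 0 j) rfl
    (by intro s' hF; simp [(hE₁.of_frame hF rfl).m_eq]) ?_ ?_).seq ?_
  · rw [State.setI_ivar, if_neg (by decide), he₁, hL.excluded_lo ham.le]
  · intro j s' hj hvj hF hI
    have hE' := hE₁.of_frame hF rfl
    have ha' : s'.ivar v_a = a := (hF.ivar 10 rfl).trans ha₁
    refine Run.of_loopFree rfl (Nat.le_of_ble_eq_true rfl) ?_
    rw [hL.excluded_succ_top (by omega), ← hI]
    simp only [Prog.result, Test.holds_ilt, IExp.eval_var, IExp.eval_get, State.setI_iarr,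
      State.setI_ivar, hE'.top_eq, hE'.rlo_eq, hvj, ha', if_true, Nat.reduceEqDiff, if_false]
    split_ifs <;> simp_all
  intro s₂ hF₂ he₂
  have hE₂ := hE₁.of_frame hF₂ rfl
  have ha₂ : s₂.ivar v_a = a := (hF₂.ivar 10 rfl).trans ha₁
  have hb₂ : s₂.ivar v_b = 0 := (hF₂.ivar 11 rfl).trans hb₁
  have hk₂ : s₂.ivar v_k = m := (hF₂.ivar 12 rfl).trans hk₁
  have hI₂ := hI₁.trans (Improves.of_frame rfl hF₂ hI₁.sound)
  -- every box is matched already or still lies in the rectangle of parameters to be walked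
  refine Run.loop (B := 160) (fun r s' => r = (m - s'.ivar v_b) + s'.ivar v_k ∧ s'.ivar v_k ≤ m ∧
      (∀ j, s'.ivar v_k = j + 1 → s'.ivar v_e = excluded n S rlo rhi rtop a (s'.ivar v_b) j) ∧
      Improves Init Encl s s' ∧
      ∀ b < m, ∀ j < m, excluded n S rlo rhi rtop a b j < m →
        Reached s' (boxArea x y lo hi top (sqDist X Y p q) a b j) ∨
          (s'.ivar v_b ≤ b ∧ j < s'.ivar v_k)) ?_ ?_ (m + m) ?_
  · rintro r s' hF ⟨hr, hkm, he, hI, hcov⟩ hb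
    have hE' := hE₂.of_frame hF rfl
    have ha' : s'.ivar v_a = a := (hF.ivar 10 rfl).trans ha₂
    simp only [Test.holds_both, Test.holds_ilt, IExp.eval_var, IExp.eval_zero, hE'.m_eq] at hb
    obtain ⟨j, hj⟩ : ∃ j, s'.ivar v_k = j + 1 := ⟨s'.ivar v_k - 1, by omega⟩
    obtain ⟨b, hvb⟩ : ∃ b, s'.ivar v_b = b := ⟨_, rfl⟩
    have he' := he j hj
    rw [hvb] at he' hb hr hcov
    rw [hj] at hr hkm hcov
    refine ⟨(m - b) + j, by omega, ?_⟩
    refine (Run.branch (B := 110 + 35) (fun hc => ?_) (fun hc => ?_)).mono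
      (Nat.le_of_ble_eq_true rfl) (fun _ _ h => h)
    · have hlt : excluded n S rlo rhi rtop a b j < m := by
        simpa [he', hE'.m_eq] using hc
      obtain ⟨henc, harea⟩ := hbox a ham b hb.1 j (by omega) hlt
      refine (run_candidate hE' ha' hvb hj henc harea hI.sound).seq ?_
      rintro s₃ hF₃ ⟨hI₃, hR₃⟩
      refine (run_excludeHi hL (hE'.of_frame hF₃ rfl) ((hF₃.ivar 10 rfl).trans ha')
        ((hF₃.ivar 11 rfl).trans hvb) ((hF₃.ivar 12 rfl).trans hj) hb.1
        ((hF₃.ivar 13 rfl).trans he')).mono le_rfl ?_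
      rintro s₄ hF₄ ⟨hb₄, he₄⟩
      have hk₄ : s₄.ivar v_k = j + 1 :=
        (hF₄.ivar 12 rfl).trans ((hF₃.ivar 12 rfl).trans hj)
      have hI₄ := Improves.of_frame (Init := Init) (Encl := Encl) rfl hF₄ hI₃.sound
      refine ⟨by rw [hb₄, hk₄]; omega, by omega, ?_, (hI.trans hI₃).trans hI₄, ?_⟩
      · intro i hi
        obtain rfl : i = j := by omega
        rw [he₄, hb₄]
      · intro b' hb' j' hj' hex
        rw [hb₄, hk₄]
        rcases hcov b' hb' j' hj' hex with h | ⟨h1, h2⟩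
        · exact Or.inl (hI₄.keep _ (hI₃.keep _ h))
        · by_cases hbb : b' = b
          · left
            subst hbb
            have hle := hL.boxArea_le hm hd ham hb' (show j' ≤ j by omega) (by omega) hlt
            have hR := hI₄.keep _ hR₃
            exact ⟨hR.1, hR.2.trans hle⟩
          · right; omega
    · have hge : m ≤ excluded n S rlo rhi rtop a b j := by
        simpa [he', hE'.m_eq] using hc
      refine (run_includeTop hL hE' ha' hvb hj (by omega) he').mono (by omega) ?_
      rintro s₃ hF₃ ⟨hk₃, he₃⟩
      have hb₃ : s₃.ivar v_b = b := (hF₃.ivar 11 rfl).trans hvb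
      have hI₃ := Improves.of_frame (Init := Init) (Encl := Encl) rfl hF₃ hI.sound
      refine ⟨by rw [hb₃, hk₃], by omega, ?_, hI.trans hI₃, ?_⟩
      · intro i hi
        rw [hb₃]
        exact he₃ i (by omega)
      · intro b' hb' j' hj' hex
        rw [hb₃, hk₃]
        rcases hcov b' hb' j' hj' hex with h | ⟨h1, h2⟩
        · exact Or.inl (hI₃.keep _ h)
        · right
          refine ⟨h1, ?_⟩
          by_contra hcon
          have hmono := excluded_mono (n := n) (S := S) (rlo := rlo) (rhi := rhi) (rtop := rtop)
            (a := a) h1 (show j ≤ j' by omega)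
          omega
  · rintro r s' hF ⟨hr, hkm, he, hI, hcov⟩ hb
    have hE' := hE₂.of_frame hF rfl
    simp only [Test.holds_both, Test.holds_ilt, IExp.eval_var, IExp.eval_zero, hE'.m_eq] at hb
    refine ⟨hI, fun b' hb' j' hj' hex => ?_⟩
    rcases hcov b' hb' j' hj' hex with h | h
    · exact h
    · omega
  · refine ⟨by rw [hb₂, hk₂]; omega, hk₂.le, ?_, hI₂, ?_⟩
    · intro j hj
      have : j = m - 1 := by omega
      rw [he₂, hb₂, this]
    · intro b hb j hj _
      right; omega

end search


/-! ### Processing one line -/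

namespace Prog

/-- Computes the coordinates of point `v_i` with respect to the line, and lets it take part in the
selections unless it lies to the left of the line. -/
def coords : Prog :=
  storeR a_fx (iv v_i) (rv r_dx * (ra a_x (iv v_i) - ra a_x (iv v_p)) +
    rv r_dy * (ra a_y (iv v_i) - ra a_y (iv v_p))) ;;
  storeR a_fy (iv v_i) (rv r_dy * (ra a_x (iv v_i) - ra a_x (iv v_p)) -
    rv r_dx * (ra a_y (iv v_i) - ra a_y (iv v_p))) ;;
  storeR a_nfx (iv v_i) (0 - ra a_fx (iv v_i)) ;;
  branch (.rlt (ra a_fy (iv v_i)) 0) (storeI a_leaf (iv v_i) (iv v_n))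
    (storeI a_leaf (iv v_i) (iv v_i))

/-- Finds the best box on the line from point `v_p` to point `v_q`. -/
def edge : Prog :=
  (setR r_dx (ra a_x (iv v_q) - ra a_x (iv v_p)) ;;
    setR r_dy (ra a_y (iv v_q) - ra a_y (iv v_p)) ;;
    setR r_sq (rv r_dx * rv r_dx + rv r_dy * rv r_dy) ;;
    setI v_m (iv v_t + 1 - ia a_cnt (iv v_q))) ;;
  forLoop v_i (iv v_n) coords ;;
  select a_nfx a_lo a_rlo ;; select a_fx a_hi a_rhi ;; select a_fy a_top a_rtop ;;
  forLoop v_a (iv v_m) staircase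

end Prog

theorem countBelow_add (n : ℕ) (Q P : ℕ → Prop) :
    countBelow n (fun i => Q i ∧ P i) + countBelow n (fun i => Q i ∧ ¬ P i) = countBelow n Q := by
  classical
  unfold countBelow
  rw [← Finset.card_union_of_disjoint]
  · congr 1
    ext i
    simp only [Finset.mem_union, Finset.mem_filter]
    tauto
  · rw [Finset.disjoint_left]
    intro i h h'
    simp only [Finset.mem_filter] at h h'
    exact h'.2.2 h.2.2

/-- If fewer than `m` members of `S` are not in `T`, then one of the `m` listed ones is in `T`; the
first of them has the least rank in `T`. -/
theorem Selected.exists_first {n m : ℕ} {S T : ℕ → Prop} {K : ℕ → ℝ} {out rank : ℕ → ℕ}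
    (h : Selected n m S K out rank) (hmn : m ≤ n) (hT : countBelow n (fun i => S i ∧ ¬ T i) < m) :
    ∃ a < m, T (out a) ∧ ∀ i < n, T i → a ≤ rank i := by
  classical
  have hex : ∃ a, a < m ∧ T (out a) := by
    by_contra hcon
    push Not at hcon
    have hinj : Set.InjOn out (Finset.range m) := by
      intro a ha b hb hab
      have ha' := (h.out_spec a (by simpa using ha)).2.2
      rw [hab, (h.out_spec b (by simpa using hb)).2.2] at ha'
      exact ha'.symm
    refine absurd hT (not_lt.mpr ?_)
    conv_lhs => rw [← Finset.card_range m, ← Finset.card_image_of_injOn hinj]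
    refine Finset.card_le_card fun i hi => ?_
    obtain ⟨a, ha, rfl⟩ := Finset.mem_image.mp hi
    have ha' : a < m := by simpa using ha
    have := h.out_spec a ha'
    simp only [Finset.mem_filter, Finset.mem_range]
    exact ⟨this.1, this.2.1, hcon a ha'⟩
  refine ⟨Nat.find hex, (Nat.find_spec hex).1, (Nat.find_spec hex).2, fun i hi hTi => ?_⟩
  by_contra hlt
  push Not at hlt
  have hm := (Nat.find_spec hex).1
  rcases h.rank_spec i hi with h' | h'
  · omega
  · exact Nat.find_min hex hlt ⟨h'.1, by rwa [h'.2]⟩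

section

variable {X Y : ℕ → ℝ} {n t p q : ℕ} {Init Encl : Rectangle → Prop}

theorem norm_plane (a b : ℝ) : ‖(!₂[a, b] : Plane)‖ = Real.sqrt (a * a + b * b) := by
  rw [EuclideanSpace.norm_eq]
  simp [Fin.sum_univ_two, sq]

theorem area_frameRect (hd : 0 < sqDist X Y p q) {x₁ x₂ h : ℝ} (hx : x₁ ≤ x₂) (hh : 0 ≤ h) :
    (frameRect X Y p q x₁ x₂ h).area = (x₂ - x₁) * h / sqDist X Y p q := by
  unfold Rectangle.area frameRect
  simp only [norm_plane]
  set d := sqDist X Y p q with hdd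
  have e1 : (x₂ - x₁) / d * (X q - X p) * ((x₂ - x₁) / d * (X q - X p)) +
      (x₂ - x₁) / d * (Y q - Y p) * ((x₂ - x₁) / d * (Y q - Y p)) = (x₂ - x₁) ^ 2 / d := by
    have : (x₂ - x₁) ^ 2 / d = ((x₂ - x₁) / d) ^ 2 * d := by field_simp
    rw [this, hdd, sqDist]; ring
  have e2 : h / d * (Y q - Y p) * (h / d * (Y q - Y p)) +
      (0 - h / d * (X q - X p)) * (0 - h / d * (X q - X p)) = h ^ 2 / d := by
    have : h ^ 2 / d = (h / d) ^ 2 * d := by field_simp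
    rw [this, hdd, sqDist]; ring
  rw [e1, e2, ← Real.sqrt_mul (by positivity),
    Real.sqrt_eq_iff_mul_self_eq (by positivity)
      (div_nonneg (mul_nonneg (by linarith) hh) hd.le)]
  field_simp

theorem GeneralPosition.sqDist_pos (h : GeneralPosition n X Y) (hp : p < n) (hq : q < n)
    (hpq : p ≠ q) : 0 < sqDist X Y p q := by
  by_contra hcon
  have h1 := mul_self_nonneg (X q - X p)
  have h2 := mul_self_nonneg (Y q - Y p)
  unfold sqDist at hcon
  refine hpq (h.injective p hp q hq ?_ ?_)
  · have : (X q - X p) = 0 := mul_self_eq_zero.mp (by linarith)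
    linarith
  · have : (Y q - Y p) = 0 := mul_self_eq_zero.mp (by linarith)
    linarith

/-- The points left of the line, and those on it or to its right, are `n` together. -/
theorem leftCount_add : leftCount n X Y p q + countBelow n (fun i => ¬ depth X Y p q i < 0) = n := by
  have h := countBelow_add n (fun _ => True) (fun i => depth X Y p q i < 0)
  simp only [true_and] at h
  have e : leftCount n X Y p q = countBelow n (fun i => depth X Y p q i < 0) := by
    unfold leftCount
    refine countBelow_congr fun i _ => ?_
    unfold cross depth
    constructor <;> intro h <;> linarith
  rw [e, h]
  simp [countBelow]

theorem run_coords {s : State} (hE : Env n t X Y s) (hp : s.ivar v_p = p) :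
    s.rvar r_dx = X q - X p → s.rvar r_dy = Y q - Y p →
    Run (Prog.forLoop v_i (iv v_n) Prog.coords) s (108 * n + 10) (fun s' => ∀ i < n,
      s'.rarr a_fx i = along X Y p q i ∧ s'.rarr a_fy i = depth X Y p q i ∧
      s'.rarr a_nfx i = 0 - along X Y p q i ∧
      s'.iarr a_leaf i = open scoped Classical in if ¬ depth X Y p q i < 0 then i else n) := by
  intro hdx hdy
  refine (Run.forLoop_const (N := n) (B := 90) (fun i s' => ∀ k < i,
      s'.rarr a_fx k = along X Y p q k ∧ s'.rarr a_fy k = depth X Y p q k ∧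
      s'.rarr a_nfx k = 0 - along X Y p q k ∧
      s'.iarr a_leaf k = open scoped Classical in if ¬ depth X Y p q k < 0 then k else n) rfl
    (by intro s' hF; exact (hF.ivar 0 rfl).trans hE.n_eq) (by simp) ?_).mono ?_ (fun _ _ h => h)
  swap
  · have hc : (iv v_n).cost = 1 := rfl
    rw [hc]; omega
  intro i s' hi hvi hF hI
  have hE' := hE.of_frame hF rfl rfl rfl rfl rfl
  have hp' : s'.ivar v_p = p := (hF.ivar 2 rfl).trans hp
  have hdx' : s'.rvar r_dx = X q - X p := (hF.rvar 7 rfl).trans hdx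
  have hdy' : s'.rvar r_dy = Y q - Y p := (hF.rvar 8 rfl).trans hdy
  have h1 : ∀ k < i + 1, Function.update (s'.rarr a_fx) i (along X Y p q i) k = along X Y p q k :=
    forall_lt_update (P := fun k v => v = along X Y p q k) (fun k hk => (hI k hk).1) rfl
  have h2 : ∀ k < i + 1, Function.update (s'.rarr a_fy) i (depth X Y p q i) k = depth X Y p q k :=
    forall_lt_update (P := fun k v => v = depth X Y p q k) (fun k hk => (hI k hk).2.1) rfl
  have h3 : ∀ k < i + 1, Function.update (s'.rarr a_nfx) i (0 - along X Y p q i) k =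
      0 - along X Y p q k :=
    forall_lt_update (P := fun k v => v = 0 - along X Y p q k) (fun k hk => (hI k hk).2.2.1) rfl
  have h4 := forall_lt_update (x := open scoped Classical in if ¬ depth X Y p q i < 0 then i else n)
    (P := fun k v => v = open scoped Classical in if ¬ depth X Y p q k < 0 then k else n)
    (fun k hk => (hI k hk).2.2.2) rfl
  refine Run.of_loopFree rfl (Nat.le_of_ble_eq_true rfl) ?_
  intro k hk
  have h1k := h1 k hk
  have h2k := h2 k hk
  have h3k := h3 k hk
  have h4k := h4 k hk
  simp only [Prog.coords, Prog.result, Test.holds_rlt, IExp.eval_var, RExp.eval_get, RExp.eval_sub,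
    RExp.eval_add, RExp.eval_mul, RExp.eval_var, RExp.eval_zero, State.storeR_rarr,
    State.storeR_ivar, State.storeR_rvar, hvi, hp', hdx', hdy', hE'.x_eq, hE'.y_eq, if_true,
    Nat.reduceEqDiff, if_false, OfNat.zero_ne_ofNat, OfNat.one_ne_ofNat, Function.update_self]
  change _ = depth X Y p q k at h2k
  by_cases hdp : depth X Y p q i < 0
  · rw [if_neg (not_not.mpr hdp)] at h4k
    rw [if_pos (by exact hdp)]
    refine ⟨?_, ?_, ?_, ?_⟩
    · simpa [along] using h1k
    · simpa [depth] using h2k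
    · simpa [along] using h3k
    · simpa [hvi, hE'.n_eq] using h4k
  · rw [if_pos hdp] at h4k
    rw [if_neg (by exact hdp)]
    refine ⟨?_, ?_, ?_, ?_⟩
    · simpa [along] using h1k
    · simpa [depth] using h2k
    · simpa [along] using h3k
    · simpa [hvi, hE'.n_eq] using h4k

/-- The result becomes at least as good as any box on the line, with enough points. Such a box leaves
out fewer than `m = t + 1 - leftCount` points of the half plane to the right, so each of its other
three sides contains one of the first `m` points of the corresponding list, and it suffices to try
the boxes bounded by listed points. -/
theorem run_edge (h : GeneralPosition n X Y) (hp : p < n) (hq : q < n) (hpq : p ≠ q)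
    (htn : t < n) (hEncl : ∀ x₁ x₂ h, n - t ≤ countBelow n (fun i => x₁ ≤ along X Y p q i ∧
      along X Y p q i ≤ x₂ ∧ 0 ≤ depth X Y p q i ∧ depth X Y p q i ≤ h) →
      Encl (frameRect X Y p q x₁ x₂ h))
    {s : State} (hE : Env n t X Y s) (hvp : s.ivar v_p = p) (hvq : s.ivar v_q = q)
    (hcnt : s.iarr a_cnt q = leftCount n X Y p q) (hle : leftCount n X Y p q ≤ t)
    (hs : Sound Init Encl s) :
    Run Prog.edge s (500 * n + 500 + (t + 1) * (150 * Nat.log 2 (2 * n) + 400 * (t + 1) + 300))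
      (fun s' => Improves Init Encl s s' ∧ ∀ (T : ℕ → Prop) (v : ℝ),
        (∀ i < n, T i → 0 ≤ depth X Y p q i) → n - t ≤ countBelow n T →
        (∀ k < n, T k → ∀ l < n, T l → ∀ r < n, T r →
          (along X Y p q k - along X Y p q l) * depth X Y p q r ≤ v * sqDist X Y p q) →
        Reached s' v) := by
  classical
  have hd := h.sqDist_pos hp hq hpq
  set S : ℕ → Prop := fun i => ¬ depth X Y p q i < 0 with hS
  set m := t + 1 - leftCount n X Y p q with hmdef
  set L := Nat.log 2 (2 * n) with hLdef
  have hadd : leftCount n X Y p q + countBelow n S = n := leftCount_add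
  have hm : m ≤ countBelow n S := by omega
  have hmn : m ≤ n := by omega
  refine (Run.seq (B := 60) (Q := fun s' => s'.rvar r_dx = X q - X p ∧ s'.rvar r_dy = Y q - Y p ∧
    s'.rvar r_sq = sqDist X Y p q ∧ s'.ivar v_m = m) (Run.of_loopFree rfl
      (Nat.le_of_ble_eq_true rfl) ?_) (B' := (108 * n + 10) + ((100 * n + 100 + m * (L * 50 + 50)) +
      ((100 * n + 100 + m * (L * 50 + 50)) + ((100 * n + 100 + m * (L * 50 + 50)) +
      (m * (400 * m + 100 + 1 + 7) + 1 + 6))))) ?_).mono ?_ (fun _ _ h => h)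
  · simp [Prog.result, hE.x_eq, hE.y_eq, hE.t_eq, hvp, hvq, hcnt, sqDist, hmdef]
  swap
  · have hmt : m ≤ t + 1 := by omega
    have e1 : m * (L * 50 + 50) ≤ (t + 1) * (L * 50 + 50) := Nat.mul_le_mul_right _ hmt
    have e2 : m * (400 * m + 100 + 1 + 7) ≤ (t + 1) * (400 * (t + 1) + 100 + 1 + 7) :=
      Nat.mul_le_mul hmt (by omega)
    have e3 : 3 * ((t + 1) * (L * 50 + 50)) + (t + 1) * (400 * (t + 1) + 100 + 1 + 7) ≤
        (t + 1) * (150 * L + 400 * (t + 1) + 300) := by nlinarith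
    omega
  rintro s₁ hF₁ ⟨hdx₁, hdy₁, hsq₁, hm₁⟩
  have hE₁ := hE.of_frame hF₁ rfl rfl rfl rfl rfl
  have hp₁ : s₁.ivar v_p = p := (hF₁.ivar 2 rfl).trans hvp
  have hI₁ := Improves.of_frame (Init := Init) (Encl := Encl) rfl hF₁ hs
  refine (run_coords hE₁ hp₁ hdx₁ hdy₁).seq ?_
  intro s₂ hF₂ hc₂
  have hE₂ := hE₁.of_frame hF₂ rfl rfl rfl rfl rfl
  have hI₂ := hI₁.trans (Improves.of_frame rfl hF₂ hI₁.sound)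
  have hm₂ : s₂.ivar v_m = m := (hF₂.ivar 8 rfl).trans hm₁
  have hcard : m ≤ ((Finset.range n).filter S).card := by
    refine hm.trans (le_of_eq ?_)
    unfold countBelow
    congr
  refine (run_select (S := S) (K := a_nfx) (o := a_lo) (r := a_rlo) (by decide)
    (by decide) (by decide) (by decide) (by decide) (by decide) hE₂.n_eq hm₂ hE₂.par_eq
    (fun i hi => by rw [(hc₂ i hi).2.2.2]) hcard).seq ?_
  intro s₃ hF₃ hlo
  have hE₃ := hE₂.of_frame hF₃ rfl rfl rfl rfl rfl
  have hI₃ := hI₂.trans (Improves.of_frame rfl hF₃ hI₂.sound)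
  have hm₃ : s₃.ivar v_m = m := (hF₃.ivar 8 rfl).trans hm₂
  have hleaf₃ : s₃.iarr a_leaf = s₂.iarr a_leaf := hF₃.iarr 1 rfl
  refine (run_select (S := S) (K := a_fx) (o := a_hi) (r := a_rhi) (by decide)
    (by decide) (by decide) (by decide) (by decide) (by decide) hE₃.n_eq hm₃ hE₃.par_eq
    (fun i hi => by rw [hleaf₃, (hc₂ i hi).2.2.2]) hcard).seq ?_
  intro s₄ hF₄ hhi
  have hE₄ := hE₃.of_frame hF₄ rfl rfl rfl rfl rfl
  have hI₄ := hI₃.trans (Improves.of_frame rfl hF₄ hI₃.sound)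
  have hm₄ : s₄.ivar v_m = m := (hF₄.ivar 8 rfl).trans hm₃
  have hleaf₄ : s₄.iarr a_leaf = s₂.iarr a_leaf := (hF₄.iarr 1 rfl).trans hleaf₃
  refine (run_select (S := S) (K := a_fy) (o := a_top) (r := a_rtop) (by decide)
    (by decide) (by decide) (by decide) (by decide) (by decide) hE₄.n_eq hm₄ hE₄.par_eq
    (fun i hi => by rw [hleaf₄, (hc₂ i hi).2.2.2]) hcard).seq ?_
  intro s₅ hF₅ htop
  have hI₅ := hI₄.trans (Improves.of_frame rfl hF₅ hI₄.sound)
  have hfx : s₅.rarr a_fx = s₂.rarr a_fx :=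
    (hF₅.rarr 3 rfl).trans ((hF₄.rarr 3 rfl).trans (hF₃.rarr 3 rfl))
  have hfy : s₅.rarr a_fy = s₂.rarr a_fy :=
    (hF₅.rarr 5 rfl).trans ((hF₄.rarr 5 rfl).trans (hF₃.rarr 5 rfl))
  have hfx₃ : s₃.rarr a_fx = s₂.rarr a_fx := hF₃.rarr 3 rfl
  have hfy₄ : s₄.rarr a_fy = s₂.rarr a_fy := (hF₄.rarr 5 rfl).trans (hF₃.rarr 5 rfl)
  have hlo₅ : s₅.iarr a_lo = s₃.iarr a_lo := (hF₅.iarr 6 rfl).trans (hF₄.iarr 6 rfl)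
  have hrlo₅ : s₅.iarr a_rlo = s₃.iarr a_rlo := (hF₅.iarr 7 rfl).trans (hF₄.iarr 7 rfl)
  have hhi₅ : s₅.iarr a_hi = s₄.iarr a_hi := hF₅.iarr 8 rfl
  have hrhi₅ : s₅.iarr a_rhi = s₄.iarr a_rhi := hF₅.iarr 9 rfl
  rw [← hlo₅, ← hrlo₅] at hlo
  rw [← hhi₅, ← hrhi₅, hfx₃] at hhi
  rw [hfy₄] at htop
  have hEE : EdgeEnv X Y p q m (s₅.iarr a_lo) (s₅.iarr a_rlo) (s₅.iarr a_hi) (s₅.iarr a_rhi)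
      (s₅.iarr a_top) (s₅.iarr a_rtop) (s₂.rarr a_fx) (s₂.rarr a_fy) s₅ := by
    have hE₅ := hE₄.of_frame hF₅ rfl rfl rfl rfl rfl
    have er : ∀ x, x = r_dx ∨ x = r_dy ∨ x = r_sq → s₅.rvar x = s₁.rvar x := by
      rintro x (rfl | rfl | rfl) <;>
        exact (hF₅.rvar _ rfl).trans ((hF₄.rvar _ rfl).trans ((hF₃.rvar _ rfl).trans
          (hF₂.rvar _ rfl)))
    have ep : s₅.ivar v_p = p := (hF₅.ivar 2 rfl).trans ((hF₄.ivar 2 rfl).trans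
      ((hF₃.ivar 2 rfl).trans ((hF₂.ivar 2 rfl).trans hp₁)))
    exact ⟨ep, (hF₅.ivar 8 rfl).trans hm₄, hE₅.x_eq, hE₅.y_eq, (er _ (by simp)).trans hdx₁,
      (er _ (by simp)).trans hdy₁, (er _ (by simp)).trans hsq₁, hfx, hfy, rfl, rfl, rfl, rfl, rfl,
      rfl⟩
  generalize s₅.iarr a_lo = lo at *
  generalize s₅.iarr a_rlo = rlo at *
  generalize s₅.iarr a_hi = hi at *
  generalize s₅.iarr a_rhi = rhi at *
  generalize s₅.iarr a_top = top at *
  generalize s₅.iarr a_rtop = rtop at *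
  generalize s₂.rarr a_fx = x at *
  generalize s₂.rarr a_fy = y at *
  have hx : ∀ i < n, x i = along X Y p q i := fun i hi => (hc₂ i hi).1
  have hy : ∀ i < n, y i = depth X Y p q i := fun i hi => (hc₂ i hi).2.1
  have hL : Lists n m S x y lo rlo hi rhi top rtop := by
    refine ⟨⟨hlo.out_spec, hlo.rank_spec, fun j hj i hi hSi hji => ?_⟩, hhi, htop, hmn⟩
    have := hlo.sorted j hj i hi hSi hji
    rw [(hc₂ i hi).2.2.1, (hc₂ _ (hlo.out_spec j hj).1).2.2.1] at this
    rwa [hx i hi, hx _ (hlo.out_spec j hj).1]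
  have hkept : ∀ a b j, excluded n S rlo rhi rtop a b j < m →
      n - t ≤ countBelow n (fun i => S i ∧ ¬ (rlo i < a ∨ rhi i < b ∨ rtop i < j)) := by
    intro a b j hlt
    have := countBelow_add n S (fun i => rlo i < a ∨ rhi i < b ∨ rtop i < j)
    unfold excluded at hlt
    omega
  have hbox : ∀ a < m, ∀ b < m, ∀ j < m, excluded n S rlo rhi rtop a b j < m →
      Encl (frameRect X Y p q (x (lo a)) (x (hi b)) (y (top j))) ∧
        (frameRect X Y p q (x (lo a)) (x (hi b)) (y (top j))).area =
          boxArea x y lo hi top (sqDist X Y p q) a b j := by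
    intro a ha b hb j hj hlt
    refine ⟨hEncl _ _ _ ((hkept a b j hlt).trans (countBelow_mono ?_)), ?_⟩
    · rintro i hi ⟨hSi, hno⟩
      push Not at hno
      have e1 := hL.lo_sel.sorted a ha i hi hSi hno.1
      have e2 := hL.hi_sel.sorted b hb i hi hSi hno.2.1
      have e3 := hL.top_sel.sorted j hj i hi hSi hno.2.2
      rw [hx i hi] at e1 e2
      rw [hy i hi] at e3
      exact ⟨by linarith, e2, not_lt.mp hSi, e3⟩
    · obtain ⟨i, hi, hSi, h1, h2, -⟩ := exists_kept hm hlt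
      have e1 := hL.lo_sel.sorted a ha i hi hSi h1
      have e2 := hL.hi_sel.sorted b hb i hi hSi h2
      have ho := hL.top_sel.out_spec j hj
      refine area_frameRect hd (by linarith) ?_
      rw [hy _ ho.1]
      exact not_lt.mp ho.2.1
  refine (Run.forLoop_const (N := m) (fun a' s' => Improves Init Encl s s' ∧
      ∀ a < a', ∀ b < m, ∀ j < m, excluded n S rlo rhi rtop a b j < m →
        Reached s' (boxArea x y lo hi top (sqDist X Y p q) a b j)) rfl
    (by intro s' hF; exact (hEE.of_frame hF rfl).m_eq) ?_ ?_).mono le_rfl ?_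
  · exact ⟨⟨hI₅.sound, hI₅.keep⟩, fun a ha => by omega⟩
  · rintro a s' ham hva hF ⟨hI, hR⟩
    refine (run_staircase hL hm hd.le hbox (hEE.of_frame hF rfl) hva ham hI.sound).mono le_rfl ?_
    rintro s'' hF'' ⟨hI'', hR''⟩
    have hI3 := hI.trans hI''
    refine ⟨⟨hI3.sound, hI3.keep⟩, fun a' ha' b hb j hj hlt => ?_⟩
    rcases Nat.lt_succ_iff_lt_or_eq.mp ha' with h' | rfl
    · exact hI''.keep _ (hR a' h' b hb j hj hlt)
    · exact hR'' b hb j hj hlt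
  · rintro s₆ hF₆ ⟨hI, hR⟩
    refine ⟨hI, fun T v hTS hTc hTv => ?_⟩
    have hfew : countBelow n (fun i => S i ∧ ¬ T i) < m := by
      have e1 := countBelow_add n S T
      have e2 : countBelow n T ≤ countBelow n (fun i => S i ∧ T i) :=
        countBelow_mono fun i hi hT => ⟨not_lt.mpr (hTS i hi hT), hT⟩
      omega
    obtain ⟨a, ha, hTa, hmina⟩ := hL.lo_sel.exists_first hmn hfew
    obtain ⟨b, hb, hTb, hminb⟩ := hL.hi_sel.exists_first hmn hfew
    obtain ⟨j, hj, hTj, hminj⟩ := hL.top_sel.exists_first hmn hfew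
    have hex : excluded n S rlo rhi rtop a b j < m := by
      refine lt_of_le_of_lt (countBelow_mono fun i hi hSi => ⟨hSi.1, fun hT => ?_⟩) hfew
      have e1 := hmina i hi hT
      have e2 := hminb i hi hT
      have e3 := hminj i hi hT
      have := hSi.2
      omega
    have hRv := hR a ha b hb j hj hex
    refine ⟨hRv.1, hRv.2.trans ?_⟩
    have la := (hL.lo_sel.out_spec a ha).1
    have lb := (hL.hi_sel.out_spec b hb).1
    have lj := (hL.top_sel.out_spec j hj).1
    unfold boxArea
    rw [div_le_iff₀ hd, hx _ la, hx _ lb, hy _ lj]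
    exact hTv _ lb hTb _ la hTa _ lj hTj

end


/-! ### A smallest rectangle with a side on a line through two points -/

/-- Affine functions that are nonnegative at `0` and not all nondecreasing stay nonnegative up to
the time when one that decreases vanishes. -/
theorem exists_first_zero {ι : Type*} (I : Finset ι) (α β : ι → ℝ) (hα : ∀ i ∈ I, 0 ≤ α i)
    (hβ : ∃ i ∈ I, β i < 0) :
    ∃ s, 0 ≤ s ∧ (∀ i ∈ I, 0 ≤ α i + s * β i) ∧ ∃ i ∈ I, β i < 0 ∧ α i + s * β i = 0 := by
  classical
  obtain ⟨i₀, hi₀, hb₀⟩ := hβ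
  obtain ⟨i, hi, hmin⟩ := Finset.exists_min_image (I.filter (fun i => β i < 0))
    (fun i => α i / (- β i)) ⟨i₀, by simp [hi₀, hb₀]⟩
  simp only [Finset.mem_filter] at hi hmin
  have hpos : 0 < - β i := by linarith [hi.2]
  refine ⟨α i / (- β i), div_nonneg (hα i hi.1) hpos.le, fun j hj => ?_, i, hi.1, hi.2, ?_⟩
  · by_cases hbj : β j < 0
    · have h := hmin j ⟨hj, hbj⟩
      rw [le_div_iff₀ (by linarith)] at h
      linarith
    · have := mul_nonneg (div_nonneg (hα i hi.1) hpos.le) (not_lt.mp hbj)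
      linarith [hα j hj]
  · have := hi.2.ne
    field_simp
    ring

theorem mul_le_mul_of_abs_le {u v U V : ℝ} (hu : |u| ≤ U) (hv : |v| ≤ V) : u * v ≤ U * V :=
  calc u * v ≤ |u * v| := le_abs_self _
    _ = |u| * |v| := abs_mul _ _
    _ ≤ U * V := mul_le_mul hu hv (abs_nonneg _) ((abs_nonneg _).trans hu)

/-- The functions `F` and `G`, coordinates for two orthogonal directions, are bounded on `T` by a
box one of whose sides contains two points of `T`. -/
def HasTie (T : Finset ℕ) (F G : ℕ → ℝ) : Prop :=
  ∃ x ∈ T, ∃ z ∈ T, x ≠ z ∧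
    ((F x = F z ∧ ∀ i ∈ T, F x ≤ F i) ∨ (F x = F z ∧ ∀ i ∈ T, F i ≤ F x) ∨
      (G x = G z ∧ ∀ i ∈ T, G x ≤ G i) ∨ (G x = G z ∧ ∀ i ∈ T, G i ≤ G x))

/-- The bounding box can be turned, by an angle with tangent `s ≥ 0`, until a side contains two
points. The points `a`, `b`, `c`, `d` on the sides remain there, and if the inequality `hdir` holds,
then the area does not grow. -/
theorem exists_turn_of_le {T : Finset ℕ} (hT : 1 < T.card) {f g : ℕ → ℝ} {A : ℝ} {a b c d : ℕ}
    (ha : a ∈ T) (hb : b ∈ T) (hc : c ∈ T) (hd : d ∈ T)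
    (hfa : ∀ i ∈ T, f a ≤ f i) (hfb : ∀ i ∈ T, f i ≤ f b)
    (hgc : ∀ i ∈ T, g c ≤ g i) (hgd : ∀ i ∈ T, g i ≤ g d)
    (hA : (f b - f a) * (g d - g c) ≤ A)
    (hdir : (g b - g a) * (g d - g c) ≤ (f d - f c) * (f b - f a)) :
    ∃ s : ℝ, HasTie T (fun i => f i + s * g i) (fun i => g i - s * f i) ∧
      ∀ i ∈ T, ∀ j ∈ T, ∀ k ∈ T, ∀ l ∈ T,
        ((f i + s * g i) - (f j + s * g j)) * ((g k - s * f k) - (g l - s * f l)) ≤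
          A * (1 + s ^ 2) := by
  have hfin : ∀ s : ℝ, 0 ≤ s → (∀ i ∈ T, f a + s * g a ≤ f i + s * g i) →
      (∀ i ∈ T, f i + s * g i ≤ f b + s * g b) → (∀ i ∈ T, g c - s * f c ≤ g i - s * f i) →
      (∀ i ∈ T, g i - s * f i ≤ g d - s * f d) → ∀ i ∈ T, ∀ j ∈ T, ∀ k ∈ T, ∀ l ∈ T,
        ((f i + s * g i) - (f j + s * g j)) * ((g k - s * f k) - (g l - s * f l)) ≤
          A * (1 + s ^ 2) := by
    intro s hs h1 h2 h3 h4 i hi j hj k hk l hl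
    have hle := mul_le_mul_of_abs_le
      (u := (f i + s * g i) - (f j + s * g j)) (U := (f b + s * g b) - (f a + s * g a))
      (v := (g k - s * f k) - (g l - s * f l)) (V := (g d - s * f d) - (g c - s * f c))
      (by rw [abs_le]; constructor <;> linarith [h1 i hi, h1 j hj, h2 i hi, h2 j hj])
      (by rw [abs_le]; constructor <;> linarith [h3 k hk, h3 l hl, h4 k hk, h4 l hl])
    have he : - ((g b - g a) * (f d - f c)) ≤ (g d - g c) * (f b - f a) := by
      have := mul_le_mul_of_abs_le (u := -(g b - g a)) (U := g d - g c) (v := f d - f c)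
        (V := f b - f a)
        (by rw [abs_le]; constructor <;> linarith [hgc a ha, hgc b hb, hgd a ha, hgd b hb])
        (by rw [abs_le]; constructor <;> linarith [hfa c hc, hfa d hd, hfb c hc, hfb d hd])
      linarith
    have e1 := mul_le_mul_of_nonneg_left hdir hs
    have e2 := mul_le_mul_of_nonneg_left (he.trans ((mul_comm _ _).trans_le hA)) (sq_nonneg s)
    have e3 : ((f b + s * g b) - (f a + s * g a)) * ((g d - s * f d) - (g c - s * f c)) =
        (f b - f a) * (g d - g c) + s * ((g b - g a) * (g d - g c)) -
          s * ((f d - f c) * (f b - f a)) + s ^ 2 * (-((g b - g a) * (f d - f c))) := by ring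
    linarith
  by_cases hdec : (∃ i ∈ T, g i - g a < 0) ∨ (∃ i ∈ T, g b - g i < 0) ∨
      (∃ i ∈ T, f c - f i < 0) ∨ (∃ i ∈ T, f i - f d < 0)
  · obtain ⟨s, hs, hall, ⟨x, m⟩, hi, hneg, hzero⟩ := exists_first_zero (T ×ˢ Finset.univ (α := Fin 4))
      (fun i => ![f i.1 - f a, f b - f i.1, g i.1 - g c, g d - g i.1] i.2)
      (fun i => ![g i.1 - g a, g b - g i.1, f c - f i.1, f i.1 - f d] i.2)
      (by
        rintro ⟨i, m⟩ hi
        simp only [Finset.mem_product, Finset.mem_univ, and_true] at hi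
        have := hfa i hi
        have := hfb i hi
        have := hgc i hi
        have := hgd i hi
        fin_cases m <;> simp <;> linarith)
      (by
        rcases hdec with ⟨i, hi, h⟩ | ⟨i, hi, h⟩ | ⟨i, hi, h⟩ | ⟨i, hi, h⟩
        · exact ⟨(i, 0), by simp [hi], by simpa using h⟩
        · exact ⟨(i, 1), by simp [hi], by simpa using h⟩
        · exact ⟨(i, 2), by simp [hi], by simpa using h⟩
        · exact ⟨(i, 3), by simp [hi], by simpa using h⟩)
    have h1 : ∀ i ∈ T, f a + s * g a ≤ f i + s * g i := by
      intro i hi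
      have := hall (i, 0) (by simp [hi])
      simp at this
      linarith
    have h2 : ∀ i ∈ T, f i + s * g i ≤ f b + s * g b := by
      intro i hi
      have := hall (i, 1) (by simp [hi])
      simp at this
      linarith
    have h3 : ∀ i ∈ T, g c - s * f c ≤ g i - s * f i := by
      intro i hi
      have := hall (i, 2) (by simp [hi])
      simp at this
      linarith
    have h4 : ∀ i ∈ T, g i - s * f i ≤ g d - s * f d := by
      intro i hi
      have := hall (i, 3) (by simp [hi])
      simp at this
      linarith
    refine ⟨s, ?_, hfin s hs h1 h2 h3 h4⟩
    have hx : x ∈ T := by simpa using hi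
    fin_cases m
    · simp at hneg hzero
      exact ⟨a, ha, x, hx, by rintro rfl; exact lt_irrefl _ hneg,
        Or.inl ⟨by linarith, h1⟩⟩
    · simp at hneg hzero
      exact ⟨b, hb, x, hx, by rintro rfl; exact lt_irrefl _ hneg,
        Or.inr (Or.inl ⟨by linarith, h2⟩)⟩
    · simp at hneg hzero
      exact ⟨c, hc, x, hx, by rintro rfl; exact lt_irrefl _ hneg,
        Or.inr (Or.inr (Or.inl ⟨by linarith, h3⟩))⟩
    · simp at hneg hzero
      exact ⟨d, hd, x, hx, by rintro rfl; exact lt_irrefl _ hneg,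
        Or.inr (Or.inr (Or.inr ⟨by linarith, h4⟩))⟩
  · -- no constraint becomes tighter: a side contains two points from the start
    push Not at hdec
    obtain ⟨d1, -, d3, -⟩ := hdec
    refine ⟨0, ?_, hfin 0 le_rfl ?_ ?_ ?_ ?_⟩
    · by_cases hac : a = c
      · obtain ⟨x, hx, hxa⟩ := Finset.exists_mem_ne hT a
        refine ⟨a, ha, x, hx, hxa.symm, Or.inl ⟨?_, fun i hi => by simpa using hfa i hi⟩⟩
        have e1 := d3 x hx
        have e2 := hfa x hx
        rw [← hac] at e1
        simp; linarith
      · refine ⟨c, hc, a, ha, fun h => hac h.symm, Or.inr (Or.inr (Or.inl ⟨?_, fun i hi => by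
          simpa using hgc i hi⟩))⟩
        have e1 := d1 c hc
        have e2 := hgc a ha
        simp; linarith
    · intro i hi; simpa using hfa i hi
    · intro i hi; simpa using hfb i hi
    · intro i hi; simpa using hgc i hi
    · intro i hi; simpa using hgd i hi

/-- A bounding box can be turned, without making its area larger, until a side contains two
points: one of the two senses of rotation satisfies the inequality of `exists_turn_of_le`. -/
theorem exists_turn {T : Finset ℕ} (hT : 1 < T.card) {f g : ℕ → ℝ} {A : ℝ}
    (hA : ∀ i ∈ T, ∀ j ∈ T, ∀ k ∈ T, ∀ l ∈ T, (f i - f j) * (g k - g l) ≤ A) :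
    ∃ s : ℝ, HasTie T (fun i => f i + s * g i) (fun i => g i - s * f i) ∧
      ∀ i ∈ T, ∀ j ∈ T, ∀ k ∈ T, ∀ l ∈ T,
        ((f i + s * g i) - (f j + s * g j)) * ((g k - s * f k) - (g l - s * f l)) ≤
          A * (1 + s ^ 2) := by
  have hne : T.Nonempty := Finset.card_pos.mp (by omega)
  obtain ⟨a, ha, hfa⟩ := Finset.exists_min_image T f hne
  obtain ⟨b, hb, hfb⟩ := Finset.exists_max_image T f hne
  obtain ⟨c, hc, hgc⟩ := Finset.exists_min_image T g hne
  obtain ⟨d, hd, hgd⟩ := Finset.exists_max_image T g hne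
  rcases le_total ((g b - g a) * (g d - g c)) ((f d - f c) * (f b - f a)) with hdir | hdir
  · exact exists_turn_of_le hT ha hb hc hd hfa hfb hgc hgd (hA b hb a ha d hd c hc) hdir
  · -- the reflection `g ↦ -g` reverses the sense of rotation
    obtain ⟨s, ⟨x, hx, z, hz, hxz, htie⟩, hbd⟩ := exists_turn_of_le (g := fun i => - g i) hT ha hb
      hd hc hfa hfb (fun i hi => neg_le_neg (hgd i hi)) (fun i hi => neg_le_neg (hgc i hi))
      (by have := hA b hb a ha d hd c hc; linarith) (by linarith)
    refine ⟨-s, ⟨x, hx, z, hz, hxz, ?_⟩, fun i hi j hj k hk l hl => ?_⟩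
    · rcases htie with ⟨h, h'⟩ | ⟨h, h'⟩ | ⟨h, h'⟩ | ⟨h, h'⟩
      · exact Or.inl ⟨by linarith, fun i hi => by linarith [h' i hi]⟩
      · exact Or.inr (Or.inl ⟨by linarith, fun i hi => by linarith [h' i hi]⟩)
      · exact Or.inr (Or.inr (Or.inr ⟨by linarith, fun i hi => by linarith [h' i hi]⟩))
      · exact Or.inr (Or.inr (Or.inl ⟨by linarith, fun i hi => by linarith [h' i hi]⟩))
    · have := hbd i hi j hj l hl k hk
      nlinarith

section flush

variable {X Y : ℕ → ℝ} {n : ℕ}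

/-- The points of `T` lie on or to the right of the line from `p` to `q`, and their bounding box on
this line has at most the area `A`. -/
def FlushBox (X Y : ℕ → ℝ) (T : Finset ℕ) (A : ℝ) (p q : ℕ) : Prop :=
  (∀ i ∈ T, 0 ≤ depth X Y p q i) ∧ ∀ k ∈ T, ∀ l ∈ T, ∀ r ∈ T,
    (along X Y p q k - along X Y p q l) * depth X Y p q r ≤ A * sqDist X Y p q

/-- Two points `x` and `z` of `T` on a side of the bounding box with direction `(w₁, w₂)` give a line
with the whole box to its right, if taken in the suitable order. -/
theorem exists_flushBox_of_tie (h : GeneralPosition n X Y) {T : Finset ℕ} (hTn : ∀ i ∈ T, i < n)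
    {A w₁ w₂ : ℝ} (hw : 0 < w₁ * w₁ + w₂ * w₂) {x z : ℕ} (hx : x ∈ T) (hz : z ∈ T) (hxz : x ≠ z)
    (heq : w₁ * X x + w₂ * Y x = w₁ * X z + w₂ * Y z)
    (hmin : ∀ i ∈ T, w₁ * X x + w₂ * Y x ≤ w₁ * X i + w₂ * Y i)
    (hA : ∀ i ∈ T, ∀ j ∈ T, ∀ k ∈ T, ∀ l ∈ T,
      ((w₁ * X i + w₂ * Y i) - (w₁ * X j + w₂ * Y j)) *
        ((w₁ * Y k - w₂ * X k) - (w₁ * Y l - w₂ * X l)) ≤ A * (w₁ * w₁ + w₂ * w₂)) :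
    ∃ p ∈ T, ∃ q ∈ T, p ≠ q ∧ FlushBox X Y T A p q := by
  wlog hlt : w₁ * Y x - w₂ * X x < w₁ * Y z - w₂ * X z generalizing x z
  · rcases (not_lt.mp hlt).eq_or_lt with he | hlt'
    · exfalso
      refine hxz (h.injective x (hTn x hx) z (hTn z hz) ?_ ?_)
      · have : (w₁ * w₁ + w₂ * w₂) * (X x - X z) = 0 := by linear_combination w₁ * heq + w₂ * he
        rcases mul_eq_zero.mp this with h0 | h0 <;> linarith
      · have : (w₁ * w₁ + w₂ * w₂) * (Y x - Y z) = 0 := by linear_combination w₂ * heq - w₁ * he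
        rcases mul_eq_zero.mp this with h0 | h0 <;> linarith
    · exact this hz hx hxz.symm heq.symm (fun i hi => heq.symm.trans_le (hmin i hi)) hlt'
  set D := w₁ * w₁ + w₂ * w₂ with hD
  set μ := (w₁ * Y z - w₂ * X z) - (w₁ * Y x - w₂ * X x) with hμ
  have hμ0 : 0 < μ := by linarith
  have edx : D * (X z - X x) = - w₂ * μ := by
    rw [hD, hμ]; linear_combination (-w₁) * heq
  have edy : D * (Y z - Y x) = w₁ * μ := by
    rw [hD, hμ]; linear_combination (-w₂) * heq
  have edep : ∀ i, D * depth X Y x z i =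
      μ * ((w₁ * X i + w₂ * Y i) - (w₁ * X x + w₂ * Y x)) := by
    intro i
    unfold depth
    linear_combination (X i - X x) * edy - (Y i - Y x) * edx
  have eal : ∀ k l, D * (along X Y x z k - along X Y x z l) =
      μ * ((w₁ * Y k - w₂ * X k) - (w₁ * Y l - w₂ * X l)) := by
    intro k l
    unfold along
    linear_combination (X k - X l) * edx + (Y k - Y l) * edy
  have esq : D * sqDist X Y x z = μ * μ := by
    unfold sqDist
    have : D * (D * ((X z - X x) * (X z - X x) + (Y z - Y x) * (Y z - Y x)) - μ * μ) = 0 := by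
      have e1 : D * (X z - X x) * (D * (X z - X x)) + D * (Y z - Y x) * (D * (Y z - Y x)) =
          D * (μ * μ) := by rw [edx, edy, hD]; ring
      linear_combination e1
    rcases mul_eq_zero.mp this with h0 | h0 <;> linarith
  refine ⟨x, hx, z, hz, hxz, fun i hi => ?_, fun k hk l hl r hr => ?_⟩
  · have : 0 ≤ D * depth X Y x z i := by
      rw [edep]; exact mul_nonneg hμ0.le (by linarith [hmin i hi])
    exact nonneg_of_mul_nonneg_right this hw
  · have hb := mul_le_mul_of_nonneg_left (hA r hr x hx k hk l hl) (mul_pos hμ0 hμ0).le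
    have e : D * D * ((along X Y x z k - along X Y x z l) * depth X Y x z r) ≤
        D * D * (A * sqDist X Y x z) := by
      calc _ = (D * (along X Y x z k - along X Y x z l)) * (D * depth X Y x z r) := by ring
        _ ≤ μ * μ * (A * D) := by rw [eal, edep]; linarith
        _ = D * D * (A * sqDist X Y x z) := by rw [← esq]; ring
    exact le_of_mul_le_mul_left e (mul_pos hw hw)

/-- A set of at least two points with a bounding box of area `A` has one of at most this area with
a side on a line through two of the points. -/
theorem exists_flushBox (h : GeneralPosition n X Y) {T : Finset ℕ} (hTn : ∀ i ∈ T, i < n)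
    (hT : 1 < T.card) {A u₁ u₂ : ℝ} (hu : 0 < u₁ * u₁ + u₂ * u₂)
    (hA : ∀ i ∈ T, ∀ j ∈ T, ∀ k ∈ T, ∀ l ∈ T,
      ((u₁ * X i + u₂ * Y i) - (u₁ * X j + u₂ * Y j)) *
        ((u₁ * Y k - u₂ * X k) - (u₁ * Y l - u₂ * X l)) ≤ A * (u₁ * u₁ + u₂ * u₂)) :
    ∃ p ∈ T, ∃ q ∈ T, p ≠ q ∧ FlushBox X Y T A p q := by
  obtain ⟨s, ⟨x, hx, z, hz, hxz, htie⟩, hbd⟩ := exists_turn hT hA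
  set w₁ := u₁ - s * u₂ with hw₁
  set w₂ := u₂ + s * u₁ with hw₂
  have hF : ∀ i, (u₁ * X i + u₂ * Y i) + s * (u₁ * Y i - u₂ * X i) = w₁ * X i + w₂ * Y i := by
    intro i; rw [hw₁, hw₂]; ring
  have hG : ∀ i, (u₁ * Y i - u₂ * X i) - s * (u₁ * X i + u₂ * Y i) = w₁ * Y i - w₂ * X i := by
    intro i; rw [hw₁, hw₂]; ring
  have hN : w₁ * w₁ + w₂ * w₂ = (u₁ * u₁ + u₂ * u₂) * (1 + s ^ 2) := by rw [hw₁, hw₂]; ring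
  have hw : 0 < w₁ * w₁ + w₂ * w₂ := by rw [hN]; positivity
  rw [mul_assoc, ← hN] at hbd
  simp only [hF, hG] at hbd htie
  rcases htie with ⟨he, hm⟩ | ⟨he, hm⟩ | ⟨he, hm⟩ | ⟨he, hm⟩
  · exact exists_flushBox_of_tie h hTn hw hx hz hxz he hm hbd
  · refine exists_flushBox_of_tie (w₁ := -w₁) (w₂ := -w₂) h hTn (by linarith) hx hz hxz
      (by linarith) (fun i hi => by linarith [hm i hi]) fun i hi j hj k hk l hl => ?_
    have := hbd j hj i hi l hl k hk
    linarith
  · refine exists_flushBox_of_tie (w₁ := -w₂) (w₂ := w₁) h hTn (by linarith) hx hz hxz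
      (by linarith) (fun i hi => by linarith [hm i hi]) fun i hi j hj k hk l hl => ?_
    have := hbd l hl k hk i hi j hj
    linarith
  · refine exists_flushBox_of_tie (w₁ := w₂) (w₂ := -w₁) h hTn (by linarith) hx hz hxz
      (by linarith) (fun i hi => by linarith [hm i hi]) fun i hi j hj k hk l hl => ?_
    have := hbd k hk l hl j hj i hi
    linarith

end flush


/-! ### Rectangles and coordinates -/

section rectangle

variable {X Y : ℕ → ℝ} {n p q : ℕ}

theorem mem_region_frameRect (hd : 0 < sqDist X Y p q) {x₁ x₂ h : ℝ} {i : ℕ}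
    (h₁ : x₁ ≤ along X Y p q i) (h₂ : along X Y p q i ≤ x₂) (h₃ : 0 ≤ depth X Y p q i)
    (h₄ : depth X Y p q i ≤ h) {z : Plane} (hz₀ : z 0 = X i) (hz₁ : z 1 = Y i) :
    z ∈ (frameRect X Y p q x₁ x₂ h).region := by
  have hα : (along X Y p q i - x₁) / (x₂ - x₁) * (x₂ - x₁) = along X Y p q i - x₁ := by
    by_cases h0 : x₂ - x₁ = 0
    · rw [h0]; linarith
    · rw [div_mul_cancel₀ _ h0]
  have hβ : depth X Y p q i / h * h = depth X Y p q i := by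
    by_cases h0 : h = 0
    · rw [h0]; linarith
    · rw [div_mul_cancel₀ _ h0]
  refine ⟨(along X Y p q i - x₁) / (x₂ - x₁), ⟨div_nonneg (by linarith) (by linarith),
    div_le_one_of_le₀ (by linarith) (by linarith)⟩, depth X Y p q i / h,
    ⟨div_nonneg h₃ (by linarith), div_le_one_of_le₀ h₄ (by linarith)⟩, ?_⟩
  generalize (along X Y p q i - x₁) / (x₂ - x₁) = α at hα
  generalize depth X Y p q i / h = β at hβ
  have hx : sqDist X Y p q * (X i - X p) =
      along X Y p q i * (X q - X p) + depth X Y p q i * (Y q - Y p) := by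
    unfold sqDist along depth; ring
  have hy : sqDist X Y p q * (Y i - Y p) =
      along X Y p q i * (Y q - Y p) - depth X Y p q i * (X q - X p) := by
    unfold sqDist along depth; ring
  ext j
  fin_cases j
  · simp only [frameRect, Fin.zero_eta, PiLp.add_apply, PiLp.smul_apply, smul_eq_mul, hz₀]
    simp
    field_simp
    linear_combination hx + (X q - X p) * hα.symm + (Y q - Y p) * hβ.symm
  · simp only [frameRect, Fin.mk_one, PiLp.add_apply, PiLp.smul_apply, smul_eq_mul, hz₁]
    simp
    field_simp
    linear_combination hy + (Y q - Y p) * hα.symm - (X q - X p) * hβ.symm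

/-- Points in a rectangle have, along the sides of the rectangle, a bounding box of at most its
area. -/
theorem _root_.Rectangle.exists_direction (r : Rectangle) {T : Finset ℕ}
    (hT : ∀ i ∈ T, ∃ z ∈ r.region, z 0 = X i ∧ z 1 = Y i)
    (hne : ∃ i ∈ T, ∃ j ∈ T, ¬ (X i = X j ∧ Y i = Y j)) :
    ∃ u₁ u₂ : ℝ, 0 < u₁ * u₁ + u₂ * u₂ ∧ ∀ i ∈ T, ∀ j ∈ T, ∀ k ∈ T, ∀ l ∈ T,
      ((u₁ * X i + u₂ * Y i) - (u₁ * X j + u₂ * Y j)) *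
        ((u₁ * Y k - u₂ * X k) - (u₁ * Y l - u₂ * X l)) ≤ r.area * (u₁ * u₁ + u₂ * u₂) := by
  obtain ⟨c, a, b, hperp⟩ := r
  have hp : a 0 * b 0 + a 1 * b 1 = 0 := by
    have := hperp
    simp [PiLp.inner_apply, Fin.sum_univ_two] at this
    linarith
  have hcoord : ∀ i ∈ T, ∃ α β : ℝ, 0 ≤ α ∧ α ≤ 1 ∧ 0 ≤ β ∧ β ≤ 1 ∧
      X i = c 0 + α * a 0 + β * b 0 ∧ Y i = c 1 + α * a 1 + β * b 1 := by
    intro i hi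
    obtain ⟨z, ⟨α, hα, β, hβ, rfl⟩, h0, h1⟩ := hT i hi
    exact ⟨α, β, hα.1, hα.2, hβ.1, hβ.2, by rw [← h0]; simp, by rw [← h1]; simp⟩
  have hna : ‖a‖ ^ 2 = a 0 * a 0 + a 1 * a 1 := by
    rw [EuclideanSpace.norm_sq_eq]; simp [Fin.sum_univ_two, sq]
  have hnb : ‖b‖ ^ 2 = b 0 * b 0 + b 1 * b 1 := by
    rw [EuclideanSpace.norm_sq_eq]; simp [Fin.sum_univ_two, sq]
  by_cases ha : 0 < a 0 * a 0 + a 1 * a 1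
  · refine ⟨a 0, a 1, ha, fun i hi j hj k hk l hl => ?_⟩
    obtain ⟨αi, βi, h1, h2, -, -, hxi, hyi⟩ := hcoord i hi
    obtain ⟨αj, βj, h3, h4, -, -, hxj, hyj⟩ := hcoord j hj
    obtain ⟨αk, βk, -, -, h5, h6, hxk, hyk⟩ := hcoord k hk
    obtain ⟨αl, βl, -, -, h7, h8, hxl, hyl⟩ := hcoord l hl
    have e1 : (a 0 * X i + a 1 * Y i) - (a 0 * X j + a 1 * Y j) = (αi - αj) * ‖a‖ ^ 2 := by
      rw [hna, hxi, hyi, hxj, hyj]; linear_combination (βi - βj) * hp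
    have e2 : (a 0 * Y k - a 1 * X k) - (a 0 * Y l - a 1 * X l) =
        (βk - βl) * (a 0 * b 1 - a 1 * b 0) := by
      rw [hxk, hyk, hxl, hyl]; ring
    have e3 : |a 0 * b 1 - a 1 * b 0| ≤ ‖a‖ * ‖b‖ := by
      refine abs_le_of_sq_le_sq ?_ (by positivity)
      rw [mul_pow, hna, hnb]
      nlinarith
    rw [e1, e2, ← hna]
    change _ ≤ ‖a‖ * ‖b‖ * ‖a‖ ^ 2
    calc _ ≤ ‖a‖ ^ 2 * (‖a‖ * ‖b‖) := by
          refine mul_le_mul_of_abs_le ?_ ?_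
          · rw [abs_mul, abs_of_nonneg (sq_nonneg ‖a‖)]
            exact mul_le_of_le_one_left (sq_nonneg _) (abs_le.mpr ⟨by linarith, by linarith⟩)
          · rw [abs_mul]
            exact (mul_le_of_le_one_left (abs_nonneg _)
              (abs_le.mpr ⟨by linarith, by linarith⟩)).trans e3
      _ = ‖a‖ * ‖b‖ * ‖a‖ ^ 2 := by ring
  · have ha0 : a 0 = 0 := by nlinarith [mul_self_nonneg (a 0), mul_self_nonneg (a 1)]
    have ha1 : a 1 = 0 := by nlinarith [mul_self_nonneg (a 0), mul_self_nonneg (a 1)]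
    have hb : 0 < b 0 * b 0 + b 1 * b 1 := by
      by_contra hb
      have hb0 : b 0 = 0 := by nlinarith [mul_self_nonneg (b 0), mul_self_nonneg (b 1)]
      have hb1 : b 1 = 0 := by nlinarith [mul_self_nonneg (b 0), mul_self_nonneg (b 1)]
      obtain ⟨i, hi, j, hj, hij⟩ := hne
      obtain ⟨αi, βi, -, -, -, -, hxi, hyi⟩ := hcoord i hi
      obtain ⟨αj, βj, -, -, -, -, hxj, hyj⟩ := hcoord j hj
      refine hij ⟨?_, ?_⟩
      · rw [hxi, hxj, ha0, hb0]; ring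
      · rw [hyi, hyj, ha1, hb1]; ring
    refine ⟨b 0, b 1, hb, fun i hi j hj k hk l hl => ?_⟩
    obtain ⟨αk, βk, -, -, h5, h6, hxk, hyk⟩ := hcoord k hk
    obtain ⟨αl, βl, -, -, h7, h8, hxl, hyl⟩ := hcoord l hl
    have e2 : (b 0 * Y k - b 1 * X k) - (b 0 * Y l - b 1 * X l) = 0 := by
      rw [hxk, hyk, hxl, hyl, ha0, ha1]; ring
    rw [e2, mul_zero]
    exact mul_nonneg (mul_nonneg (norm_nonneg _) (norm_nonneg _)) hb.le

end rectangle

/-! ### Few points have few points to the left of a line -/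

section colouring

variable {ι : Type*} [Fintype ι] [DecidableEq ι] {m : ℕ}

/-- One of `m` colours is prescribed for the item `l` in terms of the colours of the others: this
holds for one in `m` of the colourings. -/
theorem card_colour_eq (l : ι) (P : (ι → Fin m) → Prop) [DecidablePred P] (v : (ι → Fin m) → Fin m)
    (hP : ∀ c x, P (Function.update c l x) ↔ P c) (hv : ∀ c x, v (Function.update c l x) = v c) :
    (Finset.univ.filter (fun c => P c ∧ c l = v c)).card * m =
      (Finset.univ.filter (fun c => P c)).card := by
  have h : ((Finset.univ.filter (fun c => P c ∧ c l = v c)) ×ˢ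
      (Finset.univ : Finset (Fin m))).card = (Finset.univ.filter (fun c => P c)).card := by
    refine Finset.card_nbij' (fun x => Function.update x.1 l x.2)
      (fun c => (Function.update c l (v c), c l)) ?_ ?_ ?_ ?_
    · rintro ⟨c, x⟩ hc
      simp only [Finset.mem_coe, Finset.mem_product, Finset.mem_filter, Finset.mem_univ, true_and,
        and_true] at hc ⊢
      exact (hP c x).mpr hc.1
    · intro c hc
      simp only [Finset.mem_coe, Finset.mem_product, Finset.mem_filter, Finset.mem_univ, true_and,
        and_true] at hc ⊢
      refine ⟨(hP c _).mpr hc, ?_⟩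
      rw [hv]; simp
    · rintro ⟨c, x⟩ hc
      simp only [Finset.mem_coe, Finset.mem_product, Finset.mem_filter, Finset.mem_univ, true_and,
        and_true] at hc
      ext1
      · simp only [hv, Function.update_idem]
        rw [← hc.2, Function.update_eq_self]
      · simp
    · intro c hc
      simp
  rw [← h, Finset.card_product, Finset.card_univ, Fintype.card_fin]

/-- Each pair of a family of ordered pairs `(i, j)` has at most `t` points `l` with `L i j l` (on
its left), and among two pairs with the same first point one has the other's second point on its
left. Then a first point occurs, on average, in at most `4 (t + 1)` pairs.

In a random colouring with `2 (t + 1)` colours, a pair has with probability at least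
`1 / (4 (t + 1))` one colour that no point on its left has; but each first point is in at most one
such pair. -/
theorem card_pairs_le (t : ℕ) (L : ι → ι → ι → Prop) [∀ i j, DecidablePred (L i j)]
    (hLl : ∀ i j, ¬ L i j i) (hLr : ∀ i j, ¬ L i j j)
    (hL : ∀ i j j', i ≠ j → i ≠ j' → j ≠ j' → L i j j' ∨ L i j' j) (U : Finset ι)
    (E : Finset (ι × ι)) (hEU : ∀ e ∈ E, e.1 ∈ U) (hEne : ∀ e ∈ E, e.1 ≠ e.2)
    (hEt : ∀ e ∈ E, (Finset.univ.filter (L e.1 e.2)).card ≤ t) :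
    E.card ≤ 4 * U.card * (t + 1) := by
  set m := 2 * (t + 1) with hm
  have : NeZero m := ⟨by omega⟩
  set good : (ι → Fin m) → ι × ι → Prop :=
    fun c e => c e.2 = c e.1 ∧ ∀ l, L e.1 e.2 l → c l ≠ c e.1 with hgood
  have : ∀ c, DecidablePred (good c) := fun c e => Classical.propDecidable _
  set M := (Finset.univ : Finset (ι → Fin m)).card with hM
  have hMpos : 0 < M := Finset.card_pos.mpr ⟨fun _ => 0, Finset.mem_univ _⟩
  -- a colouring is good for at most one pair with a given first point
  have hupper : ∀ c, (E.filter (good c)).card ≤ U.card := by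
    intro c
    refine Finset.card_le_card_of_injOn Prod.fst (fun e he => ?_) ?_
    · exact hEU e (Finset.mem_filter.mp he).1
    · rintro ⟨i, j⟩ he ⟨i', j'⟩ he' (rfl : i = i')
      simp only [Finset.mem_coe, Finset.mem_filter] at he he'
      by_contra hne
      have hjj : j ≠ j' := fun h => hne (by rw [h])
      rcases hL i j j' (hEne _ he.1) (hEne _ he'.1) hjj with h | h
      · exact he.2.2 j' h he'.2.1
      · exact he'.2.2 j h he.2.1
  -- a pair is good for many colourings
  have hlower : ∀ e ∈ E, M ≤ 2 * m * (Finset.univ.filter (fun c => good c e)).card := by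
    rintro ⟨i, j⟩ he
    have hij : i ≠ j := hEne _ he
    have hlt := hEt _ he
    simp only at hlt
    have h1 : (Finset.univ.filter (fun c : ι → Fin m => c j = c i)).card * m = M := by
      have := card_colour_eq (m := m) j (fun _ => True) (fun c => c i) (fun _ _ => Iff.rfl)
        (fun c x => Function.update_of_ne hij _ _)
      simpa [hM] using this
    have h2 : ∀ l, L i j l → (Finset.univ.filter
        (fun c : ι → Fin m => c j = c i ∧ c l = c i)).card * m =
        (Finset.univ.filter (fun c : ι → Fin m => c j = c i)).card := by
      intro l hl
      have hli : i ≠ l := fun h => hLl i j (by rwa [← h] at hl)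
      have hlj : j ≠ l := fun h => hLr i j (by rwa [← h] at hl)
      refine card_colour_eq (m := m) l (fun c => c j = c i) (fun c => c i) (fun c x => ?_)
        (fun c x => Function.update_of_ne hli _ _)
      rw [Function.update_of_ne hli, Function.update_of_ne hlj]
    set N := (Finset.univ.filter (fun c : ι → Fin m => c j = c i)).card with hN
    set G := (Finset.univ.filter (fun c => good c (i, j))).card with hG
    have hcover : (Finset.univ.filter (fun c : ι → Fin m => c j = c i)) ⊆
        (Finset.univ.filter (fun c => good c (i, j))) ∪
        (Finset.univ.filter (L i j)).biUnion (fun l => Finset.univ.filter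
          (fun c : ι → Fin m => c j = c i ∧ c l = c i)) := by
      intro c hc
      simp only [Finset.mem_filter, Finset.mem_univ, true_and] at hc
      rw [Finset.mem_union]
      by_cases hg : good c (i, j)
      · left; simpa using hg
      · right
        simp only [hgood, not_and, not_forall, not_not] at hg
        obtain ⟨l, hl, hcl⟩ := hg hc
        rw [Finset.mem_biUnion]
        exact ⟨l, by simpa using hl, by simpa using ⟨hc, hcl⟩⟩
    have hc1 := (Finset.card_le_card hcover).trans (Finset.card_union_le _ _)
    have hc2 : ((Finset.univ.filter (L i j)).biUnion (fun l => Finset.univ.filter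
          (fun c : ι → Fin m => c j = c i ∧ c l = c i))).card * m ≤ t * N := by
      calc _ ≤ (∑ l ∈ Finset.univ.filter (L i j), (Finset.univ.filter
            (fun c : ι → Fin m => c j = c i ∧ c l = c i)).card) * m :=
            Nat.mul_le_mul_right _ Finset.card_biUnion_le
        _ = ∑ l ∈ Finset.univ.filter (L i j), N := by
            rw [Finset.sum_mul]
            exact Finset.sum_congr rfl fun l hl => h2 l (by simpa using hl)
        _ ≤ t * N := by
            rw [Finset.sum_const, smul_eq_mul]; exact Nat.mul_le_mul_right _ hlt
    have hc3 : N * m ≤ G * m + t * N := by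
      calc N * m ≤ (G + _) * m := Nat.mul_le_mul_right _ hc1
        _ ≤ G * m + t * N := by rw [add_mul]; exact Nat.add_le_add_left hc2 _
    have hc4 : N ≤ 2 * G := by
      have : N * (t + 2) ≤ 2 * G * (t + 1) := by rw [hm] at hc3; nlinarith
      by_contra hcon
      nlinarith
    calc M = N * m := h1.symm
      _ ≤ 2 * G * m := Nat.mul_le_mul_right _ hc4
      _ = 2 * m * G := by ring
  have hsum : ∑ e ∈ E, (Finset.univ.filter (fun c => good c e)).card =
      ∑ c : ι → Fin m, (E.filter (good c)).card := by
    simp only [Finset.card_filter]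
    exact Finset.sum_comm
  have hfinal : E.card * M ≤ 2 * m * (U.card * M) := by
    calc E.card * M = ∑ _e ∈ E, M := by rw [Finset.sum_const, smul_eq_mul]
      _ ≤ ∑ e ∈ E, 2 * m * (Finset.univ.filter (fun c => good c e)).card :=
          Finset.sum_le_sum hlower
      _ = 2 * m * ∑ c : ι → Fin m, (E.filter (good c)).card := by rw [← Finset.mul_sum, hsum]
      _ ≤ 2 * m * (U.card * M) := by
          refine Nat.mul_le_mul_left _ ?_
          calc _ ≤ ∑ _c : ι → Fin m, U.card := Finset.sum_le_sum fun c _ => hupper c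
            _ = U.card * M := by rw [Finset.sum_const, smul_eq_mul, mul_comm]
  have : E.card * M ≤ (4 * U.card * (t + 1)) * M := by
    calc _ ≤ _ := hfinal
      _ = _ := by rw [hm]; ring
  exact Nat.le_of_mul_le_mul_right this hMpos

end colouring

/-! ### Convex layers -/

section layers

open scoped Classical in
/-- A point that survives the removal of `j` layers has `j` points strictly beyond it in every
direction, one for each layer. -/
theorem le_card_beyond (Z : Finset Plane) (f : Plane →L[ℝ] ℝ) (hf : f ≠ 0) {x : Plane} (j : ℕ)
    (hx : x ∈ afterLayers Z j) :
    j + ((afterLayers Z j).filter (fun y => f x < f y)).card ≤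
      (Z.filter (fun y => f x < f y)).card := by
  induction j with
  | zero => simp [afterLayers]
  | succ j ih =>
    set A := afterLayers Z j with hA
    have hxA : x ∈ A := (Finset.mem_sdiff.mp hx).1
    have hxh : x ∉ hullPoints A := (Finset.mem_sdiff.mp hx).2
    obtain ⟨y, hy, hmax⟩ := Finset.exists_max_image A f ⟨x, hxA⟩
    have hsub : (A : Set Plane) ⊆ convexHull ℝ (A : Set Plane) := subset_convexHull ℝ _
    have hle : ∀ z ∈ convexHull ℝ (A : Set Plane), f z ≤ f y := by
      have : convexHull ℝ (A : Set Plane) ⊆ {z | f z ≤ f y} :=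
        convexHull_min (fun z hz => hmax z hz) (convex_halfSpace_le f.isLinear _)
      exact fun z hz => this hz
    have hint : ∀ z ∈ interior (convexHull ℝ (A : Set Plane)), f z < f y := by
      intro z hz
      have hopen : IsOpenMap f := f.isOpenMap_of_ne_zero hf
      have : f '' interior (convexHull ℝ (A : Set Plane)) ⊆ interior (Set.Iic (f y)) := by
        refine interior_maximal ?_ (hopen _ isOpen_interior)
        rintro _ ⟨w, hw, rfl⟩
        exact hle w (interior_subset hw)
      rw [interior_Iic] at this
      exact this ⟨z, hz, rfl⟩
    have hfront : ∀ z ∈ A, z ∈ frontier (convexHull ℝ (A : Set Plane)) ∨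
        z ∈ interior (convexHull ℝ (A : Set Plane)) := by
      intro z hz
      by_cases h : z ∈ interior (convexHull ℝ (A : Set Plane))
      · exact Or.inr h
      · exact Or.inl ⟨subset_closure (hsub hz), h⟩
    have hxy : f x < f y := by
      rcases hfront x hxA with h | h
      · exact absurd (Finset.mem_filter.mpr ⟨hxA, h⟩) hxh
      · exact hint x h
    have hyh : y ∈ hullPoints A := by
      refine Finset.mem_filter.mpr ⟨hy, ?_⟩
      rcases hfront y hy with h | h
      · exact h
      · exact absurd (hint y h) (lt_irrefl _)
    have hlt : ((afterLayers Z (j + 1)).filter (fun y => f x < f y)).card <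
        (A.filter (fun y => f x < f y)).card := by
      refine Finset.card_lt_card ((Finset.ssubset_iff_of_subset ?_).mpr ⟨y, ?_, ?_⟩)
      · exact Finset.filter_subset_filter _ Finset.sdiff_subset
      · simp [hy, hxy]
      · intro h
        exact (Finset.mem_sdiff.mp (Finset.mem_filter.mp h).1).2 hyh
    have := ih hxA
    omega

open scoped Classical in
theorem mem_afterLayers {Z : Finset Plane} {x : Plane} (hx : x ∈ Z) (j : ℕ)
    (h : x ∉ (Finset.range j).biUnion (fun i => hullPoints (afterLayers Z i))) :
    x ∈ afterLayers Z j := by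
  induction j with
  | zero => exact hx
  | succ j ih =>
    simp only [Finset.mem_biUnion, Finset.mem_range, not_exists, not_and] at h ih
    exact Finset.mem_sdiff.mpr ⟨ih fun i hi => h i (by omega), h j (by omega)⟩

end layers


/-! ### The algorithm -/

namespace Prog

/-- For each line from a point `p` to a point `q` with at most `t` points on its left, tries the
best boxes on that line. -/
def algorithm : Prog :=
  parents ;; (setR 0 (ra a_x 0) ;; setR 1 (ra a_y 0)) ;;
  forLoop v_p (iv v_n) (countLeft ;; forLoop v_q (iv v_n)
    (branch (.both (.neg (.both (.neg (.ilt (iv v_p) (iv v_q))) (.neg (.ilt (iv v_q) (iv v_p)))))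
        (.neg (.ilt (iv v_t) (ia a_cnt (iv v_q)))))
      edge skip))

end Prog

/-- The line from `p` to `q` has been dealt with: the result is at least as good as any box on this
line with enough points. -/
def Done (n t : ℕ) (X Y : ℕ → ℝ) (p q : ℕ) (s : State) : Prop :=
  p ≠ q → leftCount n X Y p q ≤ t → ∀ (T : ℕ → Prop) (v : ℝ),
    (∀ i < n, T i → 0 ≤ depth X Y p q i) → n - t ≤ countBelow n T →
    (∀ k < n, T k → ∀ l < n, T l → ∀ r < n, T r →
      (along X Y p q k - along X Y p q l) * depth X Y p q r ≤ v * sqDist X Y p q) →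
    Reached s v

theorem Done.improves {n t : ℕ} {X Y : ℕ → ℝ} {p q : ℕ} {s s' : State}
    {Init Encl : Rectangle → Prop} (h : Done n t X Y p q s) (hI : Improves Init Encl s s') :
    Done n t X Y p q s' :=
  fun hpq hle T v h1 h2 h3 => hI.keep v (h hpq hle T v h1 h2 h3)

/-- A bound for the number of steps of `Prog.edge`. -/
def edgeCost (n t : ℕ) : ℕ :=
  500 * n + 500 + (t + 1) * (150 * Nat.log 2 (2 * n) + 400 * (t + 1) + 300)

open scoped Classical in
/-- The number of ordered pairs of points with at most `t` points on the left of their line. -/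
noncomputable def edgeCount (n t : ℕ) (X Y : ℕ → ℝ) : ℕ :=
  ∑ p ∈ Finset.range n, ∑ q ∈ Finset.range n,
    if p ≠ q ∧ leftCount n X Y p q ≤ t then 1 else 0

section

variable {X Y : ℕ → ℝ} {n t : ℕ} {Init Encl : Rectangle → Prop}

/-- `Init` is a property of the rectangle that consists of the first point, and `Encl` one of the
rectangles that the search can find. -/
theorem run_algorithm (h : GeneralPosition n X Y) (htn : t < n)
    (hEncl : ∀ p < n, ∀ q < n, p ≠ q → ∀ x₁ x₂ h, n - t ≤ countBelow n (fun i =>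
      x₁ ≤ along X Y p q i ∧ along X Y p q i ≤ x₂ ∧ 0 ≤ depth X Y p q i ∧ depth X Y p q i ≤ h) →
      Encl (frameRect X Y p q x₁ x₂ h))
    {s : State} (hn : s.ivar v_n = n) (ht : s.ivar v_t = t) (hx : s.rarr a_x = X)
    (hy : s.rarr a_y = Y) (hf : s.ivar v_found = 0) (hz : ∀ i, s.rvar i = 0)
    (hInit : Init ⟨!₂[X 0, Y 0], 0, 0, by simp⟩) :
    Run Prog.algorithm s (60 + 400 * n + 500 * n * n + n * n * (50 * Nat.log 2 (2 * n)) +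
        edgeCount n t X Y * edgeCost n t)
      (fun s' => Sound Init Encl s' ∧ ∀ p < n, ∀ q < n, Done n t X Y p q s') := by
  classical
  set L := Nat.log 2 (2 * n) with hL
  set F : ℕ → ℕ → ℕ := fun p q =>
    (if p ≠ q ∧ leftCount n X Y p q ≤ t then 1 else 0) * edgeCost n t + 20 with hF
  refine ((run_parents hn).seq (B' := 10 + (∑ p ∈ Finset.range n, (((400 * n + 300 + n * (L * 50)) +
    (∑ q ∈ Finset.range n, (F p q + 1 + 7) + 1 + 6)) + 1 + 7) + 1 + 6)) ?_).mono ?_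
    (fun _ _ h => h)
  swap
  · have e1 : ∀ p, ∑ q ∈ Finset.range n, (F p q + 1 + 7) =
        (∑ q ∈ Finset.range n, if p ≠ q ∧ leftCount n X Y p q ≤ t then 1 else 0) * edgeCost n t +
          n * 28 := by
      intro p
      simp only [hF, add_assoc]
      rw [Finset.sum_add_distrib, ← Finset.sum_mul, Finset.sum_const, Finset.card_range,
        smul_eq_mul]
      rfl
    simp only [e1]
    have e2 : ∑ p ∈ Finset.range n, (((400 * n + 300 + n * (L * 50)) +
        ((∑ q ∈ Finset.range n, if p ≠ q ∧ leftCount n X Y p q ≤ t then 1 else 0) * edgeCost n t +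
          n * 28 + 1 + 6)) + 1 + 7) =
        edgeCount n t X Y * edgeCost n t + n * (428 * n + 315 + n * (L * 50)) := by
      have : ∀ c : ℕ, ((400 * n + 300 + n * (L * 50)) + (c * edgeCost n t + n * 28 + 1 + 6)) + 1 + 7
          = c * edgeCost n t + (428 * n + 315 + n * (L * 50)) := by intro c; ring
      simp only [this]
      rw [Finset.sum_add_distrib, ← Finset.sum_mul, Finset.sum_const, Finset.card_range,
        smul_eq_mul, edgeCount]
    rw [e2]
    nlinarith
  intro s₁ hF₁ hpar
  have hE₁ : Env n t X Y s₁ := ⟨(hF₁.ivar 0 rfl).trans hn, (hF₁.ivar 1 rfl).trans ht,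
    (hF₁.rarr 0 rfl).trans hx, (hF₁.rarr 1 rfl).trans hy, hpar⟩
  have hf₁ : s₁.ivar v_found = 0 := (hF₁.ivar 14 rfl).trans hf
  have hz₁ : ∀ i, s₁.rvar i = 0 := fun i => (hF₁.rvar i rfl).trans (hz i)
  refine (Run.seq (Q := fun s' => Sound Init Encl s') (Run.of_loopFree rfl
    (Nat.le_of_ble_eq_true rfl) ?_)) ?_
  · refine ⟨_, ?_, fun _ => hInit, ?_⟩
    · refine ⟨?_, ?_, ?_, ?_, ?_, ?_⟩ <;> simp [Prog.result, hE₁.x_eq, hE₁.y_eq, hz₁]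
    · intro hpos
      simp [Prog.result, hf₁] at hpos
  intro s₂ hF₂ hS₂
  have hE₂ := hE₁.of_frame hF₂ rfl rfl rfl rfl rfl
  refine (Run.forLoop (N := n) (fun p s' => Sound Init Encl s' ∧
    ∀ p' < p, ∀ q < n, Done n t X Y p' q s') _ rfl
    (by intro s' hF; exact (hF.ivar 0 rfl).trans hE₂.n_eq) ?_ ?_).mono le_rfl
    (fun _ _ h => h)
  · obtain ⟨r, hr⟩ := hS₂
    exact ⟨⟨r, hr⟩, by simp⟩
  rintro p s₃ hp hvp hF₃ ⟨hS₃, hD₃⟩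
  have hE₃ := hE₂.of_frame hF₃ rfl rfl rfl rfl rfl
  refine (run_countLeft h hE₃ hvp hp).seq ?_
  intro s₄ hF₄ hcnt
  have hE₄ := hE₃.of_frame hF₄ rfl rfl rfl rfl rfl
  have hvp₄ : s₄.ivar v_p = p := (hF₄.ivar 2 rfl).trans hvp
  have hI₄ := Improves.of_frame (Init := Init) (Encl := Encl) rfl hF₄ hS₃
  refine (Run.forLoop (N := n) (fun q s' => Improves Init Encl s₃ s' ∧
    ∀ q' < q, Done n t X Y p q' s') (F p) rfl
    (by intro s' hF; exact (hF.ivar 0 rfl).trans hE₄.n_eq) ?_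
    ?_).mono le_rfl ?_
  · exact ⟨⟨hI₄.sound, hI₄.keep⟩, by simp⟩
  · rintro q s₅ hq hvq hF₅ ⟨hI₅, hD₅⟩
    have hE₅ := hE₄.of_frame hF₅ rfl rfl rfl rfl rfl
    have hvp₅ : s₅.ivar v_p = p := (hF₅.ivar 2 rfl).trans hvp₄
    have hcnt₅ : s₅.iarr a_cnt = s₄.iarr a_cnt := hF₅.iarr 5 rfl
    by_cases hgo : p ≠ q ∧ leftCount n X Y p q ≤ t
    · have hc : s₅.iarr a_cnt q = leftCount n X Y p q := by
        rw [hcnt₅, hcnt q hq hgo.1.symm]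
      refine (Run.branch (B := edgeCost n t) (fun _ => ?_) (fun hb => ?_)).mono ?_
        (fun _ _ h => h)
      · refine (run_edge h hp hq hgo.1 htn (hEncl p hp q hq hgo.1) hE₅ hvp₅ hvq hc hgo.2
          hI₅.sound).mono le_rfl ?_
        rintro s₆ hF₆ ⟨hI₆, hR₆⟩
        have hI := hI₅.trans hI₆
        refine ⟨⟨hI.sound, hI.keep⟩, fun q' hq' => ?_⟩
        rcases Nat.lt_succ_iff_lt_or_eq.mp hq' with hlt | rfl
        · have hD : Done n t X Y p q' s₆ := (hD₅ q' hlt).improves hI₆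
          exact hD
        · exact fun _ _ => hR₆
      · exfalso
        apply hb
        simp only [Test.holds_both, Test.holds_neg, Test.holds_ilt, IExp.eval_var, IExp.eval_get,
          hvp₅, hvq, hE₅.t_eq, hc]
        omega
      · simp only [hF, if_pos hgo, one_mul]
        have hc : (Test.both (.neg (.both (.neg (.ilt (iv v_p) (iv v_q)))
          (.neg (.ilt (iv v_q) (iv v_p))))) (.neg (.ilt (iv v_t) (ia a_cnt (iv v_q))))).cost = 16 :=
          rfl
        omega
    · refine (Run.branch (B := 1) (fun hb => ?_) (fun hb => ?_)).mono ?_ (fun _ _ h => h)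
      · exfalso
        apply hgo
        simp only [Test.holds_both, Test.holds_neg, Test.holds_ilt, IExp.eval_var, IExp.eval_get,
          hvp₅, hvq, hE₅.t_eq, hcnt₅] at hb
        have hpq : p ≠ q := by omega
        rw [hcnt q hq hpq.symm] at hb
        exact ⟨hpq, by omega⟩
      · refine Run.skip ⟨⟨hI₅.sound, hI₅.keep⟩, fun q' hq' => ?_⟩
        rcases Nat.lt_succ_iff_lt_or_eq.mp hq' with hlt | rfl
        · exact hD₅ q' hlt
        · exact fun h1 h2 => absurd ⟨h1, h2⟩ hgo
      · simp only [hF, if_neg hgo, zero_mul]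
        exact Nat.le_of_ble_eq_true rfl
  · rintro s₆ hF₆ ⟨hI₆, hD₆⟩
    refine ⟨hI₆.sound, fun p' hp' q hq => ?_⟩
    rcases Nat.lt_succ_iff_lt_or_eq.mp hp' with hlt | rfl
    · have hD : Done n t X Y p' q s₆ := (hD₃ p' hlt q hq).improves hI₆
      exact hD
    · exact hD₆ q hq

end

/-! ### The points of the plane as input -/

section input

variable {n t : ℕ} (P : Fin n ↪ Plane)

/-- The coordinates with index `j` of the points, as the input contains them. -/
noncomputable def coordinate (j : Fin 2) (i : ℕ) : ℝ := if h : i < n then P ⟨i, h⟩ j else 0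

theorem coordinate_val (j : Fin 2) (i : Fin n) : coordinate P j i = P i j := by
  simp [coordinate]

theorem cross_coordinate (i j k : Fin n) :
    cross (coordinate P 0) (coordinate P 1) i j k =
      (P j 0 - P i 0) * (P k 1 - P i 1) - (P j 1 - P i 1) * (P k 0 - P i 0) := by
  simp only [cross, coordinate_val]

theorem plane_ext {a b : Plane} (h0 : a 0 = b 0) (h1 : a 1 = b 1) : a = b := by
  ext j
  fin_cases j
  · exact h0
  · exact h1

theorem generalPosition_of_noThreeCollinear (h : NoThreeCollinear (Finset.univ.map P)) :
    GeneralPosition n (coordinate P 0) (coordinate P 1) := by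
  constructor
  · intro i hi j hj hx hy
    have := P.injective (a₁ := ⟨i, hi⟩) (a₂ := ⟨j, hj⟩)
      (plane_ext (by simpa [coordinate, hi, hj] using hx) (by simpa [coordinate, hi, hj] using hy))
    simpa using this
  · intro i hi j hj k hk hij hik hjk h0
    have hcr := cross_coordinate P ⟨i, hi⟩ ⟨j, hj⟩ ⟨k, hk⟩
    simp only at hcr
    rw [h0] at hcr
    have hmem : ∀ l : Fin n, P l ∈ Finset.univ.map P := fun l => by simp
    have hne : ∀ {a b : ℕ} (ha : a < n) (hb : b < n), a ≠ b → P ⟨a, ha⟩ ≠ P ⟨b, hb⟩ := by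
      intro a b ha hb hab he
      exact hab (by simpa using P.injective he)
    refine h _ (hmem ⟨i, hi⟩) _ (hmem ⟨j, hj⟩) _ (hmem ⟨k, hk⟩) (hne hi hj hij) (hne hi hk hik)
      (hne hj hk hjk) ?_
    have hab := hne hi hj hij
    generalize P ⟨i, hi⟩ = a at *
    generalize P ⟨j, hj⟩ = b at *
    generalize P ⟨k, hk⟩ = c at *
    have hd : (b 0 - a 0) ^ 2 + (b 1 - a 1) ^ 2 ≠ 0 := by
      intro hz
      refine hab (plane_ext ?_ ?_) <;> nlinarith [sq_nonneg (b 0 - a 0), sq_nonneg (b 1 - a 1)]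
    rw [collinear_iff_of_mem (p₀ := a) (by simp)]
    refine ⟨b - a, fun x hx => ?_⟩
    simp only [Set.mem_insert_iff, Set.mem_singleton_iff] at hx
    rcases hx with rfl | rfl | rfl
    · exact ⟨0, by simp⟩
    · exact ⟨1, by simp⟩
    · refine ⟨((x 0 - a 0) * (b 0 - a 0) + (x 1 - a 1) * (b 1 - a 1)) /
        ((b 0 - a 0) ^ 2 + (b 1 - a 1) ^ 2), plane_ext ?_ ?_⟩
      · simp only [vadd_eq_add, PiLp.add_apply, PiLp.smul_apply, PiLp.sub_apply, smul_eq_mul]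
        field_simp
        linear_combination (b 1 - a 1) * hcr
      · simp only [vadd_eq_add, PiLp.add_apply, PiLp.smul_apply, PiLp.sub_apply, smul_eq_mul]
        field_simp
        linear_combination (-(b 0 - a 0)) * hcr

open scoped Classical in
theorem card_filter_univ_eq_countBelow (Q : ℕ → Prop) :
    (Finset.univ.filter (fun i : Fin n => Q i)).card = countBelow n Q := by
  unfold countBelow
  rw [Finset.card_filter, Finset.card_filter,
    Fin.sum_univ_eq_sum_range (fun i => if Q i then 1 else 0)]

open scoped Classical in
theorem card_filter_map (R : Plane → Prop) :
    ((Finset.univ.map P).filter R).card = (Finset.univ.filter (fun i => R (P i))).card := by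
  rw [Finset.filter_map, Finset.card_map]
  rfl

theorem enclosed_eq (r : Rectangle) (Q : ℕ → Prop) (hQ : ∀ i : Fin n, P i ∈ r.region ↔ Q i) :
    r.enclosed (Finset.univ.map P) = countBelow n Q := by
  classical
  rw [← card_filter_univ_eq_countBelow]
  unfold Rectangle.enclosed
  have := card_filter_map P (fun x => x ∈ r.region)
  simp only [hQ] at this
  convert this

/-- A point with a line through another point and at most `t` points on its left is on one of the
first `t + 1` convex layers. -/
theorem mem_layers_of_leftCount_le {i j : Fin n} (hij : i ≠ j)
    (hle : leftCount n (coordinate P 0) (coordinate P 1) i j ≤ t) :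
    P i ∈ (open scoped Classical in (Finset.range (t + 1)).biUnion
      (fun l => hullPoints (afterLayers (Finset.univ.map P) l))) := by
  classical
  by_contra hnot
  have hmem := mem_afterLayers (by simp) (t + 1) hnot
  set f : Plane →L[ℝ] ℝ := (P j 0 - P i 0) • EuclideanSpace.proj 1 -
    (P j 1 - P i 1) • EuclideanSpace.proj 0 with hf
  have hfv : ∀ z : Plane, f z = (P j 0 - P i 0) * z 1 - (P j 1 - P i 1) * z 0 := by
    intro z; simp [hf]
  have hf0 : f ≠ 0 := by
    intro h0
    have h1 := hfv !₂[-(P j 1 - P i 1), P j 0 - P i 0]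
    rw [h0] at h1
    simp at h1
    refine hij (P.injective (plane_ext ?_ ?_))
    · nlinarith [mul_self_nonneg (P j 0 - P i 0), mul_self_nonneg (P j 1 - P i 1)]
    · nlinarith [mul_self_nonneg (P j 0 - P i 0), mul_self_nonneg (P j 1 - P i 1)]
  have hb := le_card_beyond _ f hf0 (t + 1) hmem
  rw [card_filter_map] at hb
  have e : (Finset.univ.filter (fun l => f (P i) < f (P l))).card =
      leftCount n (coordinate P 0) (coordinate P 1) i j := by
    rw [leftCount, ← countBelow, ← card_filter_univ_eq_countBelow]
    congr 1
    ext l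
    simp only [Finset.mem_filter, Finset.mem_univ, true_and, cross_coordinate, hfv]
    constructor <;> intro h <;> linarith
  omega

/-- The first point of a line with at most `t` points on its left lies on the first `t + 1` layers,
and a point occurs, on average, in at most `4 (t + 1)` such lines: two lines with the same first
point have one second point on the left of the other line. -/
theorem edgeCount_le (h : GeneralPosition n (coordinate P 0) (coordinate P 1)) :
    edgeCount n t (coordinate P 0) (coordinate P 1) ≤
      4 * layerCount (Finset.univ.map P) t * (t + 1) := by
  classical
  set X := coordinate P 0 with hX
  set Y := coordinate P 1 with hY
  set E : Finset (Fin n × Fin n) := Finset.univ.filter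
    (fun e => (e.1 : ℕ) ≠ e.2 ∧ leftCount n X Y e.1 e.2 ≤ t) with hE
  set lay := (Finset.range (t + 1)).biUnion
      (fun l => hullPoints (afterLayers (Finset.univ.map P) l)) with hlay
  have hcard : edgeCount n t X Y = E.card := by
    rw [hE, Finset.card_filter, ← Finset.univ_product_univ, Finset.sum_product, edgeCount,
      ← Fin.sum_univ_eq_sum_range (fun p => ∑ q ∈ Finset.range n,
        if p ≠ q ∧ leftCount n X Y p q ≤ t then 1 else 0)]
    refine Finset.sum_congr rfl fun p _ => ?_
    rw [← Fin.sum_univ_eq_sum_range (fun q =>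
        if (p : ℕ) ≠ q ∧ leftCount n X Y p q ≤ t then 1 else 0)]
  have hU : (Finset.univ.filter (fun i => P i ∈ lay)).card ≤ layerCount (Finset.univ.map P) t := by
    refine (Finset.card_le_card_of_injOn (t := lay) P (fun i hi => ?_) P.injective.injOn).trans
      (le_of_eq ?_)
    · simpa using hi
    · rw [layerCount]
  rw [hcard]
  refine (card_pairs_le t (fun i j l : Fin n => 0 < cross X Y i j l) ?_ ?_ ?_
    (Finset.univ.filter (fun i => P i ∈ lay)) E ?_ ?_ ?_).trans ?_
  · intro i j; rw [cross_self_left]; exact lt_irrefl _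
  · intro i j; rw [cross_self_right]; exact lt_irrefl _
  · intro i j j' h1 h2 h3
    have h0 := h.cross_ne_zero i i.2 j j.2 j' j'.2 (by simpa [Fin.ext_iff] using h1)
      (by simpa [Fin.ext_iff] using h2) (by simpa [Fin.ext_iff] using h3)
    have ha : cross X Y i j' j = - cross X Y i j j' := by unfold cross; ring
    rw [ha]
    rcases lt_or_gt_of_ne h0 with h' | h'
    · right; linarith
    · left; exact h'
  · rintro ⟨i, j⟩ he
    simp only [hE, Finset.mem_filter, Finset.mem_univ, true_and] at he ⊢
    have := mem_layers_of_leftCount_le (t := t) P (i := i) (j := j)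
      (fun h => he.1 (by rw [h])) he.2
    convert this
  · rintro ⟨i, j⟩ he hij
    simp only [hE, Finset.mem_filter, Finset.mem_univ, true_and] at he
    exact he.1 (congrArg Fin.val hij)
  · rintro ⟨i, j⟩ he
    simp only [hE, Finset.mem_filter, Finset.mem_univ, true_and] at he
    refine le_trans (le_of_eq ?_) he.2
    rw [leftCount, ← countBelow, ← card_filter_univ_eq_countBelow]
  · exact Nat.mul_le_mul_right _ (Nat.mul_le_mul_left _ hU)

theorem afterLayers_subset (Z : Finset Plane) (i : ℕ) : afterLayers Z i ⊆ Z := by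
  induction i with
  | zero => exact Finset.Subset.refl _
  | succ i ih => exact Finset.sdiff_subset.trans ih

theorem layerCount_le (t : ℕ) : layerCount (Finset.univ.map P) t ≤ n := by
  classical
  have : (Finset.univ.map P).card = n := by simp
  refine le_trans (Finset.card_le_card (t := Finset.univ.map P) fun x hx => ?_) this.le
  obtain ⟨i, -, hi⟩ := Finset.mem_biUnion.mp hx
  exact afterLayers_subset _ _ (Finset.mem_filter.mp hi).1

end input


/-! ### Correctness -/

section correctness

variable {n t : ℕ} (P : Fin n ↪ Plane)

/-- Once all lines have been dealt with, the result is at least as good as any bounding box of at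
least `n - t` points: by the flush lemma some box on a line through two of these points is as good,
and that line has at most `t` points on its left. -/
theorem reached_of_box {X Y : ℕ → ℝ} (h : GeneralPosition n X Y) (htn : t ≤ n) {s : State}
    (hD : ∀ p < n, ∀ q < n, Done n t X Y p q s) {T : Finset ℕ} (hTn : ∀ i ∈ T, i < n)
    (hT : 1 < T.card) (hcard : n - t ≤ T.card) {A u₁ u₂ : ℝ} (hu : 0 < u₁ * u₁ + u₂ * u₂)
    (hA : ∀ i ∈ T, ∀ j ∈ T, ∀ k ∈ T, ∀ l ∈ T,
      ((u₁ * X i + u₂ * Y i) - (u₁ * X j + u₂ * Y j)) *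
        ((u₁ * Y k - u₂ * X k) - (u₁ * Y l - u₂ * X l)) ≤ A * (u₁ * u₁ + u₂ * u₂)) :
    Reached s A := by
  obtain ⟨p, hp, q, hq, hpq, hpos, hbox⟩ := exists_flushBox h hTn hT hu hA
  have hcount : countBelow n (· ∈ T) = T.card := by
    unfold countBelow
    congr 1
    ext i
    simp only [Finset.mem_filter, Finset.mem_range]
    exact ⟨fun h => h.2, fun h => ⟨hTn i h, h⟩⟩
  have hle : leftCount n X Y p q ≤ t := by
    have h1 := leftCount_add (n := n) (X := X) (Y := Y) (p := p) (q := q)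
    have h2 : countBelow n (· ∈ T) ≤ countBelow n (fun i => ¬ depth X Y p q i < 0) :=
      countBelow_mono fun i _ hi => not_lt.mpr (hpos i hi)
    omega
  exact hD p (hTn p hp) q (hTn q hq) hpq hle (· ∈ T) A (fun i _ hi => hpos i hi)
    (by rw [hcount]; exact hcard)
    (fun k _ hk l _ hl r _ hr => hbox k hk l hl r hr)

/-- A rectangle is always found: all points together have a bounding box. -/
theorem reached_some {X Y : ℕ → ℝ} (h : GeneralPosition n X Y) (htn : t ≤ n) (hn : 2 ≤ n)
    {s : State} (hD : ∀ p < n, ∀ q < n, Done n t X Y p q s) : ∃ A, Reached s A := by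
  obtain ⟨A, hA⟩ := (((Finset.range n ×ˢ Finset.range n) ×ˢ
    (Finset.range n ×ˢ Finset.range n)).image fun v =>
      (X v.1.1 - X v.1.2) * (Y v.2.1 - Y v.2.2)).exists_le
  refine ⟨A, reached_of_box h htn hD (T := Finset.range n) (fun i hi => Finset.mem_range.mp hi)
    (by rw [Finset.card_range]; exact hn) (by simp) (u₁ := 1) (u₂ := 0) (by norm_num) ?_⟩
  intro i hi j hj k hk l hl
  have := hA _ (Finset.mem_image_of_mem _ (a := ((i, j), (k, l)))
    (by simp only [Finset.mem_product]; exact ⟨⟨hi, hj⟩, hk, hl⟩))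
  simpa using this

/-- The result is a smallest rectangle, as every rectangle with enough points is matched by a box on
a line that has been dealt with. -/
theorem isMER_of_done {s : State} (htn : 2 * t < n) (hX : NoThreeCollinear (Finset.univ.map P))
    (hS : Sound (fun r => r.corner = !₂[coordinate P 0 0, coordinate P 1 0] ∧ r.area = 0)
      (fun r => 2 ≤ n ∧ n - t ≤ r.enclosed (Finset.univ.map P)) s)
    (hD : ∀ p < n, ∀ q < n, Done n t (coordinate P 0) (coordinate P 1) p q s) :
    ∃ r : Rectangle, Outputs s r ∧ r.IsMER (Finset.univ.map P) t := by
  classical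
  have h := generalPosition_of_noThreeCollinear P hX
  have hcard : (Finset.univ.map P).card = n := by simp
  obtain ⟨r, hr, hinit, hfound⟩ := hS
  refine ⟨r, hr, ?_⟩
  unfold Rectangle.IsMER
  rw [hcard]
  by_cases hn : 2 ≤ n
  · obtain ⟨A, hA⟩ := reached_some h (by omega) hn hD
    obtain ⟨⟨-, henc⟩, harea⟩ := hfound hA.1
    refine ⟨henc, fun r' hr' => ?_⟩
    rw [harea]
    set T : Finset ℕ := (Finset.range n).filter
      (fun i => ∃ h : i < n, P ⟨i, h⟩ ∈ r'.region) with hTdef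
    have hTcard : r'.enclosed (Finset.univ.map P) = T.card := by
      rw [enclosed_eq P r' (fun i => ∃ h : i < n, P ⟨i, h⟩ ∈ r'.region) fun i => by simp,
        countBelow, hTdef]
      congr
    have hTn : ∀ i ∈ T, i < n := fun i hi => Finset.mem_range.mp (Finset.mem_filter.mp hi).1
    have hT1 : 1 < T.card := by omega
    obtain ⟨u₁, u₂, hu, hbox⟩ := r'.exists_direction (X := coordinate P 0) (Y := coordinate P 1)
      (T := T)
      (fun i hi => by
        obtain ⟨-, hin, hm⟩ := Finset.mem_filter.mp hi
        exact ⟨_, hm, (coordinate_val P 0 ⟨i, hin⟩).symm, (coordinate_val P 1 ⟨i, hin⟩).symm⟩)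
      (by
        obtain ⟨i, hi, j, hj, hij⟩ := Finset.one_lt_card.mp hT1
        exact ⟨i, hi, j, hj, fun he => hij (h.injective i (hTn i hi) j (hTn j hj) he.1 he.2)⟩)
    exact (reached_of_box h (by omega) hD hTn hT1 (by omega) hu hbox).2
  · -- a single point: the result is the point itself
    have h1 : n = 1 := by omega
    have hzero : s.ivar v_found = 0 := by
      by_contra hne
      exact hn (hfound (Nat.pos_of_ne_zero hne)).1.1
    obtain ⟨hc, ha⟩ := hinit hzero
    refine ⟨?_, fun r' _ => ?_⟩
    · refine (Nat.sub_le n t).trans ?_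
      rw [enclosed_eq P r (fun _ => True)]
      · simp [countBelow]
      · intro i
        have hi : (i : ℕ) = 0 := by omega
        simp only [iff_true]
        refine ⟨0, by simp, 0, by simp, ?_⟩
        have h0 := coordinate_val P 0 i
        have h1 := coordinate_val P 1 i
        rw [hi] at h0 h1
        rw [hc, h0, h1]
        exact plane_ext (by simp) (by simp)
    · rw [ha]
      exact mul_nonneg (norm_nonneg _) (norm_nonneg _)

/-! ### The number of steps -/

/-- It follows that the square of the logarithm is at most linear. -/
theorem sq_le_two_mul_two_pow (m : ℕ) : m * m ≤ 2 * 2 ^ m := by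
  induction m with
  | zero => simp
  | succ m ih =>
    rcases Nat.lt_or_ge m 3 with h | h
    · interval_cases m <;> norm_num
    · rw [pow_succ]
      nlinarith

theorem edgeCost_le (hn : 1 ≤ n) : edgeCost n t ≤ 1300 * (n + (t + 1) * (t + 1)) := by
  unfold edgeCost
  set L := Nat.log 2 (2 * n) with hL
  have h1 : 2 ^ L ≤ 2 * n := Nat.pow_log_le_self 2 (by omega)
  have h2 := sq_le_two_mul_two_pow L
  have h3 : 2 * ((t + 1) * L) ≤ (t + 1) * (t + 1) + L * L := by
    zify
    nlinarith [sq_nonneg ((t : ℤ) + 1 - L)]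
  nlinarith

/-- Here `k` stands for the number of points on the first `t + 1` layers and `E` for the number of
lines that are searched. -/
theorem total_le {k E : ℕ} (hn : 2 ≤ n) (hk : k ≤ n) (hE : E ≤ 4 * k * (t + 1)) :
    60 + 400 * n + 500 * n * n + n * n * (50 * Nat.log 2 (2 * n)) + E * edgeCost n t ≤
      20000 * (n * n) + 50 * (n * n * Nat.log 2 (2 * n)) + 50000 * (k * t ^ 3 + k * t * n) := by
  have h1 := edgeCost_le (n := n) (t := t) (by omega)
  have h2 : k * (t + 1) * (n + (t + 1) * (t + 1)) ≤
      2 * (n * n) + 8 * (k * t ^ 3 + k * t * n) := by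
    rcases Nat.eq_zero_or_pos t with rfl | ht
    · -- the one place where `k` is not multiplied by `t`: `k n` is absorbed by `n ^ 2 log n`
      have : k * n ≤ n * n := Nat.mul_le_mul_right n hk
      nlinarith
    · have h3 : t + 1 ≤ 2 * t := by omega
      calc k * (t + 1) * (n + (t + 1) * (t + 1))
          ≤ k * (2 * t) * (n + (2 * t) * (2 * t)) := by gcongr
        _ = 2 * (k * t * n) + 8 * (k * t ^ 3) := by ring
        _ ≤ _ := by nlinarith [Nat.zero_le (k * t * n), Nat.zero_le (n * n)]
  have h4 : E * edgeCost n t ≤ 5200 * (k * (t + 1) * (n + (t + 1) * (t + 1))) :=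
    (Nat.mul_le_mul hE h1).trans (by ring_nf; exact le_rfl)
  have h5 : 2 * n ≤ n * n := Nat.mul_le_mul_right n hn
  have h6 : n * n * (50 * Nat.log 2 (2 * n)) = 50 * (n * n * Nat.log 2 (2 * n)) := by ring
  have h7 : 500 * n * n = 500 * (n * n) := by ring
  rw [h6, h7]
  omega

theorem one_le_two_mul_log (hn : 2 ≤ n) : 1 ≤ 2 * Real.log n := by
  have h1 : Real.log 2 ≤ Real.log n := Real.log_le_log (by norm_num) (by exact_mod_cast hn)
  linarith [Real.log_two_gt_d9]

theorem natLog_le_four_mul_log (hn : 2 ≤ n) : (Nat.log 2 (2 * n) : ℝ) ≤ 4 * Real.log n := by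
  have h1 : Real.log 2 ≤ Real.log n := Real.log_le_log (by norm_num) (by exact_mod_cast hn)
  have h2 : ((2 ^ Nat.log 2 (2 * n) : ℕ) : ℝ) ≤ ((2 * n : ℕ) : ℝ) := by
    exact_mod_cast Nat.pow_log_le_self 2 (by omega)
  have hn0 : (n : ℝ) ≠ 0 := by positivity
  have h3 := Real.log_le_log (by positivity) h2
  push_cast at h3
  rw [Real.log_pow, Real.log_mul (by norm_num) hn0] at h3
  have h4 := Real.log_two_gt_d9
  have h5 : (0 : ℝ) ≤ Nat.log 2 (2 * n) := Nat.cast_nonneg _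
  nlinarith

theorem steps_le {T k : ℕ} (hn : 2 ≤ n) (hk : k ≤ n)
    (hT : T ≤ 20000 * (n * n) + 50 * (n * n * Nat.log 2 (2 * n)) +
      50000 * (k * t ^ 3 + k * t * n)) :
    (T : ℝ) ≤ 50000 * ((k : ℝ) * (t : ℝ) ^ 3 + (k : ℝ) * (t : ℝ) * (n : ℝ) +
        (n : ℝ) ^ 2 * Real.log n) ∧
      (T : ℝ) ≤ 50000 * ((n : ℝ) ^ 2 * Real.log n + (n : ℝ) ^ 2 * (t : ℝ) +
        (n : ℝ) * (t : ℝ) ^ 3) := by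
  have hT' : (T : ℝ) ≤ 20000 * ((n : ℝ) * n) + 50 * ((n : ℝ) * n * (Nat.log 2 (2 * n) : ℕ)) +
      50000 * ((k : ℝ) * (t : ℝ) ^ 3 + (k : ℝ) * t * n) := by exact_mod_cast hT
  have hk' : (k : ℝ) ≤ n := by exact_mod_cast hk
  have hnn : (0 : ℝ) ≤ (n : ℝ) * n := by positivity
  have h1 := mul_le_mul_of_nonneg_left (one_le_two_mul_log hn) hnn
  have h2 := mul_le_mul_of_nonneg_left (natLog_le_four_mul_log hn) hnn
  have h3 : (0 : ℝ) ≤ Real.log n := by linarith [one_le_two_mul_log hn]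
  have h3' : 0 ≤ (n : ℝ) * n * Real.log n := mul_nonneg hnn h3
  have h4 : (k : ℝ) * (t : ℝ) ^ 3 ≤ (n : ℝ) * (t : ℝ) ^ 3 :=
    mul_le_mul_of_nonneg_right hk' (by positivity)
  have h5 : (k : ℝ) * t * n ≤ (n : ℝ) * t * n := by gcongr
  constructor <;> nlinarith

end correctness

end RealRAM

theorem theorem1 :
    ∃ (prog : RealRAM.Prog) (C : ℝ), ∀ (n t : ℕ) (p : Fin n ↪ Plane),
      2 * t < n → NoThreeCollinear (Finset.univ.map p) →
        ∃ (T : ℕ) (s : RealRAM.State),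
          RealRAM.Exec prog (RealRAM.input n t p) T s ∧
          (∃ r : Rectangle, RealRAM.Outputs s r ∧ r.IsMER (Finset.univ.map p) t) ∧
          (2 ≤ n →
            (T : ℝ) ≤ C * ((layerCount (Finset.univ.map p) t : ℝ) * (t : ℝ) ^ 3
              + (layerCount (Finset.univ.map p) t : ℝ) * (t : ℝ) * (n : ℝ)
              + (n : ℝ) ^ 2 * Real.log (n : ℝ)) ∧
            (T : ℝ) ≤ C * ((n : ℝ) ^ 2 * Real.log (n : ℝ)
              + (n : ℝ) ^ 2 * (t : ℝ) + (n : ℝ) * (t : ℝ) ^ 3)) := by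
  open RealRAM in
  refine ⟨Prog.algorithm, 50000, fun n t P htn hX => ?_⟩
  have h := generalPosition_of_noThreeCollinear P hX
  have hEncl : ∀ p < n, ∀ q < n, p ≠ q → ∀ x₁ x₂ y, n - t ≤ countBelow n (fun i =>
      x₁ ≤ along (coordinate P 0) (coordinate P 1) p q i ∧
      along (coordinate P 0) (coordinate P 1) p q i ≤ x₂ ∧
      0 ≤ depth (coordinate P 0) (coordinate P 1) p q i ∧
      depth (coordinate P 0) (coordinate P 1) p q i ≤ y) →
      2 ≤ n ∧ n - t ≤ (frameRect (coordinate P 0) (coordinate P 1) p q x₁ x₂ y).enclosed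
        (Finset.univ.map P) := by
    intro p hp q hq hpq x₁ x₂ y hc
    refine ⟨by omega, hc.trans ?_⟩
    rw [enclosed_eq P _ (fun i => ∃ h : i < n, P ⟨i, h⟩ ∈
      (frameRect (coordinate P 0) (coordinate P 1) p q x₁ x₂ y).region) fun i => by simp]
    refine countBelow_mono fun i hi hQ => ⟨hi, ?_⟩
    exact mem_region_frameRect (h.sqDist_pos hp hq hpq) hQ.1 hQ.2.1 hQ.2.2.1 hQ.2.2.2
      (coordinate_val P 0 ⟨i, hi⟩).symm (coordinate_val P 1 ⟨i, hi⟩).symm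
  obtain ⟨T, s, hexec, hT, hQ⟩ := run_algorithm (t := t) h (by omega) hEncl
    (Encl := fun r => 2 ≤ n ∧ n - t ≤ r.enclosed (Finset.univ.map P))
    (Init := fun r => r.corner = !₂[coordinate P 0 0, coordinate P 1 0] ∧ r.area = 0)
    (s := input n t P) rfl rfl (by funext i; simp [input, coordinate])
    (by funext i; simp [input, coordinate]) rfl (fun _ => rfl) ⟨rfl, by simp [Rectangle.area]⟩
  refine ⟨T, s, hexec, isMER_of_done P htn hX hQ.1 hQ.2, fun hn => ?_⟩
  exact steps_le hn (layerCount_le P t)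
    (hT.trans (total_le hn (layerCount_le P t) (edgeCount_le P h)))
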